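/- Let $a,b\in\mathbb C\setminus\{0\}$, $E(z)=ae^z+be^{-z}$, and $F(t)=e^t-1$. A point $z$ is *escaping* if $|E^{\circ k}(z)|\to\infty$. **Symbols.** Let $c=\frac12\ln(b/a)$ with $|\operatorname{Im}c|\le\pi/2$, and let $v_1=E(c)$, $v_2=E(c+i\pi)$ be the critical values. Let $\mathcal A$ be the union of the segment $[v_1,v_2]$ and the vertical ray starting at $v_1$ (upwards if $\operatorname{Im}v_1\ge\operatorname{Im}v_2$, downwards otherwise). The connected components of $E^{-1}(\mathbb C\setminus\mathcal A)$ are labelled bijectively as $R_j$, $j\in\mathbb Z\times\{L,R\}$, such that $R_{(n+1,\cdot)}=R_{(n,\cdot)}+2\pi i$, $\overline{R_{(0,R)}}$ contains $[x,\infty)$ and $\overline{R_{(0,L)}}$ contains $(-\infty,-x]$ for some real $x$. For $\underline s=s_1s_2\ldots$ with $s_k\in\mathbb Z\times\{L,R\}$, a point $z$ has *external address* $\underline s$ if $E^{\circ k}(z)\in R_{s_{k+1}}\setminus\mathcal A$ for all $k\ge0$. Let $\sigma$ be the shift, put $|(n,L)|=|(n,R)|=|n|$, and in formulas write $n$ for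 $(n,L)$ and $(n,R)$. Call $\underline s$ *exponentially bounded* if for some $x>0$ one has $|s_k|\le F^{\circ(k-1)}(x)$ for all $k\ge1$. Its *minimal potential* is $t_{\underline s}=\inf\{t>0:\ |s_k|/F^{\circ(k-1)}(t)\to0\}$. **Ray tails.** A *ray tail* with external address $\underline s$ is an injective continuous curve $g:[\tau,\infty)\to\mathbb C$ ($\tau>0$) of escaping points with external address $\underline s$, such that $\operatorname{Re}g(t)\to+\infty$ or $\operatorname{Re}g(t)\to-\infty$ as $t\to\infty$, and such that for each $t\ge\tau$, as $k\to\infty$, $E^{\circ k}(g(t))=\pm F^{\circ k}(t)+2\pi i s_{k+1}+O(1)$, with sign $+$ if $s_{k+1}\in\mathbb Z\times\{R\}$ and $-$ otherwise. Let $M=\max\{|\ln a|,|\ln b|\}$ (principal branches) and let $T_{a,b}$ be the least number with $$T_{a,b}\ge\max\Big\{\sqrt{|2b/a|}\,(|a|+|b|),\ \sqrt{|2a/b|}\,(|a|+|b|),\ 8|ab|,\ 1,\ \tfrac12\ln|2b/a|,\ \tfrac12\ln|2a/b|,\ \ln\tfrac4{|a|},\ \ln\tfrac4{|b|}\Big\}+M+2$$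 and $F(T_{a,b})\ge T_{a,b}+M+4$. Let $T_{\underline s}$ be the infimum of all $T\ge T_{a,b}$ such that $4\pi|s_{n+1}|<F^{\circ n}(T)$ for all $n\ge0$. **Dynamic rays.** Let $\underline s$ be exponentially bounded. A *dynamic ray* at $\underline s$ is a curve $g_{\underline s}:(\tau,\infty)\to\mathbb C$ that belongs to a sequence of injective continuous curves $g_{\sigma^n(\underline s)}:(F^{\circ n}(\tau),\infty)\to\mathbb C$, $n\ge0$, of escaping points with the following properties: * $E(g_{\sigma^n(\underline s)}(t))=g_{\sigma^{n+1}(\underline s)}(F(t))$ for all $n\ge0$ and $t>F^{\circ n}(\tau)$; * for every $n\ge0$ and $T>T_{\sigma^n(\underline s)}$, the restriction of $g_{\sigma^n(\underline s)}$ to $[T,\infty)$ is a ray tail with external address $\sigma^n(\underline s)$; * $g_{\sigma^n(\underline s)}(t)\notin\{v_1,v_2\}$ for all $n\ge1$ and $t>F^{\circ n}(\tau)$; * either $\tau=t_{\underline s}$, or (the exceptional case, possible only if a critical orbit escapes) $\tau>t_{\underline s}$ and $\lim_{t\searrow F^{\circ n}(\tau)}g_{\sigma^n(\underline s)}(t)\in\{v_1,v_2\}$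 for some $n\ge1$. The ray *lands* at $w\in\mathbb C$ if $\lim_{t\searrow\tau}g_{\underline s}(t)=w$. **Claim.** If a dynamic ray $g_{\underline s}:(\tau,\infty)\to\mathbb C$ lands at an escaping point $w$, then the ray and its landing point escape uniformly: for every $r\in\mathbb R$ there is an $N\ge0$ such that for all $n\ge N$ one has $|\operatorname{Re}E^{\circ n}(w)|>r$ and $|\operatorname{Re}E^{\circ n}(g_{\underline s}(t))|>r$ for all $t>\tau$. -/

import Mathlib

namespace CosineFamily

open Filter Topology Set

/-- The cosine map `E(z) = a e^z + b e^{-z}`. -/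
noncomputable def cosMap (a b z : ℂ) : ℂ := a * Complex.exp z + b * Complex.exp (-z)

/-- Escaping points: `|E^k(z)| → ∞`. -/
def IsEscaping (a b z : ℂ) : Prop :=
  Tendsto (fun k : ℕ => ‖(cosMap a b)^[k] z‖) atTop atTop

/-! ### The partition of the plane -/

/-- `c = (1/2) ln (b/a)`, for a branch of the logarithm with `|Im c| ≤ π/2`. (There are two such
numbers `c` if `b/a` is a negative real number.) -/
def IsCritCentre (a b c : ℂ) : Prop :=
  Complex.exp (2 * c) = b / a ∧ |c.im| ≤ Real.pi / 2

/-- The critical value `v₁ = E(c)`. -/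
noncomputable def critVal₁ (a b c : ℂ) : ℂ := cosMap a b c

/-- The critical value `v₂ = E(c + iπ)`. -/
noncomputable def critVal₂ (a b c : ℂ) : ℂ := cosMap a b (c + Real.pi * Complex.I)

/-- The slit `𝒜`: the segment between the critical values together with the vertical ray that
starts at `v₁` and points away from `v₂` (upwards if `Im v₁ ≥ Im v₂`, downwards otherwise). -/
noncomputable def slit (a b c : ℂ) : Set ℂ :=
  segment ℝ (critVal₁ a b c) (critVal₂ a b c) ∪
    {z | z.re = (critVal₁ a b c).re ∧
      (((critVal₂ a b c).im ≤ (critVal₁ a b c).im ∧ (critVal₁ a b c).im ≤ z.im) ∨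
        ((critVal₁ a b c).im < (critVal₂ a b c).im ∧ z.im ≤ (critVal₁ a b c).im))}

/-- The open set `E⁻¹(ℂ \ 𝒜)`, whose connected components are the strips. -/
noncomputable def stripDomain (a b c : ℂ) : Set ℂ := cosMap a b ⁻¹' (slit a b c)ᶜ

/-- The two letters `L` and `R`. -/
inductive Side
  | L
  | R

/-- The symbols `n_L`, `n_R` for `n ∈ ℤ`. -/
abbrev Symbol := ℤ × Side

/-- External addresses. The entry `s k` is the `(k+1)`-st entry of the sequence. -/
abbrev Address := ℕ → Symbol

/-- The `n`-fold shift. -/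
def shift (n : ℕ) (s : Address) : Address := fun k => s (k + n)

/-- `|n_L| = |n_R| = |n|`. -/
noncomputable def size (j : Symbol) : ℝ := |(j.1 : ℝ)|

/-- `+1` for `n_R` and `-1` for `n_L`. -/
def Side.sign : Side → ℝ
  | .L => -1
  | .R => 1

/-- `R` enumerates, without repetition, the connected components of `E⁻¹(ℂ \ 𝒜)`; translation by
`2πi` raises the label by one; the closure of `R_{0_R}` contains a right end of the real line, and
the closure of `R_{0_L}` contains a left end of it. -/
structure IsStripLabelling (a b c : ℂ) (R : Symbol → Set ℂ) : Prop where
  component : ∀ j, ∃ z ∈ stripDomain a b c, R j = connectedComponentIn (stripDomain a b c) z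
  injective : Function.Injective R
  covers : ∀ z ∈ stripDomain a b c, ∃ j, z ∈ R j
  translate : ∀ (n : ℤ) (σ : Side) (z : ℂ),
    z ∈ R (n, σ) ↔ z + 2 * Real.pi * Complex.I ∈ R (n + 1, σ)
  right_zero : ∃ x₀ : ℝ, ∀ x : ℝ, x₀ ≤ x → (x : ℂ) ∈ closure (R (0, Side.R))
  left_zero : ∃ x₀ : ℝ, ∀ x : ℝ, x ≤ x₀ → (x : ℂ) ∈ closure (R (0, Side.L))

/-- The orbit of `z` stays in `ℂ \ 𝒜`, and `z` has external address `s`. -/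
def HasAddress (a b c : ℂ) (R : Symbol → Set ℂ) (s : Address) (z : ℂ) : Prop :=
  ∀ k : ℕ, (cosMap a b)^[k] z ∉ slit a b c ∧ (cosMap a b)^[k] z ∈ R (s k)

/-! ### Potentials -/

/-- `F(t) = e^t - 1`. -/
noncomputable def F (t : ℝ) : ℝ := Real.exp t - 1

/-- Exponentially bounded external addresses. -/
def ExpBounded (s : Address) : Prop :=
  ∃ x : ℝ, 0 < x ∧ ∀ k : ℕ, size (s k) ≤ F^[k] x

/-- The minimal potential `t_s` (finite, and used here only, for exponentially bounded `s`). -/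
noncomputable def minPotential (s : Address) : ℝ :=
  sInf {t : ℝ | 0 < t ∧ Tendsto (fun k : ℕ => size (s k) / F^[k] t) atTop (𝓝 0)}

/-- `M = max {|ln a|, |ln b|}`, for branches whose imaginary parts lie in `[-π, π]`. -/
noncomputable def logBound (a b : ℂ) : ℝ := max ‖Complex.log a‖ ‖Complex.log b‖

/-- The lower bound that is imposed on `T_{a,b}`. -/
noncomputable def baseBound (a b : ℂ) : ℝ :=
  max (Real.sqrt ‖2 * b / a‖ * (‖a‖ + ‖b‖))
    (max (Real.sqrt ‖2 * a / b‖ * (‖a‖ + ‖b‖))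
      (max (8 * ‖a * b‖)
        (max 1
          (max (1 / 2 * Real.log ‖2 * b / a‖)
            (max (1 / 2 * Real.log ‖2 * a / b‖)
              (max (Real.log (4 / ‖a‖)) (Real.log (4 / ‖b‖)))))))) + logBound a b + 2

/-- `T_{a,b}`: the least number above `baseBound` with `F(T) ≥ T + M + 4`. -/
noncomputable def mapPotential (a b : ℂ) : ℝ :=
  sInf {T : ℝ | baseBound a b ≤ T ∧ T + logBound a b + 4 ≤ F T}

/-- `T_s`: the infimum of all `T ≥ T_{a,b}` with `4π |s_{n+1}| < F^n(T)` for all `n ≥ 0`. -/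
noncomputable def tailPotential (a b : ℂ) (s : Address) : ℝ :=
  sInf {T : ℝ | mapPotential a b ≤ T ∧ ∀ n : ℕ, 4 * Real.pi * size (s n) < F^[n] T}

/-! ### Ray tails and dynamic rays -/

/-- `g`, restricted to `[τ, ∞)`, is a ray tail with external address `s`. -/
structure IsRayTail (a b c : ℂ) (R : Symbol → Set ℂ) (s : Address) (τ : ℝ) (g : ℝ → ℂ) :
    Prop where
  pos : 0 < τ
  continuousOn : ContinuousOn g (Ici τ)
  injOn : InjOn g (Ici τ)
  escaping : ∀ t, τ ≤ t → IsEscaping a b (g t)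
  address : ∀ t, τ ≤ t → HasAddress a b c R s (g t)
  re_tendsto : Tendsto (fun t => (g t).re) atTop atTop ∨ Tendsto (fun t => (g t).re) atTop atBot
  asymptotics : ∀ t, τ ≤ t → ∃ C : ℝ, ∀ k : ℕ,
    ‖(cosMap a b)^[k] (g t) -
      (((s k).2.sign * F^[k] t : ℝ) + 2 * Real.pi * Complex.I * ((s k).1 : ℂ))‖ ≤ C

/-- `G n`, restricted to `(F^n(τ), ∞)`, is the dynamic ray at the `n`-th shift of `s`: all these
curves are injective, consist of escaping points, extend the ray tails, and are related by the
functional equation `E(g_s(t)) = g_{σ(s)}(F(t))`. The initial potential `τ` is the minimal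
potential `t_s` if no critical value lies on one of the curves `G n` with `n ≥ 1`; otherwise the
pull-back stops at the largest potential `τ > t_s` at which one of them meets a critical value. -/
structure IsRaySequence (a b c : ℂ) (R : Symbol → Set ℂ) (s : Address) (τ : ℝ)
    (G : ℕ → ℝ → ℂ) : Prop where
  expBounded : ExpBounded s
  continuousOn : ∀ n, ContinuousOn (G n) (Ioi (F^[n] τ))
  injOn : ∀ n, InjOn (G n) (Ioi (F^[n] τ))
  escaping : ∀ n, ∀ t, F^[n] τ < t → IsEscaping a b (G n t)
  functional : ∀ n, ∀ t, F^[n] τ < t → cosMap a b (G n t) = G (n + 1) (F t)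
  tail : ∀ n, ∀ T, tailPotential a b (shift n s) < T → IsRayTail a b c R (shift n s) T (G n)
  avoids : ∀ n, 1 ≤ n → ∀ t, F^[n] τ < t → G n t ≠ critVal₁ a b c ∧ G n t ≠ critVal₂ a b c
  initial : τ = minPotential s ∨
    (minPotential s < τ ∧ ∃ n, 1 ≤ n ∧
      (Tendsto (G n) (𝓝[>] (F^[n] τ)) (𝓝 (critVal₁ a b c)) ∨
        Tendsto (G n) (𝓝[>] (F^[n] τ)) (𝓝 (critVal₂ a b c))))

/-- `g`, restricted to `(τ, ∞)`, is the dynamic ray at external address `s`. -/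
def IsDynamicRay (a b c : ℂ) (R : Symbol → Set ℂ) (s : Address) (τ : ℝ) (g : ℝ → ℂ) : Prop :=
  ∃ G : ℕ → ℝ → ℂ, G 0 = g ∧ IsRaySequence a b c R s τ G

/-- The ray `g : (τ, ∞) → ℂ` lands at `w`. -/
def LandsAt (τ : ℝ) (g : ℝ → ℂ) (w : ℂ) : Prop := Tendsto g (𝓝[>] τ) (𝓝 w)

/-- The ray `g : (τ, ∞) → ℂ` and its landing point `w` escape uniformly. -/
def EscapeUniformly (a b : ℂ) (τ : ℝ) (g : ℝ → ℂ) (w : ℂ) : Prop :=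
  ∀ r : ℝ, ∃ N : ℕ, ∀ n : ℕ, N ≤ n →
    r < |((cosMap a b)^[n] w).re| ∧ ∀ t, τ < t → r < |((cosMap a b)^[n] (g t)).re|

end CosineFamily

namespace CosineFamily

open Filter Topology Set

/-! ### Planar topology: paths that have to meet -/

/-! Fix a large `K`. If one point of the ray has an orbit that stays in `|Re z| ≥ K` from time `n`
on, then so do, up to an additive constant, all points of higher potential (`LandingRay.up`):
comparisons of far iterates pull back under `E` with bounded loss. Hence uniform escape can fail
only if, for every `n`, all ray points close enough to the landing point enter `|Re z| < K` at some
time `≥ n`. This is `NoUniformTime`, which `LandingRay.not_noUniformTime` refutes.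

Suppose it holds. An arc in `|Re z| ≥ K` of vertical extent at least `4π` has a subarc whose image
is again such an arc, so it contains a point whose orbit stays far forever
(`Growth.exists_orbit_far_forever`). Near the landing point this is forbidden. Therefore some nearby
ray points keep within `4π` of the heights of the landing orbit until they reach `|Re z| ≤ K`
(`LandingRay.exists_exit`). Going backwards from that exit, low heights force small real parts, so
the landing point cannot escape at the speed of a potential that exceeds the growth of its heights
(`LandingRay.false_of_fast`). Two consequences follow. The forward images of the ray with its
landing point are pairwise disjoint (`LandingRay.orbit_ne`). And the heights of the landing orbit
cannot be comparable with those of the address: otherwise the landing point would escape more slowly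
than every ray point, and pulling back would keep the ray as far out as the landing orbit
(`LandingRay.false_of_height`).

Plane topology shows that these heights are comparable after all. A far point of the landing orbit
is joined to infinity by a nearly horizontal path, `k` iterates of which stay far
(`Growth.exists_path`); with the image of the ray it forms a curve with two ends at infinity. By
compactness, ray points at intermediate heights return near the imaginary axis within a bounded
number of steps (`LandingRay.exists_return_time`), so they avoid the `2πi`-translates of the path
when `k` is that number. If at some late time the two ends lie in opposite half-planes, translates
of the curve would separate later images of the ray from their landing points unless the heights
agree up to a constant (`LandingRay.height_of_opposite`). If the ends always lie in the same
half-plane, the curve is a hairpin that would meet its own translate unless its two ends have nearby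
heights (`LandingRay.height_of_same`). -/

lemma exists_log_on_rectangle {a b c d : ℝ} (hab : a ≤ b) (hcd : c ≤ d) {h : ℝ → ℝ → ℂ}
    (hc : ContinuousOn (fun p : ℝ × ℝ => h p.1 p.2) (Icc a b ×ˢ Icc c d))
    (h0 : ∀ s ∈ Icc a b, ∀ t ∈ Icc c d, h s t ≠ 0) :
    ∃ L : ℝ → ℝ → ℂ, ContinuousOn (fun p : ℝ × ℝ => L p.1 p.2) (Icc a b ×ˢ Icc c d) ∧
      ∀ s ∈ Icc a b, ∀ t ∈ Icc c d, Complex.exp (L s t) = h s t := by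
  -- Clamping the coordinates extends `h` to the whole plane without creating zeros, and the plane
  -- is simply connected.
  set g : ℝ × ℝ → ℂ := fun p => h (projIcc a b hab p.1) (projIcc c d hcd p.2) with hg
  have hgc : Continuous g := by
    have h1 : Continuous (fun p : ℝ × ℝ =>
        ((projIcc a b hab p.1 : ℝ), (projIcc c d hcd p.2 : ℝ))) := by fun_prop
    exact hc.comp_continuous h1 fun p => ⟨(projIcc a b hab p.1).2, (projIcc c d hcd p.2).2⟩
  have hsc : IsSimplyConnected (univ : Set (ℝ × ℝ)) := by
    have := (convex_univ (𝕜 := ℝ) (E := ℝ × ℝ)).contractibleSpace univ_nonempty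
    exact SimplyConnectedSpace.ofContractible _
  obtain ⟨f, hf, hfe⟩ := Complex.exists_continuousOn_eqOn_exp_comp hsc isOpen_univ
    hgc.continuousOn (by
      rintro ⟨p, -, hp⟩
      exact h0 _ (projIcc a b hab p.1).2 _ (projIcc c d hcd p.2).2 hp)
  refine ⟨fun s t => f (s, t), hf.mono (subset_univ _), fun s hs t ht => ?_⟩
  have := hfe (mem_univ (s, t))
  simpa [hg, projIcc_of_mem hab hs, projIcc_of_mem hcd ht] using this

/-- Both `L` and the principal logarithm of `e * k` are continuous logarithms up to a constant, so
their difference varies continuously in a translate of `2πi ℤ` and is constant. -/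
lemma log_increment {a b : ℝ} (hab : a ≤ b) {k L : ℝ → ℂ} (hL : ContinuousOn L (Icc a b))
    (hk : ContinuousOn k (Icc a b)) (he : ∀ t ∈ Icc a b, Complex.exp (L t) = k t) {e : ℂ}
    (hs : ∀ t ∈ Icc a b, e * k t ∈ Complex.slitPlane) :
    L b - L a = Complex.log (e * k b) - Complex.log (e * k a) := by
  have ha : a ∈ Icc a b := left_mem_Icc.2 hab
  have hb : b ∈ Icc a b := right_mem_Icc.2 hab
  set φ : ℝ → ℂ := fun t => (L t - Complex.log (e * k t)) - (L a - Complex.log (e * k a)) with hφ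
  have hne : ∀ t ∈ Icc a b, e * k t ≠ 0 := fun t ht => Complex.slitPlane_ne_zero (hs t ht)
  have hφc : ContinuousOn φ (Icc a b) :=
    (hL.sub ((continuousOn_const.mul hk).clog hs)).sub continuousOn_const
  have h1 : ∀ t ∈ Icc a b, ∃ n : ℤ, φ t = n * (2 * Real.pi * Complex.I) := by
    intro t ht
    rw [← Complex.exp_eq_one_iff, hφ]
    have := hne t ht
    have h2 := hne a ha
    have h3 : e ≠ 0 := left_ne_zero_of_mul h2
    have h4 : k a ≠ 0 := right_ne_zero_of_mul h2
    have h5 : k t ≠ 0 := right_ne_zero_of_mul this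
    simp only [Complex.exp_sub, Complex.exp_log this, Complex.exp_log h2, he t ht, he a ha]
    field_simp
  have hψc : ContinuousOn (fun t => (φ t).im / (2 * Real.pi)) (Icc a b) :=
    (Complex.continuous_im.comp_continuousOn hφc).div_const _
  have hψ : ∀ t ∈ Icc a b, ∀ n : ℤ, φ t = n * (2 * Real.pi * Complex.I) →
      (φ t).im / (2 * Real.pi) = n := by
    intro t _ n hn
    rw [hn]
    simp
  have hφa : φ a = 0 := by simp [hφ]
  suffices h : φ b = 0 by
    have h' : (L b - Complex.log (e * k b)) - (L a - Complex.log (e * k a)) = 0 := h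
    linear_combination h'
  obtain ⟨n, hn⟩ := h1 b hb
  by_contra hcon
  have hn0 : n ≠ 0 := by rintro rfl; simp at hn; exact hcon hn
  have hb' := hψ b hb n hn
  have ha' : (φ a).im / (2 * Real.pi) = 0 := by simp [hφa]
  -- A continuous integer-valued function that goes from `0` to `n ≠ 0` would take the value `±1/2`;
  -- parity excludes it.
  have key : ∃ t ∈ Icc a b, (φ t).im / (2 * Real.pi) = (n.sign : ℝ) / 2 := by
    rcases lt_or_gt_of_ne hn0 with hneg | hpos
    · have hm : (n.sign : ℝ) / 2 ∈ Icc ((φ b).im / (2 * Real.pi)) ((φ a).im / (2 * Real.pi)) := by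
        rw [hb', ha', Int.sign_eq_neg_one_of_neg hneg]
        have : (n : ℝ) ≤ -1 := by exact_mod_cast Int.le_sub_one_of_lt hneg
        constructor <;> push_cast <;> linarith
      obtain ⟨t, ht, h⟩ := intermediate_value_Icc' hab hψc hm
      exact ⟨t, ht, h⟩
    · have hm : (n.sign : ℝ) / 2 ∈ Icc ((φ a).im / (2 * Real.pi)) ((φ b).im / (2 * Real.pi)) := by
        rw [hb', ha', Int.sign_eq_one_of_pos hpos]
        have : (1 : ℝ) ≤ n := by exact_mod_cast hpos
        constructor <;> push_cast <;> linarith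
      obtain ⟨t, ht, h⟩ := intermediate_value_Icc hab hψc hm
      exact ⟨t, ht, h⟩
  obtain ⟨t, ht, h⟩ := key
  obtain ⟨m, hm⟩ := h1 t ht
  rw [hψ t ht m hm] at h
  have h2 : (2 * m : ℤ) = n.sign := by
    have : (2 * m : ℝ) = n.sign := by linarith
    exact_mod_cast this
  rcases lt_or_gt_of_ne hn0 with hneg | hpos
  · rw [Int.sign_eq_neg_one_of_neg hneg] at h2; omega
  · rw [Int.sign_eq_one_of_pos hpos] at h2; omega

lemma log_neg_of_im_pos {z : ℂ} (h : 0 < z.im) :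
    Complex.log (-z) = Complex.log z - Real.pi * Complex.I := by
  have := Complex.arg_neg_eq_arg_sub_pi_of_im_pos h
  apply Complex.ext <;> simp [Complex.log_re, Complex.log_im, this]

lemma log_neg_of_im_neg {z : ℂ} (h : z.im < 0) :
    Complex.log (-z) = Complex.log z + Real.pi * Complex.I := by
  have := Complex.arg_neg_eq_arg_add_pi_of_im_neg h
  apply Complex.ext <;> simp [Complex.log_re, Complex.log_im, this]

/-- The increments of a logarithm of `h` along the boundary of a rectangle add up to zero, with
the logarithm on each side given by a branch that is defined on it. -/
lemma boundary_log_sum {a b c d : ℝ} (hab : a ≤ b) (hcd : c ≤ d) {h : ℝ → ℝ → ℂ}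
    (hc : ContinuousOn (fun p : ℝ × ℝ => h p.1 p.2) (Icc a b ×ˢ Icc c d))
    (h0 : ∀ s ∈ Icc a b, ∀ t ∈ Icc c d, h s t ≠ 0) {e₁ e₂ e₃ e₄ : ℂ}
    (h1 : ∀ t ∈ Icc c d, e₁ * h a t ∈ Complex.slitPlane)
    (h2 : ∀ s ∈ Icc a b, e₂ * h s d ∈ Complex.slitPlane)
    (h3 : ∀ t ∈ Icc c d, e₃ * h b t ∈ Complex.slitPlane)
    (h4 : ∀ s ∈ Icc a b, e₄ * h s c ∈ Complex.slitPlane) :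
    (Complex.log (e₁ * h a d) - Complex.log (e₁ * h a c)) +
      (Complex.log (e₂ * h b d) - Complex.log (e₂ * h a d)) =
    (Complex.log (e₄ * h b c) - Complex.log (e₄ * h a c)) +
      (Complex.log (e₃ * h b d) - Complex.log (e₃ * h b c)) := by
  obtain ⟨L, hL, hLe⟩ := exists_log_on_rectangle hab hcd hc h0
  have ha : a ∈ Icc a b := left_mem_Icc.2 hab
  have hb : b ∈ Icc a b := right_mem_Icc.2 hab
  have hc' : c ∈ Icc c d := left_mem_Icc.2 hcd
  have hd : d ∈ Icc c d := right_mem_Icc.2 hcd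
  have v : ∀ (k : ℝ → ℝ → ℂ), ContinuousOn (fun p : ℝ × ℝ => k p.1 p.2) (Icc a b ×ˢ Icc c d) →
      ∀ s ∈ Icc a b, ContinuousOn (fun t => k s t) (Icc c d) := fun k hk s hs =>
    hk.comp (f := fun t : ℝ => (s, t)) (by fun_prop) fun t ht => ⟨hs, ht⟩
  have v' : ∀ (k : ℝ → ℝ → ℂ), ContinuousOn (fun p : ℝ × ℝ => k p.1 p.2) (Icc a b ×ˢ Icc c d) →
      ∀ t ∈ Icc c d, ContinuousOn (fun s => k s t) (Icc a b) := fun k hk t ht =>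
    hk.comp (f := fun s : ℝ => (s, t)) (by fun_prop) fun s hs => ⟨hs, ht⟩
  rw [← log_increment hcd (v L hL a ha) (v h hc a ha) (hLe a ha) h1,
    ← log_increment hab (v' L hL d hd) (v' h hc d hd) (fun s hs => hLe s hs d hd) h2,
    ← log_increment hcd (v L hL b hb) (v h hc b hb) (hLe b hb) h3,
    ← log_increment hab (v' L hL c hc') (v' h hc c hc') (fun s hs => hLe s hs c hc') h4]
  ring

/-- A path from left to right and a path from bottom to top meet. -/
lemma paths_cross {a b c d : ℝ} (hab : a ≤ b) (hcd : c ≤ d) {f g : ℝ → ℂ}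
    (hf : ContinuousOn f (Icc a b)) (hg : ContinuousOn g (Icc c d))
    (hl : ∀ t ∈ Icc c d, (f a).re < (g t).re) (hr : ∀ t ∈ Icc c d, (g t).re < (f b).re)
    (hd : ∀ s ∈ Icc a b, (g c).im < (f s).im) (hu : ∀ s ∈ Icc a b, (f s).im < (g d).im) :
    ∃ s ∈ Icc a b, ∃ t ∈ Icc c d, f s = g t := by
  by_contra! hcon
  set h : ℝ → ℝ → ℂ := fun s t => f s - g t with hh
  have ha : a ∈ Icc a b := left_mem_Icc.2 hab
  have hb : b ∈ Icc a b := right_mem_Icc.2 hab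
  have hc' : c ∈ Icc c d := left_mem_Icc.2 hcd
  have hd' : d ∈ Icc c d := right_mem_Icc.2 hcd
  have hcont : ContinuousOn (fun p : ℝ × ℝ => h p.1 p.2) (Icc a b ×ˢ Icc c d) :=
    (hf.comp continuousOn_fst fun p hp => hp.1).sub (hg.comp continuousOn_snd fun p hp => hp.2)
  -- On each side of the rectangle `f s - g t` lies in one open half-plane; the factor turns that
  -- half-plane into the right one.
  have key := boundary_log_sum (e₁ := -1) (e₂ := Complex.I) (e₃ := 1) (e₄ := -Complex.I)
    hab hcd hcont (fun s hs t ht => sub_ne_zero.2 (hcon s hs t ht))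
    (fun t ht => by left; simp [hh]; linarith [hl t ht])
    (fun s hs => by left; simp [hh]; linarith [hu s hs])
    (fun t ht => by left; simp [hh]; linarith [hr t ht])
    (fun s hs => by left; simp [hh]; linarith [hd s hs])
  have im := congrArg Complex.im key
  simp only [Complex.add_im, Complex.sub_im, Complex.log_im] at im
  have q : ∀ z : ℂ, z ≠ 0 → ∀ θ : ℝ, θ ∈ Ioc (-Real.pi) Real.pi →
      z = ‖z‖ * Complex.exp (θ * Complex.I) → z.arg = θ := by
    intro z hz θ hθ h
    rw [h, Complex.exp_mul_I, Complex.arg_mul_cos_add_sin_mul_I (norm_pos_iff.2 hz) hθ]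
  have rot : ∀ z : ℂ, z ≠ 0 → ∀ e : ℂ, ∀ φ : ℝ, e = Complex.exp (φ * Complex.I) →
      z.arg + φ ∈ Ioc (-Real.pi) Real.pi → (e * z).arg = z.arg + φ := by
    intro z hz e φ he hm
    have hez : e ≠ 0 := by rw [he]; exact Complex.exp_ne_zero _
    apply q _ (mul_ne_zero hez hz) _ hm
    have hn : ‖e‖ = 1 := by rw [he]; exact Complex.norm_exp_ofReal_mul_I φ
    rw [norm_mul, hn, one_mul]
    conv_lhs => rw [← Complex.norm_mul_exp_arg_mul_I z, he]
    push_cast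
    rw [add_mul, Complex.exp_add]
    ring
  have eI : Complex.I = Complex.exp ((Real.pi / 2 : ℝ) * Complex.I) := by
    rw [Complex.exp_mul_I]; push_cast; simp
  have enI : -Complex.I = Complex.exp ((-(Real.pi / 2) : ℝ) * Complex.I) := by
    rw [Complex.exp_mul_I]; push_cast; simp
  have e1 : (-1 : ℂ) = Complex.exp ((Real.pi : ℝ) * Complex.I) := by simp
  have e1' : (-1 : ℂ) = Complex.exp ((-Real.pi : ℝ) * Complex.I) := by
    rw [Complex.exp_mul_I]; push_cast; simp
  have pi := Real.pi_pos
  have sgn : ∀ z : ℂ, z.im ≠ 0 → z ≠ 0 := by rintro z hz rfl; simp at hz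
  -- corners
  have ad_im : (h a d).im < 0 := by simp [hh]; linarith [hu a ha]
  have ad_re : (h a d).re < 0 := by simp [hh]; linarith [hl d hd']
  have ac_im : 0 < (h a c).im := by simp [hh]; linarith [hd a ha]
  have ac_re : (h a c).re < 0 := by simp [hh]; linarith [hl c hc']
  have bd_im : (h b d).im < 0 := by simp [hh]; linarith [hu b hb]
  have bd_re : 0 < (h b d).re := by simp [hh]; linarith [hr d hd']
  have bc_im : 0 < (h b c).im := by simp [hh]; linarith [hd b hb]
  have bc_re : 0 < (h b c).re := by simp [hh]; linarith [hr c hc']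
  have A1 := Complex.arg_neg_iff.2 ad_im
  have A2 := Complex.neg_pi_lt_arg (h a d)
  have A3 : (h a d).arg < -(Real.pi / 2) := by
    by_contra hx
    push Not at hx
    have := (Complex.neg_pi_div_two_le_arg_iff).1 hx
    rcases this with h | h <;> linarith
  have B1 := Complex.arg_le_pi (h a c)
  have B2 : Real.pi / 2 < (h a c).arg := by
    by_contra hx
    push Not at hx
    have := (Complex.arg_le_pi_div_two_iff).1 hx
    rcases this with h | h <;> linarith
  have C1 := Complex.arg_neg_iff.2 bd_im
  have C2 : |(h b d).arg| < Real.pi / 2 := Complex.abs_arg_lt_pi_div_two_iff.2 (Or.inl bd_re)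
  have D2 : |(h b c).arg| < Real.pi / 2 := Complex.abs_arg_lt_pi_div_two_iff.2 (Or.inl bc_re)
  have D1 : 0 ≤ (h b c).arg := Complex.arg_nonneg_iff.2 bc_im.le
  rw [abs_lt] at C2 D2
  -- Multiplication by `-1` raises the argument by `π` at the corner with negative imaginary part
  -- and lowers it by `π` at the one with positive imaginary part. All other terms cancel and `2π =
  -- 0` remains: the winding number is not zero.
  rw [rot _ (sgn _ ad_im.ne) _ Real.pi e1 ⟨by linarith, by linarith⟩,
    rot _ (sgn _ ac_im.ne') _ (-Real.pi) e1' ⟨by linarith, by linarith⟩,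
    rot _ (sgn _ bd_im.ne) _ _ eI ⟨by linarith, by linarith⟩,
    rot _ (sgn _ ad_im.ne) _ _ eI ⟨by linarith, by linarith⟩,
    rot _ (sgn _ bc_im.ne') _ _ enI ⟨by linarith, by linarith⟩,
    rot _ (sgn _ ac_im.ne') _ _ enI ⟨by linarith, by linarith⟩, one_mul, one_mul] at im
  linarith

/-- A path that comes from the right at height `y₁` and returns to the right at height
`y₂ > y₁ + η` meets its vertical translate by `η`. -/
lemma hairpin_meets_translate {α β : ℝ} (hαβ : α ≤ β) {g : ℝ → ℂ}
    (hg : ContinuousOn g (Icc α β)) {η B y₁ y₂ : ℝ}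
    (hη : 2 * B < η) (hB : 0 ≤ B) (hy : η + 2 * B < y₂ - y₁)
    (h1 : |(g α).im - y₁| ≤ B) (h2 : |(g β).im - y₂| ≤ B)
    (hm : ∀ t ∈ Icc α β, ((g t).re < (g α).re ∧ (g t).re < (g β).re) ∨ |(g t).im - y₁| ≤ B ∨
      |(g t).im - y₂| ≤ B) :
    ∃ s ∈ Icc α β, ∃ t ∈ Icc α β, g s + η * Complex.I = g t := by
  by_contra! hcon
  set h : ℝ → ℝ → ℂ := fun s t => g s + η * Complex.I - g t with hh
  have ha : α ∈ Icc α β := left_mem_Icc.2 hαβ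
  have hb : β ∈ Icc α β := right_mem_Icc.2 hαβ
  have hcont : ContinuousOn (fun p : ℝ × ℝ => h p.1 p.2) (Icc α β ×ˢ Icc α β) :=
    ((hg.comp continuousOn_fst fun p hp => hp.1).add continuousOn_const).sub
      (hg.comp continuousOn_snd fun p hp => hp.2)
  rw [abs_le] at h1 h2
  -- On each side, `h` or `-h` has positive real part or nonzero imaginary part, hence avoids the
  -- negative axis. At the corners, passing from `log (-z)` to `log z` costs `±πi`, and these shifts
  -- add up to `2πi` instead of `0`.
  have key := boundary_log_sum (e₁ := 1) (e₂ := -1) (e₃ := 1) (e₄ := -1)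
    hαβ hαβ hcont (fun s hs t ht => sub_ne_zero.2 (hcon s hs t ht))
    (fun t ht => by
      rw [Complex.mem_slitPlane_iff]
      rcases hm t ht with h | h | h
      · left; simp [hh]; linarith
      · right; rw [abs_le] at h; simp [hh]; apply ne_of_gt; linarith
      · right; rw [abs_le] at h; simp [hh]; apply ne_of_lt; linarith)
    (fun t ht => by
      rw [Complex.mem_slitPlane_iff]
      rcases hm t ht with h | h | h
      · left; simp [hh]; linarith
      · right; rw [abs_le] at h; simp [hh]; apply ne_of_gt; linarith
      · right; rw [abs_le] at h; simp [hh]; apply ne_of_lt; linarith)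
    (fun t ht => by
      rw [Complex.mem_slitPlane_iff]
      rcases hm t ht with h | h | h
      · left; simp [hh]; linarith
      · right; rw [abs_le] at h; simp [hh]; apply ne_of_gt; linarith
      · right; rw [abs_le] at h; simp [hh]; apply ne_of_gt; linarith)
    (fun t ht => by
      rw [Complex.mem_slitPlane_iff]
      rcases hm t ht with h | h | h
      · left; simp [hh]; linarith
      · right; rw [abs_le] at h; simp [hh]; apply ne_of_lt; linarith
      · right; rw [abs_le] at h; simp [hh]; apply ne_of_lt; linarith)
  have c1 : 0 < (h α α).im := by simp [hh]; linarith
  have c3 : 0 < (h β β).im := by simp [hh]; linarith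
  have c2 : (h α β).im < 0 := by simp [hh]; linarith
  have c4 : 0 < (h β α).im := by simp [hh]; linarith
  rw [neg_one_mul, neg_one_mul, neg_one_mul, neg_one_mul, one_mul, one_mul, one_mul, one_mul,
    log_neg_of_im_pos c1, log_neg_of_im_pos c3, log_neg_of_im_neg c2, log_neg_of_im_pos c4] at key
  have im := congrArg Complex.im key
  simp at im
  linarith [Real.pi_pos]

/-! ### The model map `F` -/

lemma F_strictMono : StrictMono F := fun _ _ h => by unfold F; linarith [Real.exp_lt_exp.2 h]

lemma F_iter_strictMono (k : ℕ) : StrictMono F^[k] := F_strictMono.iterate k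

lemma continuous_F : Continuous F := by unfold F; fun_prop

lemma continuous_F_iter (k : ℕ) : Continuous F^[k] := continuous_F.iterate k

lemma F_zero : F 0 = 0 := by simp [F]

lemma F_iter_zero (k : ℕ) : F^[k] 0 = 0 := Function.iterate_fixed F_zero k

lemma le_F (t : ℝ) : t ≤ F t := by unfold F; linarith [Real.add_one_le_exp t]

lemma F_iter_pos {t : ℝ} (h : 0 < t) (k : ℕ) : 0 < F^[k] t := by
  have := F_iter_strictMono k h
  rwa [F_iter_zero] at this

lemma F_iter_nonneg {t : ℝ} (h : 0 ≤ t) (k : ℕ) : 0 ≤ F^[k] t := by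
  have := (F_iter_strictMono k).monotone h
  rwa [F_iter_zero] at this

lemma exp_F_iter (k : ℕ) (t : ℝ) : Real.exp (F^[k] t) = F^[k + 1] t + 1 := by
  rw [Function.iterate_succ_apply', F]; ring

lemma le_F_iter (k : ℕ) (t : ℝ) : t ≤ F^[k] t := by
  induction k with
  | zero => simp
  | succ k ih => rw [Function.iterate_succ_apply']; exact ih.trans (le_F _)

lemma F_sub_ge {x y : ℝ} (h : x ≤ y) : (1 + x) * (y - x) ≤ F y - F x := by
  have h1 : Real.exp y = Real.exp x * Real.exp (y - x) := by rw [← Real.exp_add]; ring_nf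
  have h2 := Real.add_one_le_exp (y - x)
  have h3 := Real.add_one_le_exp x
  have h4 := Real.exp_pos x
  unfold F
  rw [h1]
  nlinarith [mul_nonneg h4.le (sub_nonneg.2 h2), mul_nonneg (sub_nonneg.2 h3) (sub_nonneg.2 h)]

lemma F_iter_sub_ge {x y : ℝ} (hx : 0 < x) (h : x ≤ y) (k : ℕ) :
    (1 + x) ^ k * (y - x) ≤ F^[k] y - F^[k] x := by
  induction k with
  | zero => simp
  | succ k ih =>
    rw [Function.iterate_succ_apply', Function.iterate_succ_apply']
    have h1 := F_sub_ge ((F_iter_strictMono k).monotone h)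
    have h2 := le_F_iter k x
    have h3 : 0 ≤ F^[k] y - F^[k] x := sub_nonneg.2 ((F_iter_strictMono k).monotone h)
    calc (1 + x) ^ (k + 1) * (y - x) = (1 + x) * ((1 + x) ^ k * (y - x)) := by ring
      _ ≤ (1 + x) * (F^[k] y - F^[k] x) := by gcongr
      _ ≤ (1 + F^[k] x) * (F^[k] y - F^[k] x) := by gcongr
      _ ≤ _ := h1

lemma tendsto_F_iter_sub {x y : ℝ} (hx : 0 < x) (h : x < y) :
    Tendsto (fun k => F^[k] y - F^[k] x) atTop atTop :=
  tendsto_atTop_mono (F_iter_sub_ge hx h.le)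
    ((tendsto_pow_atTop_atTop_of_one_lt (by linarith)).atTop_mul_const (sub_pos.2 h))

lemma tendsto_F_iter {x : ℝ} (hx : 0 < x) : Tendsto (fun k => F^[k] x) atTop atTop := by
  have h1 := tendsto_F_iter_sub (half_pos hx) (half_lt_self hx)
  exact tendsto_atTop_mono (fun k => by linarith [F_iter_pos (half_pos hx) k]) h1

/-- One step turns the difference `F^k y - F^k x`, which tends to infinity, into a ratio of
exponential size; hence the shift of the index by one. -/
lemma tendsto_F_iter_div {x y : ℝ} (hx : 0 < x) (h : x < y) :
    Tendsto (fun k => F^[k] x / F^[k] y) atTop (𝓝 0) := by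
  rw [← tendsto_add_atTop_iff_nat 1]
  have h1 : Tendsto (fun k => Real.exp (-(F^[k] y - F^[k] x))) atTop (𝓝 0) :=
    Real.tendsto_exp_neg_atTop_nhds_zero.comp (tendsto_F_iter_sub hx h)
  refine squeeze_zero (fun k => (div_pos (F_iter_pos hx _) (F_iter_pos (hx.trans h) _)).le)
    (fun k => ?_) h1
  have h2 := F_iter_pos (hx.trans h) (k + 1)
  rw [div_le_iff₀ h2, neg_sub, Real.exp_sub, exp_F_iter, exp_F_iter]
  have h3 := F_iter_strictMono (k + 1) h
  rw [div_mul_eq_mul_div, le_div_iff₀ (by linarith)]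
  nlinarith

/-- Distinct `F`-orbits separate without bound, so asymptotics up to `O(1)` determine the potential.
-/
lemma eq_of_F_iter_sub_bounded {x y C : ℝ} (hx : 0 < x) (hy : 0 < y)
    (h : ∀ k, |F^[k] x - F^[k] y| ≤ C) : x = y := by
  by_contra hne
  rcases lt_or_gt_of_ne hne with hlt | hlt
  · obtain ⟨k, hk⟩ := ((tendsto_F_iter_sub hx hlt).eventually_gt_atTop C).exists
    have := (abs_le.1 (h k)).1
    linarith
  · obtain ⟨k, hk⟩ := ((tendsto_F_iter_sub hy hlt).eventually_gt_atTop C).exists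
    have := (abs_le.1 (h k)).2
    linarith

/-! ### Growth of the cosine map -/

lemma cosMap_neg (a b z : ℂ) : cosMap a b (-z) = cosMap b a z := by
  simp [cosMap, add_comm]

lemma continuous_cosMap (a b : ℂ) : Continuous (cosMap a b) := by
  unfold cosMap; fun_prop

lemma continuous_cosMap_iter (a b : ℂ) (k : ℕ) : Continuous (cosMap a b)^[k] :=
  (continuous_cosMap a b).iterate k

lemma cosMap_add_int (a b z : ℂ) (n : ℤ) :
    cosMap a b (z + ((2 * Real.pi * n : ℝ) : ℂ) * Complex.I) = cosMap a b z := by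
  have h1 : Complex.exp (z + ((2 * Real.pi * n : ℝ) : ℂ) * Complex.I) = Complex.exp z := by
    rw [Complex.exp_eq_exp_iff_exists_int]; exact ⟨n, by push_cast; ring⟩
  have h2 : Complex.exp (-(z + ((2 * Real.pi * n : ℝ) : ℂ) * Complex.I)) = Complex.exp (-z) := by
    rw [Complex.exp_eq_exp_iff_exists_int]; exact ⟨-n, by push_cast; ring⟩
  rw [cosMap, cosMap, h1, h2]

/-- Constants for the growth of `E` away from the imaginary axis. -/
structure Growth (a b : ℂ) (C : ℝ) : Prop where
  one_le : 1 ≤ C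
  upper : ∀ z, ‖cosMap a b z‖ ≤ Real.exp (|z.re| + C)
  lower : ∀ z : ℂ, C ≤ |z.re| → Real.exp (|z.re| - C) ≤ ‖cosMap a b z‖
  expand : ∀ z z' : ℂ, C ≤ |z.re| → C ≤ |z'.re| → 0 < z.re * z'.re → ‖z - z'‖ ≤ 1 / 2 →
    Real.exp (|z.re| - C) * ‖z - z'‖ ≤ ‖cosMap a b z - cosMap a b z'‖
  turn : ∀ z : ℂ, C ≤ z.re → ∀ θ : ℝ, Complex.exp (θ * Complex.I) = Complex.exp (z.im * Complex.I) →
    |θ + a.arg| ≤ Real.pi / 4 → Real.exp (z.re - C) ≤ (cosMap a b z).re ∧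
      (θ + a.arg = Real.pi / 4 → Real.exp (z.re - C) ≤ (cosMap a b z).im) ∧
      (θ + a.arg = -(Real.pi / 4) → (cosMap a b z).im ≤ -Real.exp (z.re - C))
  turn' : ∀ z : ℂ, z.re ≤ -C → ∀ θ : ℝ,
    Complex.exp (θ * Complex.I) = Complex.exp ((-z).im * Complex.I) →
    |θ + b.arg| ≤ Real.pi / 4 → Real.exp (-z.re - C) ≤ (cosMap a b z).re ∧
      (θ + b.arg = Real.pi / 4 → Real.exp (-z.re - C) ≤ (cosMap a b z).im) ∧
      (θ + b.arg = -(Real.pi / 4) → (cosMap a b z).im ≤ -Real.exp (-z.re - C))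
  sq : 64 * (‖a‖ * ‖b‖ + 1) ≤ Real.exp (2 * C)
  norm_fst : ‖a‖ ≤ Real.exp C
  norm_snd : ‖b‖ ≤ Real.exp C

/-- The factor `8` is slack: it lets `a e^z` dominate after the losses `1/2` and `2` in the bounds
for `e^D - 1`, and after projection to a sector of half-angle `π/4`. -/
lemma lower_right {a b : ℂ} {C : ℝ} (h1 : 8 / ‖a‖ ≤ Real.exp C)
    (h2 : 8 * ‖b‖ / ‖a‖ ≤ Real.exp C) (ha : a ≠ 0) (hC : 1 ≤ C) {z : ℂ} (hz : C ≤ z.re) :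
    ‖b * Complex.exp (-z)‖ ≤ ‖a * Complex.exp z‖ / 8 ∧
      8 * Real.exp (z.re - C) ≤ ‖a * Complex.exp z‖ := by
  have ha' := norm_pos_iff.2 ha
  rw [div_le_iff₀ ha'] at h1 h2
  have e1 : Real.exp C ≤ Real.exp z.re := Real.exp_le_exp.2 hz
  have e0 := Real.exp_pos C
  have e2 : Real.exp (-z.re) ≤ 1 := Real.exp_le_one_iff.2 (by linarith)
  simp only [norm_mul, Complex.norm_exp, Complex.neg_re]
  constructor
  · nlinarith [norm_nonneg b, mul_le_mul_of_nonneg_right e1 ha'.le]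
  · rw [Real.exp_sub, ← mul_div_assoc, div_le_iff₀ e0]
    nlinarith [Real.exp_pos z.re]

lemma norm_exp_sub_one_ge {D : ℂ} (h : ‖D‖ ≤ 1 / 2) : ‖D‖ / 2 ≤ ‖Complex.exp D - 1‖ := by
  have h1 := Complex.norm_exp_sub_one_sub_id_le (h.trans (by norm_num))
  have h2 : ‖D‖ ≤ ‖Complex.exp D - 1 - D‖ + ‖Complex.exp D - 1‖ := by
    have := norm_sub_le (Complex.exp D - 1) (Complex.exp D - 1 - D)
    simp only [sub_sub_cancel] at this
    linarith
  nlinarith [norm_nonneg D]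

lemma expand_right {a b : ℂ} {C : ℝ} (h1 : 8 / ‖a‖ ≤ Real.exp C)
    (h2 : 8 * ‖b‖ / ‖a‖ ≤ Real.exp C) (ha : a ≠ 0) (hC : 1 ≤ C) {z z' : ℂ} (hz : C ≤ z.re)
    (hd : ‖z - z'‖ ≤ 1 / 2) :
    Real.exp (z.re - C) * ‖z - z'‖ ≤ ‖cosMap a b z - cosMap a b z'‖ := by
  obtain ⟨l1, l2⟩ := lower_right h1 h2 ha hC hz
  have hd' : ‖z' - z‖ ≤ 1 / 2 := by rwa [norm_sub_rev]
  have e : cosMap a b z - cosMap a b z' =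
      -(a * Complex.exp z * (Complex.exp (z' - z) - 1)) -
        b * Complex.exp (-z) * (Complex.exp (z - z') - 1) := by
    have i1 : Complex.exp z' = Complex.exp z * Complex.exp (z' - z) := by
      rw [← Complex.exp_add]; ring_nf
    have i2 : Complex.exp (-z') = Complex.exp (-z) * Complex.exp (z - z') := by
      rw [← Complex.exp_add]; ring_nf
    rw [cosMap, cosMap, i1, i2]; ring
  have n1 : ‖a * Complex.exp z‖ * (‖z - z'‖ / 2) ≤
      ‖-(a * Complex.exp z * (Complex.exp (z' - z) - 1))‖ := by
    rw [norm_neg, norm_mul (a * Complex.exp z) (Complex.exp (z' - z) - 1)]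
    gcongr
    have := norm_exp_sub_one_ge hd'
    rwa [norm_sub_rev z' z] at this
  have n2 : ‖b * Complex.exp (-z) * (Complex.exp (z - z') - 1)‖ ≤
      ‖a * Complex.exp z‖ / 8 * (2 * ‖z - z'‖) := by
    rw [norm_mul]
    gcongr
    have := Complex.norm_exp_sub_one_le (hd.trans (by norm_num))
    exact this
  have n3 := norm_sub_norm_le (-(a * Complex.exp z * (Complex.exp (z' - z) - 1)))
    (b * Complex.exp (-z) * (Complex.exp (z - z') - 1))
  rw [← e] at n3
  nlinarith [norm_nonneg (z - z'), mul_le_mul_of_nonneg_right l2 (norm_nonneg (z - z')),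
    mul_nonneg (Real.exp_pos (z.re - C)).le (norm_nonneg (z - z'))]

/-- `E(z)` is close to `a e^z`, whose argument is `θ + arg a` modulo `2π`. A vertical window of
width `π/2` is therefore mapped far to the right, and its two ends go far up and far down. -/
lemma turn_right {a b : ℂ} {C : ℝ} (h1 : 8 / ‖a‖ ≤ Real.exp C)
    (h2 : 8 * ‖b‖ / ‖a‖ ≤ Real.exp C) (ha : a ≠ 0) (hC : 1 ≤ C) (z : ℂ) (hz : C ≤ z.re)
    (θ : ℝ) (hθ : Complex.exp (θ * Complex.I) = Complex.exp (z.im * Complex.I))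
    (hw : |θ + a.arg| ≤ Real.pi / 4) : Real.exp (z.re - C) ≤ (cosMap a b z).re ∧
      (θ + a.arg = Real.pi / 4 → Real.exp (z.re - C) ≤ (cosMap a b z).im) ∧
      (θ + a.arg = -(Real.pi / 4) → (cosMap a b z).im ≤ -Real.exp (z.re - C)) := by
  obtain ⟨l1, l2⟩ := lower_right h1 h2 ha hC hz
  have e : a * Complex.exp z =
      (‖a * Complex.exp z‖ : ℝ) * Complex.exp (((θ + a.arg : ℝ) : ℂ) * Complex.I) := by
    push_cast
    rw [add_mul, Complex.exp_add, hθ, norm_mul, Complex.norm_exp]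
    conv_lhs => rw [← Complex.norm_mul_exp_arg_mul_I a, ← Complex.re_add_im z, Complex.exp_add]
    push_cast
    ring
  set N := ‖a * Complex.exp z‖ with hN
  have hre : (a * Complex.exp z).re = N * Real.cos (θ + a.arg) := by
    rw [e, Complex.re_ofReal_mul, Complex.exp_ofReal_mul_I_re]
  have him : (a * Complex.exp z).im = N * Real.sin (θ + a.arg) := by
    rw [e, Complex.im_ofReal_mul, Complex.exp_ofReal_mul_I_im]
  have b1 := (Complex.abs_re_le_norm _).trans l1
  have b2 := (Complex.abs_im_le_norm _).trans l1
  rw [abs_le] at b1 b2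
  have s2 : (1.4 : ℝ) ≤ √2 := Real.le_sqrt_of_sq_le (by norm_num)
  have N0 : 0 ≤ N := norm_nonneg _
  have hp := Real.exp_pos (z.re - C)
  have hpi := Real.pi_pos
  have hcos : √2 / 2 ≤ Real.cos (θ + a.arg) := by
    rw [← Real.cos_pi_div_four, ← Real.cos_abs (θ + a.arg)]
    exact Real.cos_le_cos_of_nonneg_of_le_pi (abs_nonneg _) (by linarith) hw
  refine ⟨?_, fun h => ?_, fun h => ?_⟩
  · rw [cosMap, Complex.add_re, hre]
    nlinarith
  · rw [cosMap, Complex.add_im, him, h, Real.sin_pi_div_four]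
    nlinarith
  · rw [cosMap, Complex.add_im, him, h, Real.sin_neg, Real.sin_pi_div_four]
    nlinarith

/-- The estimates on the left follow from those on the right because `E(-z)` is the same map with
`a` and `b` exchanged. The bounds `sq`, `norm_fst` and `norm_snd` serve the quadratic equation that
is solved when paths are lifted. -/
lemma exists_growth {a b : ℂ} (ha : a ≠ 0) (hb : b ≠ 0) : ∃ C, Growth a b C := by
  have ha' := norm_pos_iff.2 ha
  have hb' := norm_pos_iff.2 hb
  obtain ⟨C, hC, hC1⟩ := ((Real.tendsto_exp_atTop.eventually_ge_atTop
    (8 / ‖a‖ + 8 / ‖b‖ + 8 * ‖b‖ / ‖a‖ + 8 * ‖a‖ / ‖b‖ + ‖a‖ + ‖b‖ +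
      64 * (‖a‖ * ‖b‖ + 1))).and (eventually_ge_atTop 1)).exists
  have p1 : 0 < 8 / ‖a‖ := by positivity
  have p2 : 0 < 8 / ‖b‖ := by positivity
  have p3 : 0 < 8 * ‖b‖ / ‖a‖ := by positivity
  have p4 : 0 < 8 * ‖a‖ / ‖b‖ := by positivity
  have p5 : 0 < ‖a‖ * ‖b‖ := by positivity
  have q1 : 8 / ‖a‖ ≤ Real.exp C := by linarith
  have q2 : 8 / ‖b‖ ≤ Real.exp C := by linarith
  have q3 : 8 * ‖b‖ / ‖a‖ ≤ Real.exp C := by linarith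
  have q4 : 8 * ‖a‖ / ‖b‖ ≤ Real.exp C := by linarith
  have low : ∀ {a b : ℂ}, 8 / ‖a‖ ≤ Real.exp C → 8 * ‖b‖ / ‖a‖ ≤ Real.exp C → a ≠ 0 →
      ∀ z : ℂ, C ≤ z.re → Real.exp (z.re - C) ≤ ‖cosMap a b z‖ := by
    intro a b h1 h2 ha z hz
    obtain ⟨l1, l2⟩ := lower_right h1 h2 ha hC1 hz
    have := norm_sub_norm_le (a * Complex.exp z) (-(b * Complex.exp (-z)))
    rw [sub_neg_eq_add, norm_neg] at this
    rw [cosMap]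
    linarith [Real.exp_pos (z.re - C)]
  refine ⟨C, hC1, fun z => ?_, fun z hz => ?_, fun z z' hz hz' hs hd => ?_,
    turn_right q1 q3 ha hC1, fun z hz θ hθ hw => ?_, ?_, by linarith, by linarith⟩
  · have h1 : Real.exp z.re ≤ Real.exp |z.re| := Real.exp_le_exp.2 (le_abs_self _)
    have h2 : Real.exp (-z.re) ≤ Real.exp |z.re| := Real.exp_le_exp.2 (neg_le_abs _)
    calc ‖cosMap a b z‖ ≤ ‖a * Complex.exp z‖ + ‖b * Complex.exp (-z)‖ := norm_add_le _ _
      _ = ‖a‖ * Real.exp z.re + ‖b‖ * Real.exp (-z.re) := by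
        simp [Complex.norm_exp]
      _ ≤ (‖a‖ + ‖b‖) * Real.exp |z.re| := by
        rw [add_mul]; gcongr
      _ ≤ Real.exp C * Real.exp |z.re| := by gcongr; linarith
      _ = _ := by rw [← Real.exp_add, add_comm]
  · rcases le_total 0 z.re with h | h
    · rw [abs_of_nonneg h] at hz ⊢
      exact low q1 q3 ha z hz
    · rw [abs_of_nonpos h] at hz ⊢
      have := low q2 q4 hb (-z) (by simpa using hz)
      rwa [cosMap_neg, Complex.neg_re] at this
  · rcases pos_and_pos_or_neg_and_neg_of_mul_pos hs with ⟨h, h'⟩ | ⟨h, h'⟩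
    · rw [abs_of_pos h] at hz ⊢
      exact expand_right q1 q3 ha hC1 hz hd
    · rw [abs_of_neg h] at hz ⊢
      have := expand_right q2 q4 hb hC1 (z := -z) (z' := -z') (by simpa using hz)
        (by rwa [neg_sub_neg, norm_sub_rev])
      rwa [neg_sub_neg, norm_sub_rev z' z, cosMap_neg, cosMap_neg] at this
  · have := turn_right q2 q4 hb hC1 (-z) (by simp; linarith) θ hθ hw
    rwa [cosMap_neg] at this
  · have : Real.exp C ≤ Real.exp (2 * C) := Real.exp_le_exp.2 (by linarith)
    linarith

lemma Growth.mono {a b : ℂ} {C C' : ℝ} (h : Growth a b C) (hC : C ≤ C') : Growth a b C' where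
  one_le := h.one_le.trans hC
  upper z := (h.upper z).trans (Real.exp_le_exp.2 (by linarith))
  lower z hz := (Real.exp_le_exp.2 (by linarith)).trans (h.lower z (hC.trans hz))
  expand z z' hz hz' hs hd := by
    refine le_trans ?_ (h.expand z z' (hC.trans hz) (hC.trans hz') hs hd)
    gcongr
  turn z hz θ hθ hw := by
    obtain ⟨h1, h2, h3⟩ := h.turn z (hC.trans hz) θ hθ hw
    have e : Real.exp (z.re - C') ≤ Real.exp (z.re - C) := Real.exp_le_exp.2 (by linarith)
    exact ⟨e.trans h1, fun h => e.trans (h2 h), fun h => (h3 h).trans (by linarith)⟩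
  turn' z hz θ hθ hw := by
    obtain ⟨h1, h2, h3⟩ := h.turn' z (by linarith) θ hθ hw
    have e : Real.exp (-z.re - C') ≤ Real.exp (-z.re - C) := Real.exp_le_exp.2 (by linarith)
    exact ⟨e.trans h1, fun h => e.trans (h2 h), fun h => (h3 h).trans (by linarith)⟩
  sq := h.sq.trans (Real.exp_le_exp.2 (by linarith))
  norm_fst := h.norm_fst.trans (Real.exp_le_exp.2 hC)
  norm_snd := h.norm_snd.trans (Real.exp_le_exp.2 hC)

/-! ### Strips have bounded height -/

section Strips

variable {a b c : ℂ}

lemma critVal_relation (ha : a ≠ 0) (hc : IsCritCentre a b c) :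
    b * Complex.exp (-c) = a * Complex.exp c := by
  have h := hc.1
  have e : Complex.exp (2 * c) = Complex.exp c * Complex.exp c := by
    rw [← Complex.exp_add]; ring_nf
  rw [e, eq_div_iff ha] at h
  rw [← h, Complex.exp_neg]
  field_simp [Complex.exp_ne_zero c]

lemma critVal₁_eq (ha : a ≠ 0) (hc : IsCritCentre a b c) :
    critVal₁ a b c = 2 * a * Complex.exp c := by
  rw [critVal₁, cosMap, critVal_relation ha hc]; ring

lemma critVal₁_ne_zero (ha : a ≠ 0) (hc : IsCritCentre a b c) : critVal₁ a b c ≠ 0 := by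
  rw [critVal₁_eq ha hc]
  exact mul_ne_zero (mul_ne_zero two_ne_zero ha) (Complex.exp_ne_zero _)

lemma cosMap_centre_add (ha : a ≠ 0) (hc : IsCritCentre a b c) (ζ : ℂ) :
    cosMap a b (c + ζ) = critVal₁ a b c * Complex.cosh ζ := by
  rw [critVal₁_eq ha hc, cosMap, neg_add, Complex.exp_add, Complex.exp_add, ← mul_assoc b,
    critVal_relation ha hc, Complex.cosh]
  ring

lemma critVal₂_eq (ha : a ≠ 0) (hc : IsCritCentre a b c) :
    critVal₂ a b c = -critVal₁ a b c := by
  rw [critVal₂, cosMap_centre_add ha hc, Complex.cosh_mul_I, Complex.cos_pi]; ring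

lemma abs_re_le_of_mem_slit {z : ℂ} (hz : z ∈ slit a b c) :
    |z.re| ≤ ‖critVal₁ a b c‖ + ‖critVal₂ a b c‖ := by
  rcases hz with h | h
  · have h1 := (convex_closedBall (0 : ℂ) (‖critVal₁ a b c‖ + ‖critVal₂ a b c‖)).segment_subset
      (x := critVal₁ a b c) (y := critVal₂ a b c)
      (by simp) (by simp) h
    rw [mem_closedBall_zero_iff] at h1
    exact (Complex.abs_re_le_norm z).trans h1
  · rw [h.1]
    exact (Complex.abs_re_le_norm _).trans (le_add_of_nonneg_right (norm_nonneg _))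

/-- A real-analytic function that separates the strips: it does not vanish on `E⁻¹(ℂ \ 𝒜)`, and
its sign alternates on the lines at the heights `Im c + π + 2πl`. -/
lemma exists_strip_separator (ha : a ≠ 0) (hc : IsCritCentre a b c) :
    ∃ Ψ : ℂ → ℝ, Continuous Ψ ∧ (∀ z ∈ stripDomain a b c, Ψ z ≠ 0) ∧
      ∀ (l : ℤ) (z z' : ℂ), (z - c).im = Real.pi + 2 * Real.pi * l →
        (z' - c).im = Real.pi + 2 * Real.pi * (l + 1) → Ψ z * Ψ z' < 0 := by
  set v := critVal₁ a b c with hv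
  have hv0 : v ≠ 0 := critVal₁_ne_zero ha hc
  have hn : 0 < Complex.normSq v := Complex.normSq_pos.2 hv0
  obtain ⟨σ, hσ1, hσ2⟩ : ∃ σ : ℝ, (σ = 1 ∧ 0 ≤ v.im ∨ σ = -1 ∧ v.im < 0) ∧ 0 ≤ σ * v.im := by
    rcases le_or_gt 0 v.im with h | h
    · exact ⟨1, Or.inl ⟨rfl, h⟩, by simpa⟩
    · exact ⟨-1, Or.inr ⟨rfl, h⟩, by linarith⟩
  have hσ0 : σ ≠ 0 := by rcases hσ1 with h | h <;> rw [h.1] <;> norm_num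
  -- Since `E(z) = v + 2v sinh²((z - c)/2)`, a value `sinh((z - c)/2) = e u` with `u` real and `2v
  -- e² = σ i` gives `E(z) = v + σ i u²`, a point of the vertical ray in the slit. The separator is
  -- the component of `sinh` transversal to the line `ℝ e`.
  obtain ⟨e, he⟩ := IsAlgClosed.exists_eq_mul_self ((σ : ℂ) * Complex.I / (2 * v))
  have hee : 2 * v * (e * e) = σ * Complex.I := by rw [← he]; field_simp
  have hre : 0 ≤ (e * e).re := by
    have h1 : e * e = ((σ / (2 * Complex.normSq v) : ℝ) : ℂ) * (Complex.I * (starRingEnd ℂ) v) := by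
      rw [← he]
      have h2 : v * (starRingEnd ℂ) v = (Complex.normSq v : ℂ) := Complex.mul_conj v
      have h3 : (Complex.normSq v : ℂ) ≠ 0 := by exact_mod_cast hn.ne'
      push_cast
      field_simp
      rw [mul_assoc, h2]
    rw [h1, Complex.re_ofReal_mul]
    simp
    rw [div_mul_eq_mul_div]
    positivity
  -- The ray points upwards when `Im v ≥ 0` and downwards otherwise, so `Re (e²) ≥ 0` and `e` is not
  -- purely imaginary. On the separating lines `sinh` is `± i cosh`, so exactly this makes the
  -- separator nonzero there.
  have he0 : e.re ≠ 0 := by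
    intro h0
    rw [Complex.mul_re, h0] at hre
    have him : e.im = 0 := by nlinarith
    have : e = 0 := Complex.ext h0 him
    rw [this] at hee
    simp [hσ0] at hee
  refine ⟨fun z => (Complex.sinh ((z - c) / 2) * (starRingEnd ℂ) e).im, ?_, ?_, ?_⟩
  · have : Continuous fun z : ℂ => Complex.sinh ((z - c) / 2) :=
      Complex.continuous_sinh.comp (by fun_prop)
    exact Complex.continuous_im.comp (this.mul continuous_const)
  · intro z hz h0
    apply hz
    set w := Complex.sinh ((z - c) / 2) with hw
    have hne : e ≠ 0 := by rintro rfl; simp at he0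
    have hns : (Complex.normSq e : ℂ) ≠ 0 := by
      exact_mod_cast (Complex.normSq_pos.2 hne).ne'
    obtain ⟨u, hu⟩ : ∃ u : ℝ, w = e * u := by
      refine ⟨(w * (starRingEnd ℂ) e).re / Complex.normSq e, ?_⟩
      have h1 : w * (starRingEnd ℂ) e = ((w * (starRingEnd ℂ) e).re : ℂ) :=
        Complex.ext (by simp) (by simpa using h0)
      have h2 : e * (starRingEnd ℂ) e = (Complex.normSq e : ℂ) := Complex.mul_conj e
      push_cast
      rw [← h1, mul_div_assoc', eq_div_iff hns, ← h2]
      ring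
    have hE : cosMap a b z = v + σ * Complex.I * (u ^ 2 : ℝ) := by
      have h1 : z = c + 2 * ((z - c) / 2) := by ring
      rw [h1, cosMap_centre_add ha hc, Complex.cosh_two_mul, Complex.cosh_sq, ← hw, hu, ← hv,
        ← hee]
      push_cast
      ring
    right
    have hv2 : (critVal₂ a b c).im = -v.im := by rw [critVal₂_eq ha hc]; simp [hv]
    rw [mem_ofPred_eq, hE, ← hv, hv2]
    have i1 : (v + σ * Complex.I * (u ^ 2 : ℝ)).re = v.re := by
      rw [Complex.add_re, Complex.re_mul_ofReal]; simp
    have i2 : (v + σ * Complex.I * (u ^ 2 : ℝ)).im = v.im + σ * u ^ 2 := by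
      rw [Complex.add_im, Complex.im_mul_ofReal]; simp
    rw [i1, i2]
    refine ⟨rfl, ?_⟩
    rcases hσ1 with ⟨h, h'⟩ | ⟨h, h'⟩
    · left; rw [h]; constructor <;> nlinarith
    · right; rw [h]; constructor <;> nlinarith
  · intro l z z' hz hz'
    have key : ∀ (p : ℂ) (m : ℤ), (p - c).im = Real.pi + 2 * Real.pi * m →
        (Complex.sinh ((p - c) / 2) * (starRingEnd ℂ) e).im =
          (-1) ^ m * (Real.cosh ((p - c).re / 2) * e.re) := by
      intro p m hp
      have h1 : (p - c) / 2 = (((p - c).re / 2 : ℝ) : ℂ) +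
          (((p - c).im / 2 : ℝ) : ℂ) * Complex.I := by
        apply Complex.ext <;> simp
      have h2 : (p - c).im / 2 = Real.pi / 2 + m * Real.pi := by rw [hp]; ring
      have hc0 : Real.cos ((p - c).im / 2) = 0 := by
        rw [h2, Real.cos_add_int_mul_pi]; simp
      have hs0 : Real.sin ((p - c).im / 2) = (-1) ^ m := by
        rw [h2, Real.sin_add_int_mul_pi]; simp
      have h3 : Complex.sinh ((p - c) / 2) =
          ((Real.cosh ((p - c).re / 2) * (-1) ^ m : ℝ) : ℂ) * Complex.I := by
        rw [h1, Complex.sinh_add, Complex.cosh_mul_I, Complex.sinh_mul_I, ← Complex.ofReal_cos, ← Complex.ofReal_sin, hc0, hs0]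
        push_cast
        ring
      rw [h3, mul_assoc, Complex.im_ofReal_mul]
      simp
      ring
    simp only [key z l hz, key z' (l + 1) (by push_cast; exact hz'),
      zpow_add_one₀ (show (-1 : ℝ) ≠ 0 by norm_num)]
    have h1 : ((-1 : ℝ) ^ l) * (-1 : ℝ) ^ l = 1 := by
      rw [← mul_zpow]; norm_num
    have h2 := Real.cosh_pos ((z - c).re / 2)
    have h3 := Real.cosh_pos ((z' - c).re / 2)
    have h4 : 0 < e.re * e.re := mul_self_pos.2 he0
    have : (-1 : ℝ) ^ l * (Real.cosh ((z - c).re / 2) * e.re) *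
        ((-1) ^ l * -1 * (Real.cosh ((z' - c).re / 2) * e.re)) =
        -((((-1 : ℝ) ^ l) * (-1 : ℝ) ^ l) * (Real.cosh ((z - c).re / 2) *
          Real.cosh ((z' - c).re / 2) * (e.re * e.re))) := by ring
    rw [this, h1, one_mul, neg_lt_zero]
    positivity

/-- A connected set of vertical extent above `4π` meets two consecutive lines on which the separator
has opposite signs, so the separator would vanish on it. -/
lemma im_sub_le_of_isPreconnected (ha : a ≠ 0) (hc : IsCritCentre a b c) {U : Set ℂ}
    (hU : IsPreconnected U) (hsub : U ⊆ stripDomain a b c) {z z' : ℂ} (hz : z ∈ U)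
    (hz' : z' ∈ U) : z'.im - z.im ≤ 4 * Real.pi := by
  obtain ⟨Ψ, hΨ, hne, hsgn⟩ := exists_strip_separator ha hc
  by_contra! hcon
  have pi := Real.pi_pos
  set l : ℤ := ⌈((z - c).im - Real.pi) / (2 * Real.pi)⌉ with hl
  have l1 : ((z - c).im - Real.pi) / (2 * Real.pi) ≤ l := Int.le_ceil _
  have l2 : (l : ℝ) < ((z - c).im - Real.pi) / (2 * Real.pi) + 1 := Int.ceil_lt_add_one _
  rw [div_le_iff₀ (by positivity)] at l1
  have l3 : ((l : ℝ) - 1) * (2 * Real.pi) < (z - c).im - Real.pi := by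
    rw [← lt_div_iff₀ (by positivity)]; linarith
  have hd : (z' - c).im = (z - c).im + (z'.im - z.im) := by simp
  have hcont : ContinuousOn (fun p : ℂ => (p - c).im) U := by fun_prop
  obtain ⟨p, hp, hp'⟩ := hU.intermediate_value hz hz' hcont
    (show Real.pi + 2 * Real.pi * l ∈ Icc _ _ from ⟨by linarith, by rw [hd]; linarith⟩)
  obtain ⟨q, hq, hq'⟩ := hU.intermediate_value hz hz' hcont
    (show Real.pi + 2 * Real.pi * (l + 1) ∈ Icc _ _ from ⟨by linarith, by rw [hd]; linarith⟩)
  have hs := hsgn l p q hp' hq'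
  have h0 : (0 : ℝ) ∈ Ψ '' U := by
    rcases mul_neg_iff.1 hs with ⟨h1, h2⟩ | ⟨h1, h2⟩
    · exact hU.intermediate_value hq hp hΨ.continuousOn ⟨h2.le, h1.le⟩
    · exact hU.intermediate_value hp hq hΨ.continuousOn ⟨h1.le, h2.le⟩
  obtain ⟨r, hr, hr0⟩ := h0
  exact hne r (hsub hr) hr0

lemma mem_strip_iff {R : Symbol → Set ℂ} (hR : IsStripLabelling a b c R) (n : ℤ) (σ : Side)
    (z : ℂ) : z ∈ R (0, σ) ↔ z + 2 * Real.pi * Complex.I * n ∈ R (n, σ) := by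
  induction n using Int.induction_on with
  | zero => simp
  | succ i ih =>
    rw [ih, hR.translate]; push_cast; ring_nf
  | pred i ih =>
    have h := hR.translate (-(i : ℤ) - 1) σ (z + 2 * Real.pi * Complex.I * ((-(i : ℤ) - 1 : ℤ) : ℂ))
    rw [ih, h]; push_cast; ring_nf

lemma exists_strip_height (ha : a ≠ 0) (hc : IsCritCentre a b c) {R : Symbol → Set ℂ}
    (hR : IsStripLabelling a b c R) :
    ∃ B, ∀ j : Symbol, ∀ z ∈ R j, |z.im - 2 * Real.pi * j.1| ≤ B := by
  have h0 : ∀ σ : Side, ∃ B, ∀ z ∈ R (0, σ), |z.im| ≤ B := by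
    intro σ
    obtain ⟨p, hp, hRp⟩ := hR.component (0, σ)
    have hpR : p ∈ R (0, σ) := by rw [hRp]; exact mem_connectedComponentIn hp
    have hpre : IsPreconnected (R (0, σ)) := by rw [hRp]; exact isPreconnected_connectedComponentIn
    have hsub : R (0, σ) ⊆ stripDomain a b c := by rw [hRp]; exact connectedComponentIn_subset _ _
    refine ⟨|p.im| + 4 * Real.pi, fun z hz => ?_⟩
    have h1 := im_sub_le_of_isPreconnected ha hc hpre hsub hpR hz
    have h2 := im_sub_le_of_isPreconnected ha hc hpre hsub hz hpR
    rw [abs_le]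
    constructor <;> linarith [le_abs_self p.im, neg_abs_le p.im]
  choose B hB using h0
  refine ⟨max (B .L) (B .R), fun ⟨n, σ⟩ z hz => ?_⟩
  have h1 : z - 2 * Real.pi * Complex.I * n ∈ R (0, σ) := by
    rw [mem_strip_iff hR n]; simpa using hz
  have h2 := hB σ _ h1
  have h3 : (z - 2 * Real.pi * Complex.I * n).im = z.im - 2 * Real.pi * n := by
    have : (2 * Real.pi * Complex.I * n : ℂ) = ((2 * Real.pi * n : ℝ) : ℂ) * Complex.I := by
      push_cast; ring
    rw [this]; simp
  rw [h3] at h2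
  cases σ
  · exact h2.trans (le_max_left _ _)
  · exact h2.trans (le_max_right _ _)

end Strips

/-! ### From a dynamic ray to the data used by the topological argument -/

/-- What the topological part of the argument needs to know about a ray `γ : (τ, ∞) → ℂ` that
lands at the escaping point `γ τ`; `h k` is the height of the strip of the `k`-th entry of the
address. -/
structure LandingRay (a b : ℂ) (τ : ℝ) (γ : ℝ → ℂ) (h : ℕ → ℝ) (C : ℝ) : Prop where
  growth : Growth a b C
  continuous : Continuous γ
  nonneg : 0 ≤ τ
  small : ∀ t, τ < t → Tendsto (fun k => h k / F^[k] t) atTop (𝓝 0)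
  tail : ∀ t, τ < t → ∀ᶠ k in atTop, ∀ t', t ≤ t' →
    |(|((cosMap a b)^[k] (γ t')).re|) - F^[k] t'| ≤ C ∧ |((cosMap a b)^[k] (γ t')).im - h k| ≤ C
  strip : ∀ k t, τ < t → (∀ t', t ≤ t' → C ≤ |((cosMap a b)^[k + 1] (γ t')).re|) →
    ∀ t', t ≤ t' → |((cosMap a b)^[k] (γ t')).im - h k| ≤ C
  far : ∀ k, ∀ᶠ t in atTop, |((cosMap a b)^[k] (γ t)).im - h k| ≤ C
  far_re : ∀ k, Tendsto (fun t => ((cosMap a b)^[k] (γ t)).re) atTop atTop ∨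
    Tendsto (fun t => ((cosMap a b)^[k] (γ t)).re) atTop atBot
  inj : ∀ k, InjOn (fun t => (cosMap a b)^[k] (γ t)) (Ioi τ)
  noncrit : ∀ k t, τ < t →
    a * Complex.exp ((cosMap a b)^[k] (γ t)) - b * Complex.exp (-((cosMap a b)^[k] (γ t))) ≠ 0
  escaping : Tendsto (fun k => |((cosMap a b)^[k] (γ τ)).re|) atTop atTop

/-- Real parts and potentials are within a bounded distance if they are one step later. -/
lemma Growth.abs_re_sub_le {a b : ℂ} {C : ℝ} (G : Growth a b C) {z : ℂ} {x : ℝ}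
    (hx : 2 * C + 1 ≤ x) (hl : Real.exp x / 2 ≤ ‖cosMap a b z‖)
    (hu : ‖cosMap a b z‖ ≤ 4 * Real.exp x) : |(|z.re|) - x| ≤ C + 2 := by
  have e1 : (2 : ℝ) ≤ Real.exp 1 := by linarith [Real.add_one_le_exp 1]
  have e2 : (4 : ℝ) ≤ Real.exp 2 := by
    have : Real.exp 2 = Real.exp 1 * Real.exp 1 := by rw [← Real.exp_add]; norm_num
    nlinarith
  have h1 : Real.exp (x - 1) ≤ Real.exp (|z.re| + C) := by
    refine le_trans ?_ (hl.trans (G.upper z))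
    rw [Real.exp_sub]
    gcongr
  rw [Real.exp_le_exp] at h1
  have h2 : Real.exp (|z.re| - C) ≤ Real.exp (x + 2) := by
    refine (G.lower z (by linarith)).trans (hu.trans ?_)
    rw [Real.exp_add, mul_comm]
    gcongr
  rw [Real.exp_le_exp] at h2
  rw [abs_le]
  constructor <;> linarith

section Derivation

variable {a b c : ℂ} {R : Symbol → Set ℂ} {s : Address} {τ : ℝ} {G : ℕ → ℝ → ℂ}

lemma minPotential_nonneg (s : Address) : 0 ≤ minPotential s :=
  Real.sInf_nonneg fun _ h => h.1.le

lemma size_nonneg (j : Symbol) : 0 ≤ size j := abs_nonneg _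

lemma tendsto_size_div {t : ℝ} (hs : ExpBounded s) (ht : minPotential s < t) :
    Tendsto (fun k => size (s k) / F^[k] t) atTop (𝓝 0) := by
  obtain ⟨x, hx, hb⟩ := hs
  have hne : {t : ℝ | 0 < t ∧ Tendsto (fun k : ℕ => size (s k) / F^[k] t) atTop (𝓝 0)}.Nonempty := by
    refine ⟨x + 1, by linarith, squeeze_zero (fun k => ?_) (fun k => ?_)
      (tendsto_F_iter_div hx (lt_add_one x))⟩
    · exact div_nonneg (size_nonneg _) (F_iter_nonneg (by linarith) _)
    · exact div_le_div_of_nonneg_right (hb k) (F_iter_nonneg (by linarith) _)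
  obtain ⟨t', ⟨h0, h1⟩, hlt⟩ := exists_lt_of_csInf_lt hne ht
  refine squeeze_zero (fun k => ?_) (fun k => ?_) h1
  · exact div_nonneg (size_nonneg _) (F_iter_nonneg (by linarith) _)
  · exact div_le_div_of_nonneg_left (size_nonneg _) (F_iter_pos h0 _)
      ((F_iter_strictMono k).monotone hlt.le)

lemma IsRaySequence.nonneg (h : IsRaySequence a b c R s τ G) : minPotential s ≤ τ := by
  rcases h.initial with h | h
  · exact h.ge
  · exact h.1.le

lemma IsRaySequence.iterate (h : IsRaySequence a b c R s τ G) (n m : ℕ) {t : ℝ}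
    (ht : F^[m] τ < t) : (cosMap a b)^[n] (G m t) = G (m + n) (F^[n] t) := by
  induction n generalizing m t with
  | zero => rfl
  | succ n ih =>
    rw [Function.iterate_succ_apply, h.functional m t ht, ih]
    · rw [Function.iterate_succ_apply, show m + 1 + n = m + (n + 1) by ring]
    · rw [Function.iterate_succ_apply']; exact F_strictMono ht

/-- For `t' < t` above the minimal potential, the entries of the shifted address are eventually
small against the `F`-orbit of `F^n t'`, so `F^n t'` is admissible in the infimum. Thus every point
of the ray is eventually mapped into a ray tail. -/
lemma eventually_tailPotential_lt (a b : ℂ) {t : ℝ} (hs : ExpBounded s)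
    (ht : minPotential s < t) : ∀ᶠ n in atTop, tailPotential a b (shift n s) < F^[n] t := by
  obtain ⟨t', h1, h2⟩ := exists_between ht
  have h0 : 0 < t' := (minPotential_nonneg s).trans_lt h1
  have e1 := (tendsto_F_iter h0).eventually_ge_atTop (mapPotential a b)
  have pi := Real.pi_pos
  have e2 := (tendsto_size_div hs h1).eventually_lt_const (show (0 : ℝ) < 1 / (4 * Real.pi) by positivity)
  obtain ⟨N, hN⟩ := eventually_atTop.1 e2
  filter_upwards [e1, eventually_ge_atTop N] with n hn hnN
  refine lt_of_le_of_lt (csInf_le ⟨mapPotential a b, fun x hx => hx.1⟩ ⟨hn, fun k => ?_⟩)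
    (F_iter_strictMono n h2)
  have := hN (k + n) (by omega)
  rw [div_lt_iff₀ (F_iter_pos h0 _), Function.iterate_add_apply, div_mul_eq_mul_div, one_mul,
    lt_div_iff₀ (by positivity)] at this
  rw [shift]
  linarith

lemma IsRaySequence.eventually_far (h : IsRaySequence a b c R s τ G) (k : ℕ) :
    ∀ᶠ t in atTop, G k (F^[k] t) ∈ R (s k) := by
  filter_upwards [eventually_gt_atTop (tailPotential a b (shift k s))] with t ht
  have := ((h.tail k (F^[k] t) (ht.trans_le (le_F_iter k t))).address _ le_rfl 0).2
  simpa [shift] using this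

/-- The expression is `E'(z)`. In the form `E(c + ζ) = v₁ cosh ζ` its zeros are those of `sinh ζ`,
where `cosh ζ = ±1`. -/
lemma noncrit_of_ne (ha : a ≠ 0) (hc : IsCritCentre a b c) {z : ℂ}
    (h1 : cosMap a b z ≠ critVal₁ a b c) (h2 : cosMap a b z ≠ critVal₂ a b c) :
    a * Complex.exp z - b * Complex.exp (-z) ≠ 0 := by
  intro h0
  obtain ⟨ζ, rfl⟩ : ∃ ζ, z = c + ζ := ⟨z - c, by ring⟩
  rw [neg_add, Complex.exp_add, Complex.exp_add, ← mul_assoc b, critVal_relation ha hc] at h0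
  have h3 : Complex.sinh ζ = 0 := by
    have : a * Complex.exp c * (Complex.exp ζ - Complex.exp (-ζ)) = 0 := by
      linear_combination h0
    rw [mul_eq_zero] at this
    rw [Complex.sinh, this.resolve_left (mul_ne_zero ha (Complex.exp_ne_zero _)), zero_div]
  have h4 : (Complex.cosh ζ - 1) * (Complex.cosh ζ + 1) = 0 := by
    linear_combination Complex.cosh_sq ζ + Complex.sinh ζ * h3
  rw [cosMap_centre_add ha hc] at h1 h2
  rw [critVal₂_eq ha hc] at h2
  rcases mul_eq_zero.1 h4 with h | h
  · exact h1 (by rw [sub_eq_zero.1 h, mul_one])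
  · exact h2 (by rw [eq_neg_of_add_eq_zero_left h]; ring)

/-- Uniform estimates on the ray tails. -/
lemma IsRaySequence.uniform_tail {B C : ℝ} (h : IsRaySequence a b c R s τ G)
    (hG : Growth a b C) (hB : ∀ j : Symbol, ∀ z ∈ R j, |z.im - 2 * Real.pi * j.1| ≤ B) {t : ℝ}
    (ht : τ < t) : ∀ᶠ k in atTop, ∀ t', t ≤ t' →
      |(|(G k (F^[k] t')).re|) - F^[k] t'| ≤ C + 2 ∧
        |(G k (F^[k] t')).im - 2 * Real.pi * (s k).1| ≤ B := by
  have hm := h.nonneg.trans_lt ht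
  have pi := Real.pi_pos
  have t0 : 0 < t := (minPotential_nonneg s).trans_lt hm
  have hC := hG.one_le
  obtain ⟨N1, hN1⟩ := eventually_atTop.1 (eventually_tailPotential_lt a b h.expBounded hm)
  obtain ⟨N2, hN2⟩ := eventually_atTop.1 ((tendsto_size_div h.expBounded hm).eventually_lt_const
    (show (0 : ℝ) < 1 / (2 * Real.pi) by positivity))
  obtain ⟨N3, hN3⟩ := eventually_atTop.1 ((tendsto_F_iter t0).eventually_ge_atTop
    (4 * C + 20 + |B|))
  have tl : ∀ k, N1 ≤ k → ∀ t', t ≤ t' → IsRayTail a b c R (shift k s) (F^[k] t') (G k) :=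
    fun k hk t' ht' => h.tail k _ ((hN1 k hk).trans_le ((F_iter_strictMono k).monotone ht'))
  have im : ∀ k, N1 ≤ k → ∀ t', t ≤ t' → |(G k (F^[k] t')).im - 2 * Real.pi * (s k).1| ≤ B := by
    intro k hk t' ht'
    have := ((tl k hk t' ht').address _ le_rfl 0).2
    exact hB _ _ (by simpa [shift] using this)
  have hgt : ∀ k, N2 ≤ k → ∀ t', t ≤ t' → |2 * Real.pi * ((s k).1 : ℝ)| ≤ F^[k] t' := by
    intro k hk t' ht'
    have h1 := hN2 k hk
    rw [div_lt_iff₀ (F_iter_pos t0 _), div_mul_eq_mul_div, one_mul, lt_div_iff₀ (by positivity)] at h1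
    have h2 := (F_iter_strictMono k).monotone ht'
    rw [abs_mul, abs_of_pos (by positivity : 0 < 2 * Real.pi)]
    change _ * size (s k) ≤ _
    linarith
  have big : ∀ k, N3 ≤ k → ∀ t', t ≤ t' → 4 * C + 20 + |B| ≤ F^[k] t' := fun k hk t' ht' =>
    (hN3 k hk).trans ((F_iter_strictMono k).monotone ht')
  have bn := le_abs_self B
  have b0 := abs_nonneg B
  -- one step backwards
  have step : ∀ k, N1 + N2 + N3 ≤ k → ∀ t', t ≤ t' →
      |(|(G (k + 1) (F^[k + 1] t')).re|) - F^[k + 1] t'| ≤ C + 2 →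
        |(|(G k (F^[k] t')).re|) - F^[k] t'| ≤ C + 2 := by
    intro k hk t' ht' hs
    have hf : cosMap a b (G k (F^[k] t')) = G (k + 1) (F^[k + 1] t') := by
      have := h.iterate 1 k (t := F^[k] t') (F_iter_strictMono k (ht.trans_le ht'))
      rwa [← Function.iterate_add_apply, Function.iterate_one, add_comm 1 k] at this
    have i1 := im (k + 1) (by omega) t' ht'
    have g1 := hgt (k + 1) (by omega) t' ht'
    have g2 := big (k + 1) (by omega) t' ht'
    have e := exp_F_iter k t'
    rw [abs_le] at hs i1 g1
    refine hG.abs_re_sub_le (by linarith [big k (by omega) t' ht']) ?_ ?_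
    · rw [hf, e]
      linarith [Complex.abs_re_le_norm (G (k + 1) (F^[k + 1] t'))]
    · rw [hf, e]
      have i2 : |(G (k + 1) (F^[k + 1] t')).im| ≤ B + F^[k + 1] t' := by
        rw [abs_le]; constructor <;> linarith
      linarith [Complex.norm_le_abs_re_add_abs_im (G (k + 1) (F^[k + 1] t'))]
  filter_upwards [eventually_ge_atTop (N1 + N2 + N3)] with k hk t' ht'
  refine ⟨?_, im k (by omega) t' ht'⟩
  -- the asymptotics give the estimate for large indices, depending on `t'`
  obtain ⟨D, hD⟩ := (tl k (by omega) t' ht').asymptotics _ le_rfl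
  have t0' : 0 < t' := t0.trans_le ht'
  obtain ⟨M, hM⟩ := eventually_atTop.1 ((tendsto_F_iter t0').eventually_ge_atTop (4 * |D| + 20))
  have hlt : F^[k] τ < F^[k] t' := F_iter_strictMono k (ht.trans_le ht')
  have late : ∀ j, M ≤ j → |(|(G (k + j) (F^[k + j] t')).re|) - F^[k + j] t'| ≤ C + 2 := by
    intro j hj
    have hf : cosMap a b (G (k + j) (F^[k + j] t')) = (cosMap a b)^[j + 1] (G k (F^[k] t')) := by
      rw [Function.iterate_succ_apply', h.iterate j k hlt, ← Function.iterate_add_apply,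
        add_comm j k]
    have d := hD (j + 1)
    rw [← Function.iterate_add_apply, show j + 1 + k = k + j + 1 by ring] at d
    have sh : shift k s (j + 1) = s (k + j + 1) := by
      rw [shift]; congr 1; ring
    rw [sh] at d
    set Z := (cosMap a b)^[j + 1] (G k (F^[k] t')) with hZ
    set m := ((((s (k + j + 1)).2.sign * F^[k + j + 1] t' : ℝ) : ℂ) +
      2 * Real.pi * Complex.I * ((s (k + j + 1)).1 : ℂ)) with hm'
    have p0 := F_iter_pos t0' (k + j + 1)
    have mre : |m.re| = F^[k + j + 1] t' := by
      have h1 : (2 * Real.pi * Complex.I * ((s (k + j + 1)).1 : ℂ)) =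
        ((2 * Real.pi * (s (k + j + 1)).1 : ℝ) : ℂ) * Complex.I := by push_cast; ring
      rw [hm', h1]
      rw [Complex.add_re, Complex.ofReal_re]
      rw [Complex.re_ofReal_mul, Complex.I_re, mul_zero, add_zero]
      rcases (s (k + j + 1)).2 with _ | _
      · rw [Side.sign, neg_one_mul, abs_neg, abs_of_pos p0]
      · rw [Side.sign, one_mul, abs_of_pos p0]
    have mim : |m.im| ≤ F^[k + j + 1] t' := by
      have h1 : (2 * Real.pi * Complex.I * ((s (k + j + 1)).1 : ℂ)) =
        ((2 * Real.pi * (s (k + j + 1)).1 : ℝ) : ℂ) * Complex.I := by push_cast; ring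
      rw [hm', h1]
      rw [Complex.add_im, Complex.ofReal_im, Complex.im_ofReal_mul, Complex.I_im, mul_one, zero_add]
      exact hgt _ (by omega) t' ht'
    have n1 : F^[k + j + 1] t' ≤ ‖m‖ := mre ▸ Complex.abs_re_le_norm m
    have n2 : ‖m‖ ≤ 2 * F^[k + j + 1] t' := by
      linarith [Complex.norm_le_abs_re_add_abs_im m]
    have n3 := norm_sub_norm_le Z m
    have n4 := norm_sub_norm_le m Z
    rw [norm_sub_rev] at n4
    have e := exp_F_iter (k + j) t'
    have g := hM (k + j + 1) (by omega)
    have dn := le_abs_self D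
    have d0 := abs_nonneg D
    refine hG.abs_re_sub_le (by linarith [big (k + j) (by omega) t' ht']) ?_ ?_
    · rw [hf, e]; linarith
    · rw [hf, e]; linarith
  -- The threshold `M` depends on `t'`, but `step` reproduces the constant `C + 2` going backwards,
  -- so the estimate reaches an index `k` that does not depend on `t'`.
  have back : ∀ i j, i + j = M → |(|(G (k + j) (F^[k + j] t')).re|) - F^[k + j] t'| ≤ C + 2 := by
    intro i
    induction i with
    | zero => intro j hj; exact late j (by omega)
    | succ i ih =>
      intro j hj
      exact step (k + j) (by omega) t' ht' (ih (j + 1) (by omega))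
  exact back M 0 (by omega)

theorem exists_landingRay (ha : a ≠ 0) (hb : b ≠ 0) (hc : IsCritCentre a b c)
    (hR : IsStripLabelling a b c R) (h : IsRaySequence a b c R s τ G) {w : ℂ}
    (hland : LandsAt τ (G 0) w) (hw : IsEscaping a b w) :
    ∃ γ C, LandingRay a b τ γ (fun k => 2 * Real.pi * (s k).1) C ∧ γ τ = w ∧
      ∀ t, τ < t → γ t = G 0 t := by
  obtain ⟨C₀, hG⟩ := exists_growth ha hb
  obtain ⟨B, hB⟩ := exists_strip_height ha hc hR
  -- The constant value `w` on `(-∞, τ]` makes the curve continuous on the whole line, so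
  -- compactness can be used on `[τ, T]`.
  set γ : ℝ → ℂ := fun t => if τ < t then G 0 t else w with hγ
  have hγ1 : ∀ t, τ < t → γ t = G 0 t := fun t ht => if_pos ht
  have hγτ : γ τ = w := if_neg (lt_irrefl _)
  have horb : ∀ k t, τ < t → (cosMap a b)^[k] (γ t) = G k (F^[k] t) := by
    intro k t ht
    rw [hγ1 t ht, h.iterate k 0 (by simpa using ht), zero_add]
  have hcont : Continuous γ := by
    rw [continuous_iff_continuousAt]
    intro t
    rcases lt_trichotomy t τ with hlt | heq | hgt
    · exact continuousAt_const.congr (by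
        filter_upwards [eventually_lt_nhds hlt] with x hx
        rw [hγ]; exact (if_neg (not_lt.2 hx.le)).symm)
    · subst heq
      rw [continuousAt_iff_continuous_left'_right']
      constructor
      · refine (continuousWithinAt_const (b := w)).congr (fun x hx => if_neg (not_lt.2 (le_of_lt hx)))
          hγτ
      · rw [ContinuousWithinAt, hγτ]
        refine hland.congr' ?_
        filter_upwards [self_mem_nhdsWithin] with x hx
        exact (hγ1 x hx).symm
    · have := (h.continuousOn 0).continuousAt (Ioi_mem_nhds (a := F^[0] τ) hgt)
      exact this.congr (by
        filter_upwards [eventually_gt_nhds hgt] with x hx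
        exact (hγ1 x hx).symm)
  set S := ‖critVal₁ a b c‖ + ‖critVal₂ a b c‖ with hS
  -- The three entries serve the tail estimate, the height of the strips, and the condition that
  -- `|Re z| ≥ C` keeps `z` off the slit.
  set C := max (C₀ + 2) (max B (S + 1)) with hC
  have c1 : C₀ + 2 ≤ C := le_max_left _ _
  have c2 : B ≤ C := (le_max_left _ _).trans (le_max_right _ _)
  have c3 : S + 1 ≤ C := (le_max_right _ _).trans (le_max_right _ _)
  have himg : ∀ k t, τ < t → IsPreconnected ((fun t => (cosMap a b)^[k] (γ t)) '' Ici t) :=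
    fun k t _ => isPreconnected_Ici.image _
      ((continuous_cosMap_iter a b k).comp hcont).continuousOn
  refine ⟨γ, C, ⟨hG.mono (by linarith), hcont, (minPotential_nonneg s).trans h.nonneg, ?_, ?_, ?_,
    ?_, ?_, ?_, ?_, ?_⟩, hγτ, hγ1⟩
  · intro t ht
    have h1 := (tendsto_size_div h.expBounded (h.nonneg.trans_lt ht)).const_mul (2 * Real.pi)
    rw [mul_zero] at h1
    have t0 : 0 < t := ((minPotential_nonneg s).trans h.nonneg).trans_lt ht
    refine squeeze_zero_norm (fun k => ?_) h1
    rw [norm_div, norm_mul, Real.norm_of_nonneg Real.two_pi_pos.le,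
      Real.norm_of_nonneg (F_iter_pos t0 k).le, mul_div_assoc]
    rfl
  · intro t ht
    filter_upwards [h.uniform_tail hG hB ht] with k hk t' ht'
    rw [horb k t' (ht.trans_le ht')]
    exact ⟨(hk t' ht').1.trans c1, (hk t' ht').2.trans c2⟩
  -- Far real parts at time `k + 1` keep the image at time `k` inside `E⁻¹(ℂ \ 𝒜)`. It is connected
  -- and its far end lies in the strip of `s k`, so all of it does.
  · intro k t ht hre t' ht'
    have hsub : ((fun t => (cosMap a b)^[k] (γ t)) '' Ici t) ⊆ stripDomain a b c := by
      rintro _ ⟨x, hx, rfl⟩ hmem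
      have h1 := abs_re_le_of_mem_slit hmem
      have h2 := hre x hx
      rw [Function.iterate_succ_apply'] at h2
      linarith
    obtain ⟨T, hT1, hT2⟩ := ((h.eventually_far k).and (eventually_ge_atTop t)).exists
    rw [← horb k T (ht.trans_le hT2)] at hT1
    obtain ⟨p, hp, hRp⟩ := hR.component (s k)
    refine (hB (s k) _ ?_).trans c2
    have h3 := (himg k t ht).subset_connectedComponentIn (mem_image_of_mem _ hT2) hsub
    rw [hRp] at hT1
    have h4 := connectedComponentIn_eq hT1
    rw [hRp, h4]
    exact h3 (mem_image_of_mem _ ht')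
  · intro k
    filter_upwards [h.eventually_far k, eventually_gt_atTop τ] with t ht htτ
    rw [horb k t htτ]
    exact (hB _ _ ht).trans c2
  · intro k
    have hF : Tendsto F^[k] atTop atTop := tendsto_atTop_mono (le_F_iter k) tendsto_id
    have he : ∀ᶠ t in atTop, (G k (F^[k] t)).re = ((cosMap a b)^[k] (γ t)).re := by
      filter_upwards [eventually_gt_atTop τ] with t ht
      rw [horb k t ht]
    rcases (h.tail k _ (lt_add_one _)).re_tendsto with h1 | h1
    · exact Or.inl ((h1.comp hF).congr' he)
    · exact Or.inr ((h1.comp hF).congr' he)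
  · intro k t ht t' ht' heq
    simp only at heq
    rw [horb k t ht, horb k t' ht'] at heq
    exact (F_iter_strictMono k).injective
      (h.injOn k (F_iter_strictMono k ht) (F_iter_strictMono k ht') heq)
  · intro k t ht
    have hf : cosMap a b ((cosMap a b)^[k] (γ t)) = G (k + 1) (F^[k + 1] t) := by
      rw [← horb (k + 1) t ht, Function.iterate_succ_apply']
    have hav := h.avoids (k + 1) (by omega) _ (F_iter_strictMono (k + 1) ht)
    rw [← hf] at hav
    exact noncrit_of_ne ha hc hav.1 hav.2
  · rw [hγτ]
    rw [tendsto_atTop]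
    intro r
    -- The norm at time `k + 1` is at most `exp (|Re| + C₀)` at time `k`, so escape forces the real
    -- parts to infinity.
    have h1 := (tendsto_add_atTop_iff_nat 1).2 hw
    filter_upwards [h1.eventually_ge_atTop (Real.exp (r + C₀))] with k hk
    rw [Function.iterate_succ_apply'] at hk
    have := hk.trans (hG.upper _)
    rw [Real.exp_le_exp] at this
    linarith

end Derivation

/-! ### Far orbits propagate to higher potentials -/

lemma Growth.abs_re_compare {a b : ℂ} {C r : ℝ} (G : Growth a b C) {z z' : ℂ} (hz : C ≤ |z.re|)
    (h : ‖cosMap a b z‖ ≤ Real.exp r * ‖cosMap a b z'‖) : |z.re| - (2 * C + r) ≤ |z'.re| := by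
  have h1 := (G.lower z hz).trans (h.trans (mul_le_mul_of_nonneg_left (G.upper z') (Real.exp_pos r).le))
  rw [← Real.exp_add, Real.exp_le_exp] at h1
  linarith

lemma norm_le_of_abs_le {z z' : ℂ} {A B : ℝ} (h1 : |z.re| ≤ |z'.re| + A) (h2 : |z.im| ≤ |z'.im| + B) :
    ‖z‖ ≤ 2 * ‖z'‖ + (A + B) := by
  linarith [Complex.norm_le_abs_re_add_abs_im z, Complex.abs_re_le_norm z', Complex.abs_im_le_norm z']

lemma four_le_exp_two : (4 : ℝ) ≤ Real.exp 2 := by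
  have e1 : (2 : ℝ) ≤ Real.exp 1 := by linarith [Real.add_one_le_exp 1]
  have : Real.exp 2 = Real.exp 1 * Real.exp 1 := by rw [← Real.exp_add]; norm_num
  nlinarith

/-- If the orbit of one point of the ray stays far from the imaginary axis, then so do the orbits
of all points of higher potential. -/
theorem LandingRay.up {a b : ℂ} {τ C K t₀ : ℝ} {γ : ℝ → ℂ} {h : ℕ → ℝ} (L : LandingRay a b τ γ h C)
    (hK : 12 * C + 4 ≤ K) {n : ℕ} (ht₀ : τ < t₀)
    (hgood : ∀ k, n ≤ k → K ≤ |((cosMap a b)^[k] (γ t₀)).re|) :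
    ∀ k, n ≤ k → ∀ t, t₀ ≤ t →
      |((cosMap a b)^[k] (γ t₀)).re| - (2 * C + 2) ≤ |((cosMap a b)^[k] (γ t)).re| ∧
        |((cosMap a b)^[k] (γ t)).im - h k| ≤ C := by
  have hC := L.growth.one_le
  obtain ⟨k₀, hk₀⟩ := eventually_atTop.1 (L.tail t₀ ht₀)
  suffices ∀ i k, n ≤ k → k₀ ≤ k + i → ∀ t, t₀ ≤ t →
      |((cosMap a b)^[k] (γ t₀)).re| - (2 * C + 2) ≤ |((cosMap a b)^[k] (γ t)).re| ∧
        |((cosMap a b)^[k] (γ t)).im - h k| ≤ C from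
    fun k hk => this k₀ k hk (by omega)
  -- Downward induction on the time: `i` bounds the distance to `k₀`, from which the tail estimates
  -- hold.
  intro i
  induction i with
  | zero =>
    intro k _ hk t ht
    have h1 := hk₀ k hk t ht
    have h2 := (hk₀ k hk t₀ le_rfl).1
    have h3 := h1.1
    have h4 := (F_iter_strictMono k).monotone ht
    rw [abs_le] at h2 h3
    exact ⟨by linarith, h1.2⟩
  | succ i ih =>
    intro k hk hki
    have IH := ih (k + 1) (by omega) (by omega)
    have him := L.strip k t₀ ht₀ fun t' ht' => by
      have := (IH t' ht').1
      have := hgood (k + 1) (by omega)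
      linarith
    intro t ht
    refine ⟨L.growth.abs_re_compare (by linarith [hgood k hk]) ?_, him t ht⟩
    rw [← Function.iterate_succ_apply' (cosMap a b), ← Function.iterate_succ_apply' (cosMap a b)]
    set z := (cosMap a b)^[k + 1] (γ t₀)
    set z' := (cosMap a b)^[k + 1] (γ t)
    have h1 : |z.re| ≤ |z'.re| + (2 * C + 2) := by linarith [(IH t ht).1]
    have h2 : |z.im| ≤ |z'.im| + 2 * C := by
      have e1 := (IH t ht).2
      have e2 := (IH t₀ le_rfl).2
      have := abs_sub_abs_le_abs_sub z.im z'.im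
      have := abs_sub_le z.im (h (k + 1)) z'.im
      rw [abs_sub_comm (h (k + 1))] at this
      linarith
    -- This reads `‖z‖ ≤ 2‖z'‖ + (4C + 2)`. Because `K ≥ 12C + 4`, the last term is at most half of
    -- `‖z‖`, so `‖z‖ ≤ 4‖z'‖ ≤ e²‖z'‖` and the loss `2C + 2` reproduces itself.
    have h3 := norm_le_of_abs_le h1 h2
    have h4 : K ≤ ‖z‖ := (hgood (k + 1) (by omega)).trans (Complex.abs_re_le_norm z)
    nlinarith [four_le_exp_two, norm_nonneg z']

/-- Near the landing point no point of the ray has an orbit that stays far from the imaginary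
axis. This is what we want to refute. -/
def NoUniformTime (a b : ℂ) (τ : ℝ) (γ : ℝ → ℂ) (K : ℝ) : Prop :=
  ∀ n : ℕ, ∃ δ, τ < δ ∧ ∀ t, τ < t → t < δ → ∃ k, n ≤ k ∧ |((cosMap a b)^[k] (γ t)).re| < K

/-- Points with far orbits from time `n` on then occur arbitrarily close to the landing point, hence
below any given potential. -/
lemma LandingRay.uniform_of_not_noUniformTime {a b : ℂ} {τ C K : ℝ} {γ : ℝ → ℂ} {h : ℕ → ℝ}
    (L : LandingRay a b τ γ h C) (hK : 12 * C + 4 ≤ K) (hN : ¬ NoUniformTime a b τ γ K) :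
    ∃ n, ∀ k, n ≤ k → ∀ t, τ < t → K - (2 * C + 2) ≤ |((cosMap a b)^[k] (γ t)).re| := by
  unfold NoUniformTime at hN
  push Not at hN
  obtain ⟨n, hn⟩ := hN
  refine ⟨n, fun k hk t ht => ?_⟩
  obtain ⟨t₀, h1, h2, h3⟩ := hn t ht
  have := (L.up hK h1 h3 k hk t h2.le).1
  linarith [h3 k hk]

/-! ### Long arcs contain points with good orbits -/

/-- Take the first parameter where `u` reaches `q`, and before it the last one where `u` is at most
`p`. -/
lemma exists_subarc {u : ℝ → ℝ} {α β p q : ℝ} (hαβ : α ≤ β) (hu : ContinuousOn u (Icc α β))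
    (hpq : p < q) (h1 : u α ≤ p) (h2 : q ≤ u β) :
    ∃ α' β', α ≤ α' ∧ α' ≤ β' ∧ β' ≤ β ∧ u α' = p ∧ u β' = q ∧
      ∀ t ∈ Icc α' β', p ≤ u t ∧ u t ≤ q := by
  have c1 : IsCompact (Icc α β ∩ u ⁻¹' Ici q) :=
    isCompact_Icc.of_isClosed_subset (hu.preimage_isClosed_of_isClosed isClosed_Icc isClosed_Ici)
      inter_subset_left
  obtain ⟨β', ⟨hβ, hβ2⟩, hβ'⟩ := c1.exists_isLeast ⟨β, right_mem_Icc.2 hαβ, h2⟩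
  have hu' : ContinuousOn u (Icc α β') := hu.mono (Icc_subset_Icc_right hβ.2)
  have c2 : IsCompact (Icc α β' ∩ u ⁻¹' Iic p) :=
    isCompact_Icc.of_isClosed_subset (hu'.preimage_isClosed_of_isClosed isClosed_Icc isClosed_Iic)
      inter_subset_left
  obtain ⟨α', ⟨hα, hα2⟩, hα'⟩ := c2.exists_isGreatest ⟨α, left_mem_Icc.2 hβ.1, h1⟩
  have hu'' : ContinuousOn u (Icc α' β') := hu'.mono (Icc_subset_Icc_left hα.1)
  simp only [mem_preimage, mem_Ici, mem_Iic] at hβ2 hα2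
  have e1 : u β' = q := by
    obtain ⟨x, hx, hxq⟩ := intermediate_value_Icc hβ.1 hu' (show q ∈ Icc (u α) (u β') from
      ⟨by linarith, hβ2⟩)
    have := hβ' ⟨⟨hx.1, hx.2.trans hβ.2⟩, hxq.ge⟩
    rw [le_antisymm this hx.2, hxq]
  have e2 : u α' = p := by
    obtain ⟨x, hx, hxp⟩ := intermediate_value_Icc hα.2 hu'' (show p ∈ Icc (u α') (u β') from
      ⟨hα2, by linarith⟩)
    have := hα' ⟨⟨hα.1.trans hx.1, hx.2⟩, hxp.le⟩
    rw [le_antisymm hx.1 this, hxp]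
  refine ⟨α', β', hα.1, hα.2, hβ.2, e2, e1, fun t ht => ⟨?_, ?_⟩⟩
  · by_contra hlt
    push Not at hlt
    have := hα' ⟨⟨hα.1.trans ht.1, ht.2⟩, hlt.le⟩
    rw [le_antisymm this ht.1, e2] at hlt
    exact lt_irrefl _ hlt
  · by_contra hlt
    push Not at hlt
    have := hβ' ⟨⟨hα.1.trans ht.1, ht.2.trans hβ.2⟩, hlt.le⟩
    rw [le_antisymm ht.2 this, e1] at hlt
    exact lt_irrefl _ hlt

/-- An interval of length `4π` contains a whole period, and so a full window of width `π/2` about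
some `2πm - A`. -/
lemma exists_window {u : ℝ → ℝ} {α β : ℝ} (hαβ : α ≤ β) (hu : ContinuousOn u (Icc α β))
    (hv : 4 * Real.pi ≤ |u α - u β|) (A : ℝ) :
    ∃ (m : ℤ) (α' β' : ℝ), α ≤ α' ∧ α' ≤ β' ∧ β' ≤ β ∧
      (∀ t ∈ Icc α' β', |u t - 2 * Real.pi * m + A| ≤ Real.pi / 4) ∧
      ((u α' - 2 * Real.pi * m + A = -(Real.pi / 4) ∧ u β' - 2 * Real.pi * m + A = Real.pi / 4) ∨
        (u α' - 2 * Real.pi * m + A = Real.pi / 4 ∧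
          u β' - 2 * Real.pi * m + A = -(Real.pi / 4))) := by
  have pi := Real.pi_pos
  have key : ∀ lo : ℝ, ∃ m : ℤ, lo ≤ 2 * Real.pi * m - A - Real.pi / 4 ∧
      2 * Real.pi * m - A + Real.pi / 4 ≤ lo + 4 * Real.pi := by
    intro lo
    refine ⟨⌈(lo + A + Real.pi / 4) / (2 * Real.pi)⌉, ?_, ?_⟩
    · have := Int.le_ceil ((lo + A + Real.pi / 4) / (2 * Real.pi))
      rw [div_le_iff₀ (by positivity)] at this
      linarith
    · have := (Int.ceil_lt_add_one ((lo + A + Real.pi / 4) / (2 * Real.pi))).le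
      rw [← sub_le_iff_le_add, le_div_iff₀ (by positivity)] at this
      linarith
  rcases le_total (u α) (u β) with hle | hle
  · rw [abs_sub_comm, abs_of_nonneg (by linarith)] at hv
    obtain ⟨m, h1, h2⟩ := key (u α)
    obtain ⟨α', β', k1, k2, k3, k4, k5, k6⟩ := exists_subarc hαβ hu
      (p := 2 * Real.pi * m - A - Real.pi / 4) (q := 2 * Real.pi * m - A + Real.pi / 4)
      (by linarith) h1 (by linarith)
    refine ⟨m, α', β', k1, k2, k3, fun t ht => ?_, Or.inl ⟨by linarith, by linarith⟩⟩
    have := k6 t ht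
    rw [abs_le]; constructor <;> linarith
  · rw [abs_of_nonneg (by linarith)] at hv
    obtain ⟨m, h1, h2⟩ := key (u β)
    obtain ⟨α', β', k1, k2, k3, k4, k5, k6⟩ := exists_subarc hαβ hu.neg
      (p := -(2 * Real.pi * m - A + Real.pi / 4)) (q := -(2 * Real.pi * m - A - Real.pi / 4))
      (by linarith) (by simp only [Pi.neg_apply]; linarith) (by simp only [Pi.neg_apply]; linarith)
    simp only [Pi.neg_apply] at k4 k5 k6
    refine ⟨m, α', β', k1, k2, k3, fun t ht => ?_, Or.inr ⟨by linarith, by linarith⟩⟩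
    have := k6 t ht
    rw [abs_le]; constructor <;> linarith

lemma exp_sub_int_mul_I (x : ℝ) (m : ℤ) :
    Complex.exp (((x - 2 * Real.pi * m : ℝ) : ℂ) * Complex.I) = Complex.exp (x * Complex.I) := by
  rw [Complex.exp_eq_exp_iff_exists_int]
  exact ⟨-m, by push_cast; ring⟩

lemma le_exp_sub {C K x : ℝ} (hC : 1 ≤ C) (hK : 12 * C + 4 ≤ K) (hx : K ≤ x) :
    x ≤ Real.exp (x - C) := by
  have := Real.quadratic_le_exp_of_nonneg (show 0 ≤ x - C by linarith)
  nlinarith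

lemma re_pos_or_neg {f : ℝ → ℂ} {S : Set ℝ} (hS : IsPreconnected S) (hf : ContinuousOn f S) {K : ℝ}
    (hK : 0 < K) (h : ∀ t ∈ S, K ≤ |(f t).re|) :
    (∀ t ∈ S, K ≤ (f t).re) ∨ (∀ t ∈ S, (f t).re ≤ -K) := by
  by_contra! hcon
  obtain ⟨⟨x, hx, h1⟩, ⟨y, hy, h2⟩⟩ := hcon
  have h3 : (f x).re ≤ 0 := by
    rcases le_abs.1 (h x hx) with h | h <;> linarith
  have h4 : 0 ≤ (f y).re := by
    rcases le_abs.1 (h y hy) with h | h <;> linarith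
  obtain ⟨z, hz, hz0⟩ := hS.intermediate_value hx hy (Complex.continuous_re.comp_continuousOn hf)
    ⟨h3, h4⟩
  have := h z hz
  simp only [Function.comp] at hz0
  rw [hz0, abs_zero] at this
  linarith

/-- On a window where `E` turns the arc through the sector `|arg| ≤ π/4`, real parts stay at least
`K` and the ends go above `2π` and below `-2π`. The hypotheses thus recur for the image and can be
iterated. -/
lemma Growth.exists_turn {a b : ℂ} {C K : ℝ} (G : Growth a b C) (hK : 12 * C + 4 ≤ K) {f : ℝ → ℂ}
    {α β : ℝ} (hαβ : α ≤ β) (hf : ContinuousOn f (Icc α β)) (hre : ∀ t ∈ Icc α β, K ≤ |(f t).re|)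
    (hv : 4 * Real.pi ≤ |(f α).im - (f β).im|) :
    ∃ α' β', α ≤ α' ∧ α' ≤ β' ∧ β' ≤ β ∧ (∀ t ∈ Icc α' β', K ≤ |(cosMap a b (f t)).re|) ∧
      4 * Real.pi ≤ |(cosMap a b (f α')).im - (cosMap a b (f β')).im| := by
  have hC := G.one_le
  have hu : ContinuousOn (fun t => (f t).im) (Icc α β) := Complex.continuous_im.comp_continuousOn hf
  have big : ∀ x, K ≤ x → 2 * Real.pi ≤ Real.exp (x - C) := fun x hx => by
    have := le_exp_sub hC hK hx
    linarith [Real.pi_lt_four]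
  have fin : ∀ x y r s : ℝ, 2 * Real.pi ≤ r → 2 * Real.pi ≤ s → ((x ≤ -r ∧ s ≤ y) ∨ (r ≤ x ∧ y ≤ -s)) →
      4 * Real.pi ≤ |x - y| := by
    rintro x y r s hr hs (⟨h1, h2⟩ | ⟨h1, h2⟩)
    · rw [abs_sub_comm]; exact le_trans (by linarith) (le_abs_self _)
    · exact le_trans (by linarith) (le_abs_self _)
  rcases re_pos_or_neg isPreconnected_Icc hf (by linarith) hre with hs | hs
  · obtain ⟨m, α', β', k1, k2, k3, k4, k5⟩ := exists_window hαβ hu hv a.arg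
    have hsub : Icc α' β' ⊆ Icc α β := Icc_subset_Icc k1 k3
    have T : ∀ t ∈ Icc α' β', _ := fun t ht => G.turn (f t) (by linarith [hs t (hsub ht)])
      ((f t).im - 2 * Real.pi * m) (exp_sub_int_mul_I _ m) (k4 t ht)
    refine ⟨α', β', k1, k2, k3, fun t ht => ?_, ?_⟩
    · exact ((hs t (hsub ht)).trans ((le_exp_sub hC hK (hs t (hsub ht))).trans (T t ht).1)).trans
        (le_abs_self _)
    · have hl := left_mem_Icc.2 k2
      have hr := right_mem_Icc.2 k2
      refine fin _ _ _ _ (big _ (hs _ (hsub hl))) (big _ (hs _ (hsub hr))) ?_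
      rcases k5 with ⟨e1, e2⟩ | ⟨e1, e2⟩
      · exact Or.inl ⟨(T _ hl).2.2 e1, (T _ hr).2.1 e2⟩
      · exact Or.inr ⟨(T _ hl).2.1 e1, (T _ hr).2.2 e2⟩
  · obtain ⟨m, α', β', k1, k2, k3, k4, k5⟩ := exists_window hαβ hu.neg
      (by simp only [Pi.neg_apply]; rwa [neg_sub_neg, abs_sub_comm]) b.arg
    have hsub : Icc α' β' ⊆ Icc α β := Icc_subset_Icc k1 k3
    have hs' : ∀ t ∈ Icc α' β', K ≤ -(f t).re := fun t ht => by linarith [hs t (hsub ht)]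
    have T : ∀ t ∈ Icc α' β', _ := fun t ht => G.turn' (f t) (by linarith [hs' t ht])
      (-(f t).im - 2 * Real.pi * m) (exp_sub_int_mul_I _ m) (k4 t ht)
    refine ⟨α', β', k1, k2, k3, fun t ht => ?_, ?_⟩
    · exact ((hs' t ht).trans ((le_exp_sub hC hK (hs' t ht)).trans (T t ht).1)).trans
        (le_abs_self _)
    · have hl := left_mem_Icc.2 k2
      have hr := right_mem_Icc.2 k2
      refine fin _ _ _ _ (big _ (hs' _ hl)) (big _ (hs' _ hr)) ?_
      rcases k5 with ⟨e1, e2⟩ | ⟨e1, e2⟩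
      · exact Or.inl ⟨(T _ hl).2.2 e1, (T _ hr).2.1 e2⟩
      · exact Or.inr ⟨(T _ hl).2.1 e1, (T _ hr).2.2 e2⟩

lemma Growth.exists_orbit_far {a b : ℂ} {C K : ℝ} (G : Growth a b C) (hK : 12 * C + 4 ≤ K) (n : ℕ) :
    ∀ {f : ℝ → ℂ} {α β : ℝ}, α ≤ β → ContinuousOn f (Icc α β) →
      (∀ t ∈ Icc α β, K ≤ |(f t).re|) → 4 * Real.pi ≤ |(f α).im - (f β).im| →
      ∃ t ∈ Icc α β, ∀ j, j ≤ n → K ≤ |((cosMap a b)^[j] (f t)).re| := by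
  induction n with
  | zero =>
    intro f α β hαβ _ hre _
    refine ⟨α, left_mem_Icc.2 hαβ, fun j hj => ?_⟩
    rw [Nat.le_zero.1 hj]
    exact hre α (left_mem_Icc.2 hαβ)
  | succ n ih =>
    intro f α β hαβ hf hre hv
    obtain ⟨α', β', k1, k2, k3, k4, k5⟩ := G.exists_turn hK hαβ hf hre hv
    have hsub : Icc α' β' ⊆ Icc α β := Icc_subset_Icc k1 k3
    obtain ⟨t, ht, h⟩ := ih (f := fun t => cosMap a b (f t)) k2
      ((continuous_cosMap a b).comp_continuousOn (hf.mono hsub)) k4 k5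
    refine ⟨t, hsub ht, fun j hj => ?_⟩
    rcases j with _ | j
    · exact hre t (hsub ht)
    · rw [Function.iterate_succ_apply]
      exact h j (by omega)

/-- Compactness: if every finite piece of an orbit condition can be met, then so can the whole. -/
lemma exists_forall_of_forall_exists {X : Type*} [TopologicalSpace X] {S : Set X} (hS : IsCompact S)
    {φ : ℕ → X → ℝ} (hφ : ∀ j, ContinuousOn (φ j) S) {K : ℝ}
    (h : ∀ n, ∃ t ∈ S, ∀ j, j ≤ n → K ≤ φ j t) : ∃ t ∈ S, ∀ j, K ≤ φ j t := by
  by_contra! hcon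
  choose! j hj using hcon
  have hcov : ∀ t ∈ S, ∃ U ∈ 𝓝[S] t, ∃ n, ∀ t' ∈ U, ∃ i, i ≤ n ∧ φ i t' < K := fun t ht =>
    ⟨_, (hφ (j t) t ht).eventually_lt_const (hj t ht), j t, fun t' ht' => ⟨_, le_rfl, ht'⟩⟩
  obtain ⟨n, hn⟩ : ∃ n, ∀ t' ∈ S, ∃ i, i ≤ n ∧ φ i t' < K := by
    refine hS.induction_on (p := fun S => ∃ n, ∀ t' ∈ S, ∃ i, i ≤ n ∧ φ i t' < K) ⟨0, by simp⟩
      ?_ ?_ hcov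
    · rintro s t hst ⟨n, hn⟩
      exact ⟨n, fun t' ht' => hn t' (hst ht')⟩
    · rintro s t ⟨n, hn⟩ ⟨m, hm⟩
      refine ⟨max n m, fun t' ht' => ?_⟩
      rcases ht' with h | h
      · obtain ⟨i, hi, hi'⟩ := hn t' h
        exact ⟨i, hi.trans (le_max_left _ _), hi'⟩
      · obtain ⟨i, hi, hi'⟩ := hm t' h
        exact ⟨i, hi.trans (le_max_right _ _), hi'⟩
  obtain ⟨t, ht, hK⟩ := h n
  obtain ⟨i, hi, hi'⟩ := hn t ht
  exact absurd (hK i hi) (not_le.2 hi')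

theorem Growth.exists_orbit_far_forever {a b : ℂ} {C K : ℝ} (G : Growth a b C)
    (hK : 12 * C + 4 ≤ K) {f : ℝ → ℂ} {α β : ℝ} (hαβ : α ≤ β) (hf : ContinuousOn f (Icc α β))
    (hre : ∀ t ∈ Icc α β, K ≤ |(f t).re|) (hv : 4 * Real.pi ≤ |(f α).im - (f β).im|) :
    ∃ t ∈ Icc α β, ∀ j, K ≤ |((cosMap a b)^[j] (f t)).re| :=
  exists_forall_of_forall_exists isCompact_Icc
    (fun j => (continuous_abs.comp Complex.continuous_re).comp_continuousOn
      ((continuous_cosMap_iter a b j).comp_continuousOn hf))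
    (fun n => G.exists_orbit_far hK n hαβ hf hre hv)

/-! ### Speed of escape of the landing point -/

section

variable {a b : ℂ} {τ C K : ℝ} {γ : ℝ → ℂ} {h : ℕ → ℝ}

lemma LandingRay.continuous_orbit (L : LandingRay a b τ γ h C) (k : ℕ) :
    Continuous fun t => (cosMap a b)^[k] (γ t) :=
  (continuous_cosMap_iter a b k).comp L.continuous

lemma LandingRay.continuous_abs_re (L : LandingRay a b τ γ h C) (k : ℕ) :
    Continuous fun t => |((cosMap a b)^[k] (γ t)).re| :=
  continuous_abs.comp (Complex.continuous_re.comp (L.continuous_orbit k))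

/-- Close to the landing point there are points of the ray that follow the orbit of the landing
point until their orbits come close to the imaginary axis. -/
theorem LandingRay.exists_exit (L : LandingRay a b τ γ h C) (hK : 12 * C + 4 ≤ K)
    (hN : NoUniformTime a b τ γ K) {n : ℕ}
    (hw : ∀ j, n ≤ j → K < |((cosMap a b)^[j] (γ τ)).re|) (J : ℕ) {ε : ℝ} (hε : τ < ε) :
    ∃ t, τ < t ∧ t < ε ∧ ∃ j, J < j ∧ n ≤ j ∧ |((cosMap a b)^[j] (γ t)).re| ≤ K ∧
      ∀ i, n ≤ i → i ≤ j →
        |((cosMap a b)^[i] (γ t)).im - ((cosMap a b)^[i] (γ τ)).im| ≤ 4 * Real.pi := by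
  obtain ⟨δ, hδ, hδ'⟩ := hN n
  have h1 : ∀ᶠ t in 𝓝[>] τ, ∀ i ∈ Finset.range (J + 1), n ≤ i →
      K < |((cosMap a b)^[i] (γ t)).re| := by
    refine (Finset.eventually_all _).2 fun i _ => ?_
    by_cases hi : n ≤ i
    · have := (L.continuous_abs_re i).continuousAt.eventually_const_lt (hw i hi)
      exact (eventually_nhdsWithin_of_eventually_nhds this).mono fun t ht _ => ht
    · exact Eventually.of_forall fun t hi' => absurd hi' hi
  obtain ⟨u, hu, hu'⟩ := mem_nhdsGT_iff_exists_Ioo_subset.1 h1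
  obtain ⟨t₁, ht₁, ht₁'⟩ := exists_between (lt_min hu (lt_min hδ hε))
  rw [lt_min_iff, lt_min_iff] at ht₁'
  obtain ⟨k, hk, hk'⟩ := hδ' t₁ ht₁ ht₁'.2.1
  -- The exit point is the first parameter at which one of the iterates `n, …, k` reaches `|Re z| ≤
  -- K`; at `t₁` the `k`-th one is already there.
  set S : Set ℝ := Icc τ t₁ ∩ ⋃ i ∈ Finset.Icc n k, {t | |((cosMap a b)^[i] (γ t)).re| ≤ K} with hS
  have cS : IsCompact S := by
    refine isCompact_Icc.inter_right (isClosed_biUnion_finset fun i _ => ?_)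
    exact isClosed_le (L.continuous_abs_re i) continuous_const
  have hne : S.Nonempty := by
    refine ⟨t₁, right_mem_Icc.2 ht₁.le, ?_⟩
    simp only [mem_iUnion]
    exact ⟨k, Finset.mem_Icc.2 ⟨hk, le_rfl⟩, hk'.le⟩
  obtain ⟨t, ⟨htI, htU⟩, hmin⟩ := cS.exists_isLeast hne
  simp only [mem_iUnion, Finset.mem_Icc, exists_prop] at htU
  obtain ⟨j, ⟨hnj, hjk⟩, hj⟩ := htU
  simp only [mem_ofPred_eq] at hj
  have hτt : τ < t := by
    rcases htI.1.lt_or_eq with h | h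
    · exact h
    · rw [← h] at hj
      exact absurd hj (not_le.2 (hw j hnj))
  have before : ∀ t' i, τ ≤ t' → t' < t → n ≤ i → i ≤ k → K ≤ |((cosMap a b)^[i] (γ t')).re| := by
    intro t' i h1 h2 hi hik
    by_contra hlt
    push Not at hlt
    refine absurd (hmin ⟨⟨h1, h2.le.trans htI.2⟩, ?_⟩) (not_le.2 h2)
    simp only [mem_iUnion]
    exact ⟨i, Finset.mem_Icc.2 ⟨hi, hik⟩, hlt.le⟩
  have upto : ∀ t' i, τ ≤ t' → t' ≤ t → n ≤ i → i ≤ k → K ≤ |((cosMap a b)^[i] (γ t')).re| := by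
    intro t' i h1 h2 hi hik
    rcases h2.lt_or_eq with h2 | rfl
    · exact before t' i h1 h2 hi hik
    · refine ge_of_tendsto ((L.continuous_abs_re i).continuousAt.tendsto.mono_left
        (nhdsWithin_le_nhds (s := Iio t'))) ?_
      filter_upwards [Ioo_mem_nhdsLT hτt] with x hx
      exact before x i hx.1.le hx.2 hi hik
  refine ⟨t, hτt, htI.2.trans_lt ht₁'.2.2, j, ?_, hnj, hj, ?_⟩
  · by_contra hJ
    have := hu' ⟨hτt, htI.2.trans_lt ht₁'.1⟩ j (Finset.mem_range.2 (by omega)) hnj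
    exact absurd hj (not_le.2 this)
  · intro i hi hij
    by_contra! hlt
    have hc : Continuous fun x => |((cosMap a b)^[i] (γ x)).im - ((cosMap a b)^[i] (γ t)).im| :=
      continuous_abs.comp ((Complex.continuous_im.comp (L.continuous_orbit i)).sub continuous_const)
    rw [abs_sub_comm] at hlt
    -- The strict height difference persists from `τ` to some `x > τ`. The arc over `[x, t]` then
    -- contains a point whose iterates from `i` on stay far, and the earlier ones from `n` on are
    -- far by `upto`, against `NoUniformTime`.
    have h2 := eventually_nhdsWithin_of_eventually_nhds (s := Ioi τ)
      (hc.continuousAt.eventually_const_lt hlt)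
    obtain ⟨x, hx, hx'⟩ := (h2.and (Ioo_mem_nhdsGT hτt)).exists
    obtain ⟨y, hy, hy'⟩ := L.growth.exists_orbit_far_forever hK hx'.2.le
      (L.continuous_orbit i).continuousOn
      (fun t' ht' => upto t' i (hx'.1.le.trans ht'.1) ht'.2 hi (hij.trans hjk)) hx.le
    have hτy := hx'.1.trans_le hy.1
    obtain ⟨k', hk1, hk2⟩ := hδ' y hτy (hy.2.trans_lt (htI.2.trans_lt ht₁'.2.1))
    rcases le_or_gt i k' with hik | hik
    · have := hy' (k' - i)
      rw [← Function.iterate_add_apply, Nat.sub_add_cancel hik] at this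
      linarith
    · linarith [upto y k' hτy.le hy.2 hk1 (by omega)]

/-- The landing point cannot escape at the speed of a point of positive potential. -/
theorem LandingRay.false_of_fast (L : LandingRay a b τ γ h C) (hK : 12 * C + 4 ≤ K)
    (hN : NoUniformTime a b τ γ K) {n : ℕ} {p P D : ℝ} (hp : 0 < p) (hpP : p < P)
    (hre : ∀ᶠ k in atTop, F^[k] P - D ≤ |((cosMap a b)^[n + k] (γ τ)).re|)
    (him : Tendsto (fun k => ((cosMap a b)^[n + k] (γ τ)).im / F^[k] p) atTop (𝓝 0)) : False := by
  have hC := L.growth.one_le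
  have e1 : ∀ᶠ k in atTop, |((cosMap a b)^[n + k] (γ τ)).im| ≤ F^[k] p := by
    filter_upwards [him.abs.eventually_lt_const (show |(0 : ℝ)| < 1 by simp)] with k hk
    rw [abs_div, abs_of_pos (F_iter_pos hp k), div_lt_one (F_iter_pos hp k)] at hk
    exact hk.le
  obtain ⟨I, hI⟩ := eventually_atTop.1 (e1.and (((tendsto_F_iter hp).eventually_ge_atTop
    (K + 4 * Real.pi)).and (L.escaping.eventually_gt_atTop K)))
  obtain ⟨m, hmI, hm1, hm2⟩ := ((eventually_ge_atTop I).and (hre.and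
    ((tendsto_F_iter_sub hp hpP).eventually_ge_atTop (D + K + 2)))).exists
  have hc := (L.continuous_abs_re (n + m)).continuousAt.eventually_const_lt
    (sub_one_lt |((cosMap a b)^[n + m] (γ τ)).re|)
  obtain ⟨ε, hε, hε'⟩ := mem_nhdsGT_iff_exists_Ioo_subset.1
    (eventually_nhdsWithin_of_eventually_nhds (s := Ioi τ) hc)
  obtain ⟨t, ht, htε, j, hJ, hnj, hj, hheight⟩ := L.exists_exit hK hN (n := n + m)
    (fun j hj => (hI j (by omega)).2.2) 0 hε
  -- Up to the exit time the heights are within `4π` of those of the landing orbit, hence of order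
  -- at most `F^i p`. A small real part at time `i + 1` therefore bounds the norm there, and with it
  -- the real part at time `i`. At `i = m` this contradicts the closeness to the landing orbit.
  have back : ∀ d i, m ≤ i → n + i + d = j → |((cosMap a b)^[n + i] (γ t)).re| ≤ F^[i] p + K := by
    intro d
    induction d with
    | zero =>
      intro i _ hij
      rw [show n + i = j by omega]
      linarith [F_iter_pos hp i]
    | succ d ih =>
      intro i hi hij
      have IH := ih (i + 1) (by omega) (by omega)
      by_contra! hcon
      have l := L.growth.lower ((cosMap a b)^[n + i] (γ t)) (by linarith [F_iter_pos hp i])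
      rw [← Function.iterate_succ_apply' (cosMap a b), Nat.succ_eq_add_one, add_assoc] at l
      have h1 := hheight (n + (i + 1)) (by omega) (by omega)
      have h2 := hI (i + 1) (by omega)
      set z := (cosMap a b)^[n + (i + 1)] (γ t)
      have h3 := Complex.norm_le_abs_re_add_abs_im z
      have h4 := abs_sub_abs_le_abs_sub z.im ((cosMap a b)^[n + (i + 1)] (γ τ)).im
      have h5 : ‖z‖ ≤ 3 * F^[i + 1] p := by linarith [h2.1, h2.2.1]
      have h6 : Real.exp (F^[i] p + 2) ≤ Real.exp (|((cosMap a b)^[n + i] (γ t)).re| - C) :=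
        Real.exp_le_exp.2 (by linarith)
      rw [Real.exp_add, exp_F_iter] at h6
      nlinarith [four_le_exp_two, F_iter_pos hp (i + 1)]
  have h1 := back (j - n - m) m le_rfl (by omega)
  have h2 := hε' ⟨ht, htε⟩
  simp only [mem_ofPred_eq] at h2
  linarith

lemma LandingRay.tendsto_height_div (L : LandingRay a b τ γ h C) {t M : ℝ} (ht : τ < t) {x : ℕ → ℝ}
    (hx : ∀ᶠ k in atTop, |x k| ≤ M * (|h k| + 1)) :
    Tendsto (fun k => x k / F^[k] t) atTop (𝓝 0) := by
  have t0 : 0 < t := L.nonneg.trans_lt ht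
  have h1 : Tendsto (fun k => M * (|h k / F^[k] t| + (F^[k] t)⁻¹)) atTop (𝓝 0) := by
    have := ((L.small t ht).abs.add (tendsto_F_iter t0).inv_tendsto_atTop).const_mul M
    simpa using this
  refine squeeze_zero_norm' ?_ h1
  filter_upwards [hx] with k hk
  have p := F_iter_pos t0 k
  rw [Real.norm_eq_abs, abs_div, abs_div, abs_of_pos p, div_le_iff₀ p]
  calc |x k| ≤ M * (|h k| + 1) := hk
    _ = _ := by field_simp

/-- If the heights of the orbit of the landing point are comparable with those of the address,
then the landing point escapes more slowly than every point of the ray. -/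
lemma LandingRay.norm_le_of_height (L : LandingRay a b τ γ h C) (hK : 12 * C + 4 ≤ K)
    (hN : NoUniformTime a b τ γ K) {M : ℝ}
    (hM : ∀ᶠ k in atTop, |((cosMap a b)^[k] (γ τ)).im| ≤ M * (|h k| + 1)) {t : ℝ} (ht : τ < t) :
    ∀ᶠ k in atTop, ‖(cosMap a b)^[k] (γ τ)‖ ≤ F^[k] t := by
  have hC := L.growth.one_le
  by_contra hcon
  rw [not_eventually] at hcon
  obtain ⟨t₁, h1, h1'⟩ := exists_between ht
  obtain ⟨t₂, h2, h2'⟩ := exists_between h1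
  have t20 : 0 < t₂ := L.nonneg.trans_lt h2
  have t10 : 0 < t₁ := t20.trans h2'
  have him := L.tendsto_height_div h2 hM
  obtain ⟨N, hN'⟩ := eventually_atTop.1 ((him.abs.eventually_lt_const
    (show |(0 : ℝ)| < 1 by simp)).and ((tendsto_F_iter t10).eventually_ge_atTop (C + 2)))
  have hge : ∀ᶠ k in atTop, F^[k] t₁ + F^[k] t₂ + (C + 2) ≤ F^[k] t := by
    filter_upwards [(tendsto_F_iter_div t10 h1').eventually_lt_const
      (show (0 : ℝ) < 1 / 4 by norm_num), (tendsto_F_iter_div t20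
      (h2'.trans h1')).eventually_lt_const (show (0 : ℝ) < 1 / 4 by norm_num),
      (tendsto_F_iter (t10.trans h1')).eventually_ge_atTop (2 * (C + 2))] with k k1 k2 k3
    have p := F_iter_pos (t10.trans h1') k
    rw [div_lt_iff₀ p] at k1 k2
    linarith
  obtain ⟨n, hn1, hn2, hn3⟩ := (hcon.and_eventually ((eventually_ge_atTop N).and hge)).exists
  have him' : ∀ k, N ≤ k → |((cosMap a b)^[k] (γ τ)).im| ≤ F^[k] t₂ := by
    intro k hk
    have := (hN' k hk).1
    rw [abs_div, abs_of_pos (F_iter_pos t20 k), div_lt_one (F_iter_pos t20 k)] at this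
    exact this.le
  -- Heights stay below `F^k t₂`, so a norm above `F^n t` comes from the real part. The margin `C +
  -- 2` then pays for the lower growth bound and leaves a factor `e² ≥ 4`, enough to restore the
  -- margin at every step.
  have fwd : ∀ i, F^[n + i] t₁ + (C + 2) ≤ |((cosMap a b)^[n + i] (γ τ)).re| := by
    intro i
    induction i with
    | zero =>
      have := Complex.norm_le_abs_re_add_abs_im ((cosMap a b)^[n] (γ τ))
      have := him' n hn2
      rw [add_zero]
      linarith
    | succ i ih =>
      have p := F_iter_pos t10 (n + i)
      have l := L.growth.lower ((cosMap a b)^[n + i] (γ τ)) (by linarith)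
      rw [← Function.iterate_succ_apply' (cosMap a b), Nat.succ_eq_add_one, add_assoc] at l
      have h6 : Real.exp (F^[n + i] t₁ + 2) ≤
          Real.exp (|((cosMap a b)^[n + i] (γ τ)).re| - C) := Real.exp_le_exp.2 (by linarith)
      rw [Real.exp_add, exp_F_iter, add_assoc] at h6
      have k1 := Complex.norm_le_abs_re_add_abs_im ((cosMap a b)^[n + (i + 1)] (γ τ))
      have k2 := him' (n + (i + 1)) (by omega)
      have k3 := (F_iter_strictMono (n + (i + 1))) h2'
      have k4 := (hN' (n + (i + 1)) (by omega)).2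
      nlinarith [four_le_exp_two]
  refine L.false_of_fast hK hN (n := n) (p := F^[n] t₂) (P := F^[n] t₁) (D := 0)
    (F_iter_pos t20 n) (F_iter_strictMono n h2') (Eventually.of_forall fun k => ?_) ?_
  · have := fwd k
    rw [← Function.iterate_add_apply, add_comm k n]
    linarith
  · have := (tendsto_add_atTop_iff_nat n).2 him
    refine this.congr fun k => ?_
    rw [← Function.iterate_add_apply, add_comm k n]

/-- The heights of the orbit of the landing point cannot be comparable with those of the
address. -/
theorem LandingRay.false_of_height (L : LandingRay a b τ γ h C) (hK : 12 * C + 4 ≤ K)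
    (hN : NoUniformTime a b τ γ K) {M : ℝ} (hM0 : 0 ≤ M)
    (hM : ∀ᶠ k in atTop, |((cosMap a b)^[k] (γ τ)).im| ≤ M * (|h k| + 1)) : False := by
  have hC := L.growth.one_le
  -- The induction below yields `‖z‖ ≤ (1 + M)‖z'‖ + D + M(C + 1)` for the landing orbit `z` and a
  -- ray orbit `z'`. The margin in the choice of `n` absorbs the additive part, leaving the factor
  -- `2(1 + M) = e^r`, for which `Growth.abs_re_compare` loses exactly `D`.
  set r := Real.log (2 * (1 + M)) with hr
  have er : Real.exp r = 2 * (1 + M) := Real.exp_log (by linarith)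
  have r0 : 0 ≤ r := Real.log_nonneg (by linarith)
  set D := 2 * C + r with hD
  have MC : 0 ≤ M * (C + 1) := by positivity
  obtain ⟨n, hn⟩ := eventually_atTop.1 (hM.and (L.escaping.eventually_ge_atTop
    (K + D + 2 * (D + M * (C + 1)))))
  obtain ⟨δ, hδ, hδ'⟩ := hN n
  obtain ⟨t₀, ht₀, ht₀'⟩ := exists_between hδ
  obtain ⟨k, hk, hk'⟩ := hδ' t₀ ht₀ ht₀'
  obtain ⟨k₀, hk₀⟩ := eventually_atTop.1 ((L.tail t₀ ht₀).and (L.norm_le_of_height hK hN hM ht₀))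
  -- The induction starts at late times, where the landing point is slower than `t₀`, and runs
  -- backwards to `n`.
  have back : ∀ i k, n ≤ k → k₀ ≤ k + i → ∀ t, t₀ ≤ t →
      |((cosMap a b)^[k] (γ τ)).re| - D ≤ |((cosMap a b)^[k] (γ t)).re| ∧
        |((cosMap a b)^[k] (γ t)).im - h k| ≤ C := by
    intro i
    induction i with
    | zero =>
      intro k _ hk t ht
      obtain ⟨h1, h2⟩ := hk₀ k hk
      have h3 := (h1 t ht).1
      have h4 := (F_iter_strictMono k).monotone ht
      have h5 := Complex.abs_re_le_norm ((cosMap a b)^[k] (γ τ))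
      rw [abs_le] at h3
      exact ⟨by linarith, (h1 t ht).2⟩
    | succ i ih =>
      intro k hk hki
      have IH := ih (k + 1) (by omega) (by omega)
      have hn1 := hn (k + 1) (by omega)
      have him := L.strip k t₀ ht₀ fun t' ht' => by
        have := (IH t' ht').1
        linarith
      intro t ht
      refine ⟨L.growth.abs_re_compare (by linarith [(hn k hk).2]) ?_, him t ht⟩
      rw [← Function.iterate_succ_apply' (cosMap a b), ← Function.iterate_succ_apply' (cosMap a b),
        er]
      obtain ⟨i1, i2⟩ := IH t ht
      set z := (cosMap a b)^[k + 1] (γ τ)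
      set z' := (cosMap a b)^[k + 1] (γ t)
      have h1 := abs_sub_abs_le_abs_sub (h (k + 1)) z'.im
      rw [abs_sub_comm] at h1
      have h2 : M * (|h (k + 1)| + 1) ≤ M * (‖z'‖ + (C + 1)) := by
        refine mul_le_mul_of_nonneg_left ?_ hM0
        linarith [Complex.abs_im_le_norm z']
      have h3 := Complex.norm_le_abs_re_add_abs_im z
      have h4 := Complex.abs_re_le_norm z
      have h5 := Complex.abs_re_le_norm z'
      nlinarith [hn1.1, hn1.2]
  have := (back k₀ k hk (by omega) t₀ le_rfl).1
  linarith [(hn k hk).2]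

/-- The orbit of the landing point does not meet the forward images of the ray. -/
theorem LandingRay.ne_of_lt (L : LandingRay a b τ γ h C) (hK : 12 * C + 4 ≤ K)
    (hN : NoUniformTime a b τ γ K) (i j : ℕ) {t : ℝ} (ht : τ < t) :
    (cosMap a b)^[i] (γ τ) ≠ (cosMap a b)^[j] (γ t) := by
  intro heq
  obtain ⟨t₂, h2, h2'⟩ := exists_between ht
  have t20 : 0 < t₂ := L.nonneg.trans_lt h2
  have e : ∀ k, (cosMap a b)^[i + k] (γ τ) = (cosMap a b)^[k + j] (γ t) := fun k => by
    rw [add_comm i k, Function.iterate_add_apply, heq, ← Function.iterate_add_apply]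
  refine L.false_of_fast hK hN (n := i) (p := F^[j] t₂) (P := F^[j] t) (D := C)
    (F_iter_pos t20 j) (F_iter_strictMono j h2') ?_ ?_
  · filter_upwards [(tendsto_add_atTop_nat j).eventually (L.tail t ht)] with k hk
    have := (hk t le_rfl).1
    rw [abs_le] at this
    rw [e, ← Function.iterate_add_apply]
    linarith
  · have hC := L.growth.one_le
    have := (tendsto_add_atTop_iff_nat j).2 (L.tendsto_height_div h2 (M := C)
      (x := fun k => ((cosMap a b)^[k] (γ t)).im) (by
        filter_upwards [L.tail t ht] with k hk
        have h1 := (hk t le_rfl).2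
        have h3 := abs_sub_abs_le_abs_sub ((cosMap a b)^[k] (γ t)).im (h k)
        nlinarith [abs_nonneg (h k)]))
    refine this.congr fun k => ?_
    rw [← Function.iterate_add_apply, e]

lemma LandingRay.not_periodic (L : LandingRay a b τ γ h C) (n : ℕ) {d : ℕ} (hd : 0 < d) :
    (cosMap a b)^[n + d] (γ τ) ≠ (cosMap a b)^[n] (γ τ) := by
  intro heq
  have e : ∀ i : ℕ, (cosMap a b)^[n + d * i] (γ τ) = (cosMap a b)^[n] (γ τ) := by
    intro i
    induction i with
    | zero => rfl
    | succ i ih =>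
      rw [show n + d * (i + 1) = d + (n + d * i) by ring, Function.iterate_add_apply, ih,
        ← Function.iterate_add_apply, add_comm, heq]
  obtain ⟨N, hN⟩ := eventually_atTop.1
    (L.escaping.eventually_gt_atTop |((cosMap a b)^[n] (γ τ)).re|)
  have := hN (n + d * N) (by nlinarith)
  rw [e] at this
  exact lt_irrefl _ this

end

/-! ### Disjointness of the forward images of the ray -/

/-- Two lifts of the same map under `E` that avoid the critical points and agree somewhere are
equal. -/
lemma eq_of_cosMap_comp_eq {X : Type*} [TopologicalSpace X] [PreconnectedSpace X] {a b : ℂ}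
    {f g : X → ℂ} (hf : Continuous f) (hg : Continuous g)
    (heq : ∀ x, cosMap a b (f x) = cosMap a b (g x))
    (hne : ∀ x, a * Complex.exp (f x) - b * Complex.exp (-f x) ≠ 0) {x₀ : X} (h₀ : f x₀ = g x₀) :
    f = g := by
  have hcl : IsClosed {x | f x = g x} := isClosed_eq hf hg
  have hop : IsOpen {x | f x = g x} := by
    rw [isOpen_iff_mem_nhds]
    intro x hx
    simp only [mem_ofPred_eq] at hx
    have c1 : ContinuousAt (fun y => a * Complex.exp (f y) - b * Complex.exp (-g y)) x := by fun_prop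
    have c2 : ContinuousAt (fun y => ‖g y - f y‖) x := by fun_prop
    have e1 := c1.eventually_ne (y := 0) (by rw [← hx]; exact hne x)
    have e2 := c2.tendsto.eventually_lt_const (u := 1) (by rw [hx]; simp)
    filter_upwards [e1, e2] with y h1 h2
    have h3 := heq y
    unfold cosMap at h3
    have k1 : Complex.exp (g y) = Complex.exp (f y) * Complex.exp (g y - f y) := by
      rw [← Complex.exp_add]; ring_nf
    have k2 : Complex.exp (-f y) = Complex.exp (-g y) * Complex.exp (g y - f y) := by
      rw [← Complex.exp_add]; ring_nf
    have h4 : (Complex.exp (g y - f y) - 1) *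
        (a * Complex.exp (f y) - b * Complex.exp (-g y)) = 0 := by
      rw [k1, k2] at h3
      linear_combination -h3
    have h5 := sub_eq_zero.1 ((mul_eq_zero.1 h4).resolve_right h1)
    obtain ⟨n, hn⟩ := Complex.exp_eq_one_iff.1 h5
    rw [hn] at h2
    have h6 : ‖(n : ℂ) * (2 * Real.pi * Complex.I)‖ = |(n : ℝ)| * (2 * Real.pi) := by
      rw [norm_mul, norm_mul, Complex.norm_I, norm_mul, Complex.norm_real, Complex.norm_intCast,
        Complex.norm_two, Real.norm_of_nonneg Real.pi_pos.le, mul_one]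
    rw [h6] at h2
    have h7 : n = 0 := by
      by_contra hn0
      have : (1 : ℝ) ≤ |(n : ℝ)| := by exact_mod_cast Int.one_le_abs hn0
      nlinarith [Real.pi_gt_three]
    rw [h7, Int.cast_zero, zero_mul, sub_eq_zero] at hn
    exact hn.symm
  have := IsClopen.eq_univ ⟨hcl, hop⟩ ⟨x₀, h₀⟩
  funext x
  exact (this ▸ mem_univ x : x ∈ {x | f x = g x})

section

variable {a b : ℂ} {τ C K : ℝ} {γ : ℝ → ℂ} {h : ℕ → ℝ}

/-- After the meeting the orbits coincide, and their real parts follow the `F`-orbits of both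
potentials up to `C`. -/
lemma LandingRay.potential_eq (L : LandingRay a b τ γ h C) {n d : ℕ} {t t' : ℝ} (ht : τ < t)
    (ht' : τ < t') (heq : (cosMap a b)^[n + d] (γ t) = (cosMap a b)^[n] (γ t')) :
    t' = F^[d] t := by
  have t0 := L.nonneg.trans_lt ht
  have t0' := L.nonneg.trans_lt ht'
  obtain ⟨N, hN⟩ := eventually_atTop.1 ((L.tail t ht).and (L.tail t' ht'))
  have e : F^[N + n] (F^[d] t) = F^[N + n] t' := by
    refine eq_of_F_iter_sub_bounded (C := 2 * C) (F_iter_pos (F_iter_pos t0 _) _)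
      (F_iter_pos t0' _) fun k => ?_
    rw [← Function.iterate_add_apply, ← Function.iterate_add_apply, ← Function.iterate_add_apply]
    have h1 := ((hN (k + (N + n) + d) (by omega)).1 t le_rfl).1
    have h2 := ((hN (k + (N + n)) (by omega)).2 t' le_rfl).1
    rw [show k + (N + n) + d = (k + N) + (n + d) by ring, Function.iterate_add_apply, heq,
      ← Function.iterate_add_apply, show k + N + n = k + (N + n) by ring,
      show k + N + (n + d) = k + (N + n) + d by ring, abs_sub_comm] at h1
    have := abs_sub_le (F^[k + (N + n) + d] t) |((cosMap a b)^[k + (N + n)] (γ t')).re|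
      (F^[k + (N + n)] t')
    linarith
  exact ((F_iter_strictMono _).injective e).symm

lemma le_F_iter' {x : ℝ} (d : ℕ) {Q : ℝ} (h : Q ≤ x) : Q ≤ F^[d] x := h.trans (le_F_iter d x)

lemma abs_sub_le_of_same_sign {x y X A : ℝ} (h : 0 < x * y) (hx : |(|x|) - X| ≤ A)
    (hy : |(|y|) - X| ≤ A) : |x - y| ≤ 2 * A := by
  have h1 : |x - y| = |(|x|) - (|y|)| := by
    rcases mul_pos_iff.1 h with ⟨h1, h2⟩ | ⟨h1, h2⟩
    · rw [abs_of_pos h1, abs_of_pos h2]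
    · rw [abs_of_neg h1, abs_of_neg h2, neg_sub_neg, abs_sub_comm]
  rw [h1]
  have := abs_sub_le |x| X |y|
  rw [abs_sub_comm X] at this
  linarith

/-- If two iterates of the ray meet at one point of the same potential, then their tails agree. -/
lemma LandingRay.tails_eq (L : LandingRay a b τ γ h C) {n d : ℕ} {t Q : ℝ} (hQ : τ < Q) (hQt : Q ≤ t)
    (heq : (cosMap a b)^[n + d] (γ t) = (cosMap a b)^[n] (γ (F^[d] t))) :
    ∀ᶠ k in atTop, ∀ x, Q ≤ x → (cosMap a b)^[k + d] (γ x) = (cosMap a b)^[k] (γ (F^[d] x)) := by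
  have hC := L.growth.one_le
  have Q0 := L.nonneg.trans_lt hQ
  obtain ⟨N, hN⟩ := eventually_atTop.1 ((L.tail Q hQ).and
    ((tendsto_F_iter Q0).eventually_ge_atTop (26 * C)))
  have hcα : ∀ k, Continuous fun x => (cosMap a b)^[k + d] (γ x) := fun k => L.continuous_orbit _
  have hcβ : ∀ k, Continuous fun x => (cosMap a b)^[k] (γ (F^[d] x)) :=
    fun k => (L.continuous_orbit k).comp (continuous_F_iter d)
  have heqk : ∀ k, n ≤ k → (cosMap a b)^[k + d] (γ t) = (cosMap a b)^[k] (γ (F^[d] t)) := by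
    intro k hk
    rw [show k + d = (k - n) + (n + d) by omega, Function.iterate_add_apply, heq,
      ← Function.iterate_add_apply, Nat.sub_add_cancel hk]
  -- The curves have equal potentials, so their real parts agree up to sign and `2C`. The common
  -- point at `t` gives both the same sign and nearby strips.
  have main : ∀ k, N + n ≤ k → ∀ x, Q ≤ x →
      25 * C ≤ |((cosMap a b)^[k + d] (γ x)).re| ∧
      25 * C ≤ |((cosMap a b)^[k] (γ (F^[d] x))).re| ∧
      0 < ((cosMap a b)^[k + d] (γ x)).re * ((cosMap a b)^[k] (γ (F^[d] x))).re ∧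
      ‖(cosMap a b)^[k + d] (γ x) - (cosMap a b)^[k] (γ (F^[d] x))‖ ≤ 6 * C := by
    intro k hk
    have ha : ∀ x, Q ≤ x → |(|((cosMap a b)^[k + d] (γ x)).re|) - F^[k + d] x| ≤ C ∧
        |((cosMap a b)^[k + d] (γ x)).im - h (k + d)| ≤ C :=
      fun x hx => (hN (k + d) (by omega)).1 x hx
    have hb : ∀ x, Q ≤ x → |(|((cosMap a b)^[k] (γ (F^[d] x))).re|) - F^[k + d] x| ≤ C ∧
        |((cosMap a b)^[k] (γ (F^[d] x))).im - h k| ≤ C := by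
      intro x hx
      rw [Function.iterate_add_apply]
      exact (hN k (by omega)).1 _ (le_F_iter' d hx)
    have hF : ∀ x, Q ≤ x → 26 * C ≤ F^[k + d] x := fun x hx =>
      (hN (k + d) (by omega)).2.trans ((F_iter_strictMono _).monotone hx)
    have big1 : ∀ x ∈ Ici Q, 25 * C ≤ |((cosMap a b)^[k + d] (γ x)).re| := fun x hx => by
      have := (ha x hx).1
      rw [abs_le] at this
      linarith [hF x hx]
    have big2 : ∀ x ∈ Ici Q, 25 * C ≤ |((cosMap a b)^[k] (γ (F^[d] x))).re| := fun x hx => by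
      have := (hb x hx).1
      rw [abs_le] at this
      linarith [hF x hx]
    have hsign : ∀ x, Q ≤ x →
        0 < ((cosMap a b)^[k + d] (γ x)).re * ((cosMap a b)^[k] (γ (F^[d] x))).re := by
      intro x hx
      have e := congrArg Complex.re (heqk k (by omega))
      rcases re_pos_or_neg isPreconnected_Ici (hcα k).continuousOn (by linarith) big1 with s1 | s1 <;>
      rcases re_pos_or_neg isPreconnected_Ici (hcβ k).continuousOn (by linarith) big2 with s2 | s2
      · nlinarith [s1 x hx, s2 x hx]
      · linarith [s1 t hQt, s2 t hQt]
      · linarith [s1 t hQt, s2 t hQt]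
      · nlinarith [s1 x hx, s2 x hx]
    intro x hx
    refine ⟨big1 x hx, big2 x hx, hsign x hx, ?_⟩
    have r := abs_sub_le_of_same_sign (hsign x hx) (ha x hx).1 (hb x hx).1
    have e := congrArg Complex.im (heqk k (by omega))
    have i1 := (ha t hQt).2
    have i2 := (hb t hQt).2
    have i3 := (ha x hx).2
    have i4 := (hb x hx).2
    have i : |((cosMap a b)^[k + d] (γ x)).im - ((cosMap a b)^[k] (γ (F^[d] x))).im| ≤ 4 * C := by
      rw [abs_le] at *
      constructor <;> linarith
    have := Complex.norm_le_abs_re_add_abs_im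
      ((cosMap a b)^[k + d] (γ x) - (cosMap a b)^[k] (γ (F^[d] x)))
    rw [Complex.sub_re, Complex.sub_im] at this
    linarith
  have expand : ∀ k, N + n ≤ k → ∀ x, Q ≤ x →
      ‖(cosMap a b)^[k + d] (γ x) - (cosMap a b)^[k] (γ (F^[d] x))‖ ≤ 1 / 2 →
      24 * C * ‖(cosMap a b)^[k + d] (γ x) - (cosMap a b)^[k] (γ (F^[d] x))‖ ≤
        ‖(cosMap a b)^[k + 1 + d] (γ x) - (cosMap a b)^[k + 1] (γ (F^[d] x))‖ := by
    intro k hk x hx hs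
    obtain ⟨m1, m2, m3, -⟩ := main k hk x hx
    have := L.growth.expand _ _ (by linarith) (by linarith) m3 hs
    rw [show k + 1 + d = k + d + 1 by ring, Function.iterate_succ_apply' (cosMap a b) (k + d),
      Function.iterate_succ_apply' (cosMap a b) k]
    refine le_trans (mul_le_mul_of_nonneg_right ?_ (norm_nonneg _)) this
    have h1 := Real.add_one_le_exp (|((cosMap a b)^[k + d] (γ x)).re| - C)
    linarith
  -- The distance is `0` at `t` and never equals `1/2`, since one more step would expand it to
  -- `12C`, above the bound `6C`. Connectedness keeps it below `1/2`.
  have small : ∀ k, N + n ≤ k → ∀ x, Q ≤ x →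
      ‖(cosMap a b)^[k + d] (γ x) - (cosMap a b)^[k] (γ (F^[d] x))‖ ≤ 1 / 2 := by
    intro k hk x hx
    by_contra! hlt
    have hc : ContinuousOn
        (fun x => ‖(cosMap a b)^[k + d] (γ x) - (cosMap a b)^[k] (γ (F^[d] x))‖) (Ici Q) :=
      (((hcα k).sub (hcβ k)).norm).continuousOn
    have h0 : ‖(cosMap a b)^[k + d] (γ t) - (cosMap a b)^[k] (γ (F^[d] t))‖ = 0 := by
      rw [heqk k (by omega), sub_self, norm_zero]
    obtain ⟨y, hy, hy'⟩ := isPreconnected_Ici.intermediate_value (show t ∈ Ici Q from hQt)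
      (show x ∈ Ici Q from hx) hc ⟨by rw [h0]; norm_num, hlt.le⟩
    simp only at hy'
    have e1 := expand k hk y hy hy'.le
    have e2 := (main (k + 1) (by omega) y hy).2.2.2
    rw [hy'] at e1
    linarith
  filter_upwards [eventually_ge_atTop (N + n)] with k hk x hx
  have iter : ∀ i : ℕ, ‖(cosMap a b)^[k + d] (γ x) - (cosMap a b)^[k] (γ (F^[d] x))‖ * 2 ^ i ≤
      ‖(cosMap a b)^[k + i + d] (γ x) - (cosMap a b)^[k + i] (γ (F^[d] x))‖ := by
    intro i
    induction i with
    | zero => simp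
    | succ i ih =>
      have := expand (k + i) (by omega) x hx (small (k + i) (by omega) x hx)
      rw [← add_assoc, pow_succ]
      nlinarith [norm_nonneg ((cosMap a b)^[k + i + d] (γ x) - (cosMap a b)^[k + i] (γ (F^[d] x)))]
  rw [← sub_eq_zero, ← norm_le_zero_iff]
  have lim : Tendsto (fun i : ℕ => (1 / 2 : ℝ) ^ i) atTop (𝓝 0) :=
    tendsto_pow_atTop_nhds_zero_of_lt_one (by norm_num) (by norm_num)
  refine ge_of_tendsto' lim fun i => ?_
  rw [div_pow, one_pow, le_div_iff₀ (by positivity)]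
  linarith [iter i, small (k + i) (by omega) x hx]

/-- Different forward images of the ray and its landing point are disjoint. -/
theorem LandingRay.orbit_ne (L : LandingRay a b τ γ h C) (hK : 12 * C + 4 ≤ K)
    (hN : NoUniformTime a b τ γ K) {m n : ℕ} (hnm : n < m) {t t' : ℝ} (ht : τ ≤ t) (ht' : τ ≤ t') :
    (cosMap a b)^[m] (γ t) ≠ (cosMap a b)^[n] (γ t') := by
  intro heq
  obtain ⟨d, hd, rfl⟩ : ∃ d, 0 < d ∧ m = n + d := ⟨m - n, by omega, by omega⟩
  rcases ht.eq_or_lt with rfl | ht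
  · rcases ht'.eq_or_lt with rfl | ht'
    · exact L.not_periodic n hd heq
    · exact L.ne_of_lt hK hN _ _ ht' heq
  rcases ht'.eq_or_lt with rfl | ht'
  · exact L.ne_of_lt hK hN _ _ ht heq.symm
  have := L.potential_eq ht ht' heq
  subst this
  have heqk : ∀ k, n ≤ k → (cosMap a b)^[k + d] (γ t) = (cosMap a b)^[k] (γ (F^[d] t)) := by
    intro k hk
    rw [show k + d = (k - n) + (n + d) by omega, Function.iterate_add_apply, heq,
      ← Function.iterate_add_apply, Nat.sub_add_cancel hk]
  -- Equality of the tails is pulled back one step at a time by uniqueness of lifts along `[min x t,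
  -- ∞)`, anchored at `t`.
  have all : ∀ x, τ < x → (cosMap a b)^[n + d] (γ x) = (cosMap a b)^[n] (γ (F^[d] x)) := by
    intro x hx
    have hQ : τ < min x t := lt_min hx ht
    obtain ⟨N, hN'⟩ := eventually_atTop.1 (L.tails_eq hQ (min_le_right x t) heq)
    have down : ∀ i k, n ≤ k → N ≤ k + i → ∀ y, min x t ≤ y →
        (cosMap a b)^[k + d] (γ y) = (cosMap a b)^[k] (γ (F^[d] y)) := by
      intro i
      induction i with
      | zero => intro k _ hk; exact hN' k hk
      | succ i ih =>
        intro k hk hki y hy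
        have IH := ih (k + 1) (by omega) (by omega)
        have : PreconnectedSpace (Ici (min x t)) := Subtype.preconnectedSpace isPreconnected_Ici
        have e := eq_of_cosMap_comp_eq (a := a) (b := b)
          (f := fun y : Ici (min x t) => (cosMap a b)^[k + d] (γ y))
          (g := fun y : Ici (min x t) => (cosMap a b)^[k] (γ (F^[d] y)))
          ((L.continuous_orbit _).comp continuous_subtype_val)
          (((L.continuous_orbit k).comp (continuous_F_iter d)).comp continuous_subtype_val)
          (fun y => by
            rw [← Function.iterate_succ_apply' (cosMap a b),
              ← Function.iterate_succ_apply' (cosMap a b)]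
            have := IH y y.2
            rwa [show k + 1 + d = (k + d).succ by rw [Nat.succ_eq_add_one]; ring] at this)
          (fun y => L.noncrit _ _ (hQ.trans_le y.2))
          (x₀ := ⟨t, min_le_right x t⟩) (heqk k hk)
        exact congrFun e ⟨y, hy⟩
    exact down N n le_rfl (by omega) x (min_le_left x t)
  have lim : (cosMap a b)^[n + d] (γ τ) = (cosMap a b)^[n] (γ (F^[d] τ)) := by
    refine tendsto_nhds_unique_of_eventuallyEq (l := 𝓝[>] τ)
      ((L.continuous_orbit (n + d)).continuousAt.tendsto.mono_left nhdsWithin_le_nhds)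
      (((L.continuous_orbit n).comp (continuous_F_iter d)).continuousAt.tendsto.mono_left
        nhdsWithin_le_nhds) ?_
    filter_upwards [self_mem_nhdsWithin] with x hx
    exact all x hx
  -- If `F^d` fixes `τ`, the landing point is preperiodic and cannot escape; otherwise its orbit
  -- meets a forward image of the ray.
  rcases (le_F_iter d τ).eq_or_lt with h1 | h1
  · rw [← h1] at lim
    exact L.not_periodic n hd lim
  · exact L.ne_of_lt hK hN _ _ h1 lim

end

/-! ### Paths from a point with a far orbit to infinity -/

/-- Lifting a path under `E` to the right half-plane. -/
lemma exists_lift_right {a b : ℂ} {C : ℝ} (hsq : 64 * (‖a‖ * ‖b‖ + 1) ≤ Real.exp (2 * C))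
    (hn : ‖a‖ ≤ Real.exp C) {U : ℝ → ℂ} (hU : Continuous U)
    (hre : ∀ x, 4 * Real.exp C ≤ |(U x).re|) {z : ℂ}
    (hz : ‖b * Complex.exp (-z)‖ ≤ ‖a * Complex.exp z‖ / 8) (h0 : U 0 = cosMap a b z) :
    ∃ V : ℝ → ℂ, Continuous V ∧ V 0 = z ∧ ∀ x, cosMap a b (V x) = U x ∧ 0 < (V x).re ∧
      |(V x).im - z.im| ≤ 4 * Real.pi := by
  have eC := Real.exp_pos C
  have hU0 : ∀ x, U x ≠ 0 := fun x hx => by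
    have := hre x
    rw [hx, Complex.zero_re, abs_zero] at this
    linarith
  have hX0 : a * Complex.exp z ≠ 0 := by
    intro hX
    rw [hX, norm_zero, zero_div] at hz
    have := norm_le_zero_iff.1 hz
    exact hU0 0 (by rw [h0, cosMap, hX, this, add_zero])
  -- the sign of the real part
  obtain ⟨ε, hε, hεpos⟩ : ∃ ε : ℂ, ε ≠ 0 ∧ ∀ x, 0 < (ε * U x).re := by
    rcases re_pos_or_neg isPreconnected_univ hU.continuousOn (K := 4 * Real.exp C) (by positivity)
      (fun x _ => hre x) with s | s
    · exact ⟨1, one_ne_zero, fun x => by rw [one_mul]; linarith [s x (mem_univ x)]⟩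
    · exact ⟨-1, by norm_num, fun x => by
        rw [neg_one_mul, Complex.neg_re]; linarith [s x (mem_univ x)]⟩
  -- The quantity `X = a e^V` solves `X² - U X + a b = 0`, so `X = U (1 + √p) / 2` for the larger
  -- root. As `p` stays within distance `1` of `1`, the principal root is continuous with positive
  -- real part.
  set p : ℝ → ℂ := fun x => 1 - 4 * a * b / U x ^ 2 with hp
  have hpn : ∀ x, ‖p x - 1‖ < 1 := by
    intro x
    have h1 : p x - 1 = -(4 * a * b / U x ^ 2) := by rw [hp]; ring
    have h2 := (hre x).trans (Complex.abs_re_le_norm (U x))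
    rw [h1, norm_neg, norm_div, norm_pow, norm_mul, norm_mul, Complex.norm_ofNat,
      div_lt_one (by have := norm_pos_iff.2 (hU0 x); positivity)]
    have h3 : Real.exp (2 * C) = Real.exp C ^ 2 := by rw [two_mul, Real.exp_add, sq]
    nlinarith
  have hp_slit : ∀ x, p x ∈ Complex.slitPlane := fun x => by
    refine Or.inl ?_
    have h1 := (Complex.abs_re_le_norm (p x - 1)).trans_lt (hpn x)
    rw [Complex.sub_re, Complex.one_re, abs_lt] at h1
    linarith
  have hp_cont : Continuous p :=
    continuous_const.sub (continuous_const.div (hU.pow 2) fun x => pow_ne_zero 2 (hU0 x))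
  set r : ℝ → ℂ := fun x => Complex.exp (Complex.log (p x) / 2) with hr
  have hr_cont : Continuous r := ((hp_cont.clog hp_slit).div_const 2).cexp
  have hr_sq : ∀ x, r x ^ 2 = p x := fun x => by
    rw [hr, ← Complex.exp_nat_mul]
    simp only [Nat.cast_ofNat]
    rw [mul_div_cancel₀ _ two_ne_zero, Complex.exp_log (Complex.slitPlane_ne_zero (hp_slit x))]
  have hr_re : ∀ x, 0 < (r x).re := fun x => by
    have h1 := Complex.abs_arg_lt_pi_div_two_iff.2 (Or.inl (show 0 < (p x).re by
      have h1 := (Complex.abs_re_le_norm (p x - 1)).trans_lt (hpn x)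
      rw [Complex.sub_re, Complex.one_re, abs_lt] at h1
      linarith))
    have him : (Complex.log (p x) / 2).im = (p x).arg / 2 := by
      rw [Complex.div_ofNat_im, Complex.log_im]
    rw [hr, Complex.exp_re, him]
    rw [abs_lt] at h1
    exact mul_pos (Real.exp_pos _)
      (Real.cos_pos_of_mem_Ioo ⟨by linarith [Real.pi_pos], by linarith [Real.pi_pos]⟩)
  set q : ℝ → ℂ := fun x => (1 + r x) / 2 with hq
  have hq_re : ∀ x, 1 / 2 < (q x).re := fun x => by
    rw [hq, Complex.div_ofNat_re, Complex.add_re, Complex.one_re]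
    linarith [hr_re x]
  have hq_cont : Continuous q := (continuous_const.add hr_cont).div_const 2
  have hq0 : ∀ x, q x ≠ 0 := fun x hx => by
    have := hq_re x
    rw [hx, Complex.zero_re] at this
    linarith
  have hq_eq : ∀ x, (U x * q x) ^ 2 - U x * (U x * q x) + a * b = 0 := fun x => by
    have h1 := hr_sq x
    rw [hp] at h1
    have h2 : U x ^ 2 * r x ^ 2 = U x ^ 2 - 4 * a * b := by
      rw [h1]
      field_simp [hU0 x]
    rw [hq]
    linear_combination h2 / 4
  -- the initial value
  have hinit : a * Complex.exp z = U 0 * q 0 := by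
    set X := a * Complex.exp z
    set Y := b * Complex.exp (-z)
    have hXY : X * Y = a * b := by
      have : Complex.exp z * Complex.exp (-z) = 1 := by rw [← Complex.exp_add, add_neg_cancel, Complex.exp_zero]
      linear_combination a * b * this
    have hU0' : U 0 = X + Y := h0
    have hm : ((X - Y) / (X + Y)) ^ 2 = r 0 ^ 2 := by
      rw [hr_sq, hp]
      have := hU0 0
      rw [hU0'] at this
      simp only
      rw [hU0', mul_assoc, ← hXY]
      field_simp
      ring
    -- Dominance of `X` over `Y` identifies the starting point with the root of positive real part.
    have hmre : 0 < ((X - Y) / (X + Y)).re := by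
      have hne := hU0 0
      rw [hU0'] at hne
      have e : (X - Y) / (X + Y) = 1 - 2 * Y / (X + Y) := by field_simp; ring
      have n1 : ‖2 * Y / (X + Y)‖ < 1 := by
        rw [norm_div, norm_mul, Complex.norm_ofNat, div_lt_one (norm_pos_iff.2 hne)]
        have := norm_sub_le (X + Y) Y
        rw [add_sub_cancel_right] at this
        have := norm_pos_iff.2 hX0
        linarith
      rw [e, Complex.sub_re, Complex.one_re]
      linarith [(Complex.re_le_norm (2 * Y / (X + Y)))]
    have hmr : (X - Y) / (X + Y) = r 0 := by
      rcases sq_eq_sq_iff_eq_or_eq_neg.1 hm with e | e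
      · exact e
      · have h1 := hr_re 0
        rw [e, Complex.neg_re] at hmre
        linarith
    have hne := hU0 0
    rw [hU0'] at hne
    rw [hq, hU0']
    simp only
    rw [← hmr]
    field_simp
    ring
  have hLs : ∀ x, ε * U x ∈ Complex.slitPlane := fun x => Or.inl (hεpos x)
  have hqs : ∀ x, q x ∈ Complex.slitPlane := fun x => Or.inl (by linarith [hq_re x])
  -- The height changes by four principal arguments, each at most `π` in modulus; this is the source
  -- of `4π`.
  set V : ℝ → ℂ := fun x => z + (Complex.log (ε * U x) - Complex.log (ε * U 0)) +
    (Complex.log (q x) - Complex.log (q 0)) with hV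
  have hVexp : ∀ x, a * Complex.exp (V x) = U x * q x := by
    intro x
    rw [hV]
    simp only
    rw [Complex.exp_add, Complex.exp_add, Complex.exp_sub, Complex.exp_sub,
      Complex.exp_log (Complex.slitPlane_ne_zero (hLs x)),
      Complex.exp_log (Complex.slitPlane_ne_zero (hLs 0)), Complex.exp_log (hq0 x),
      Complex.exp_log (hq0 0), ← mul_assoc, ← mul_assoc, hinit]
    have := hU0 0
    have := hq0 0
    field_simp
  refine ⟨V, ?_, ?_, fun x => ⟨?_, ?_, ?_⟩⟩
  · exact (continuous_const.add (((continuous_const.mul hU).clog hLs).sub continuous_const)).add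
      ((hq_cont.clog hqs).sub continuous_const)
  · rw [hV]; simp
  · have h1 : Complex.exp (V x) * Complex.exp (-V x) = 1 := by
      rw [← Complex.exp_add, add_neg_cancel, Complex.exp_zero]
    have h2 : a * Complex.exp (V x) ≠ 0 := by rw [hVexp]; exact mul_ne_zero (hU0 x) (hq0 x)
    refine mul_left_cancel₀ h2 ?_
    have h3 := hq_eq x
    rw [← hVexp] at h3
    rw [cosMap]
    linear_combination h3 + a * b * h1
  · have h1 := congrArg norm (hVexp x)
    rw [norm_mul, norm_mul, Complex.norm_exp] at h1
    have h2 := (hre x).trans (Complex.abs_re_le_norm (U x))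
    have h3 := (hq_re x).le.trans (Complex.re_le_norm (q x))
    rw [← Real.one_lt_exp_iff]
    by_contra! hle
    nlinarith [norm_nonneg a]
  · have him : (V x).im - z.im = ((ε * U x).arg - (ε * U 0).arg) + ((q x).arg - (q 0).arg) := by
      rw [hV]
      simp only [Complex.add_im, Complex.sub_im, Complex.log_im]
      ring
    rw [him]
    have h1 := Complex.abs_arg_le_pi (ε * U x)
    have h2 := Complex.abs_arg_le_pi (ε * U 0)
    have h3 := Complex.abs_arg_le_pi (q x)
    have h4 := Complex.abs_arg_le_pi (q 0)
    rw [abs_le] at *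
    constructor <;> linarith

section

variable {a b : ℂ} {C K : ℝ}

lemma sixteen_le_exp_four : (16 : ℝ) ≤ Real.exp 4 := by
  have : Real.exp 4 = Real.exp 2 * Real.exp 2 := by rw [← Real.exp_add]; norm_num
  nlinarith [four_le_exp_two]

lemma Growth.exp_neg_le (G : Growth a b C) {z : ℂ} (hz : C + 2 ≤ |z.re|) :
    9 * Real.exp (C - |z.re|) ≤ ‖cosMap a b z‖ := by
  have h1 := G.lower z (by linarith)
  have h2 : Real.exp (|z.re| - C) = Real.exp (C - |z.re|) * Real.exp (2 * (|z.re| - C)) := by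
    rw [← Real.exp_add]; ring_nf
  have h3 : Real.exp 4 ≤ Real.exp (2 * (|z.re| - C)) := Real.exp_le_exp.2 (by linarith)
  nlinarith [sixteen_le_exp_four, Real.exp_pos (C - |z.re|)]

lemma Growth.dominant_right (G : Growth a b C) {z : ℂ} (hz : C + 2 ≤ z.re) :
    ‖b * Complex.exp (-z)‖ ≤ ‖a * Complex.exp z‖ / 8 := by
  have h0 : |z.re| = z.re := abs_of_pos (by linarith [G.one_le])
  have h1 := G.exp_neg_le (z := z) (by rwa [h0])
  have h2 : ‖b * Complex.exp (-z)‖ ≤ Real.exp (C - |z.re|) := by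
    rw [norm_mul, Complex.norm_exp, Complex.neg_re, h0, sub_eq_add_neg, Real.exp_add]
    exact mul_le_mul_of_nonneg_right G.norm_snd (Real.exp_pos _).le
  have h3 := norm_add_le (a * Complex.exp z) (b * Complex.exp (-z))
  rw [cosMap] at h1
  linarith

lemma Growth.dominant_left (G : Growth a b C) {z : ℂ} (hz : z.re ≤ -(C + 2)) :
    ‖a * Complex.exp z‖ ≤ ‖b * Complex.exp (-z)‖ / 8 := by
  have h0 : |z.re| = -z.re := abs_of_neg (by linarith [G.one_le])
  have h1 := G.exp_neg_le (z := z) (by rw [h0]; linarith)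
  have h2 : ‖a * Complex.exp z‖ ≤ Real.exp (C - |z.re|) := by
    rw [norm_mul, Complex.norm_exp, h0, sub_neg_eq_add, Real.exp_add]
    exact mul_le_mul_of_nonneg_right G.norm_fst (Real.exp_pos _).le
  have h3 := norm_add_le (a * Complex.exp z) (b * Complex.exp (-z))
  rw [cosMap] at h1
  linarith

lemma Growth.exists_lift_step (G : Growth a b C) {U : ℝ → ℂ} (hU : Continuous U)
    (hre : ∀ x, 4 * Real.exp C ≤ |(U x).re|) {z : ℂ} (hz : C + 2 ≤ |z.re|)
    (h0 : U 0 = cosMap a b z) :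
    ∃ V : ℝ → ℂ, Continuous V ∧ V 0 = z ∧ ∀ x, cosMap a b (V x) = U x ∧ 0 < z.re * (V x).re ∧
      |(V x).im - z.im| ≤ 4 * Real.pi := by
  have hC := G.one_le
  rcases le_abs.1 hz with hs | hs
  · obtain ⟨V, h1, h2, h3⟩ := exists_lift_right G.sq G.norm_fst hU hre (G.dominant_right hs) h0
    exact ⟨V, h1, h2, fun x => ⟨(h3 x).1, mul_pos (by linarith) (h3 x).2.1, (h3 x).2.2⟩⟩
  · obtain ⟨V, h1, h2, h3⟩ := exists_lift_right (a := b) (b := a) (z := -z)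
      (by rw [mul_comm ‖b‖]; exact G.sq) G.norm_snd hU hre
      (by rw [neg_neg]; exact G.dominant_left (by linarith)) (by rw [h0, cosMap_neg])
    refine ⟨fun x => -V x, h1.neg, by simp only [h2, neg_neg], fun x => ⟨?_, ?_, ?_⟩⟩
    · rw [cosMap_neg]; exact (h3 x).1
    · rw [Complex.neg_re]; nlinarith [(h3 x).2.1]
    · have := (h3 x).2.2
      rw [Complex.neg_im] at this ⊢
      rwa [← abs_neg, show -(-(V x).im - z.im) = (V x).im - -z.im by ring]

/-- An escaping point whose orbit stays far from the imaginary axis can be connected to infinity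
by a nearly horizontal path, `k` iterates of which stay far from the imaginary axis. -/
theorem Growth.exists_path (G : Growth a b C) (hK : 12 * C + 4 ≤ K) (hK' : 4 * Real.exp C ≤ K)
    (k : ℕ) : ∀ z : ℂ, (∀ j, 3 * K + 30 ≤ |((cosMap a b)^[j] z).re|) →
      ∃ V : ℝ → ℂ, Continuous V ∧ V 0 = z ∧ Tendsto (fun x => |(V x).re|) atTop atTop ∧
        (∀ x, |z.re| - (2 * C + 2) ≤ |(V x).re|) ∧ (∀ x, |(V x).im - z.im| ≤ 4 * Real.pi) ∧
        (∀ x, 0 < z.re * (V x).re) ∧ ∀ x j, j ≤ k → K ≤ |((cosMap a b)^[j] (V x)).re| := by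
  have hC := G.one_le
  have pi := Real.pi_pos
  induction k with
  | zero =>
    intro z hz
    have hz0 : 3 * K + 30 ≤ |z.re| := hz 0
    obtain ⟨ε, hε⟩ : ∃ ε : ℝ, ∀ x : ℝ, |z.re + ε * (|x|)| = |z.re| + |x| ∧
        0 < z.re * (z.re + ε * |x|) := by
      rcases le_abs.1 hz0 with hs | hs
      · refine ⟨1, fun x => ?_⟩
        have := abs_nonneg x
        rw [one_mul, abs_of_pos (show 0 < z.re by linarith), abs_of_pos (by linarith)]
        exact ⟨rfl, mul_pos (by linarith) (by linarith)⟩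
      · refine ⟨-1, fun x => ?_⟩
        have := abs_nonneg x
        rw [neg_one_mul, abs_of_neg (show z.re < 0 by linarith), abs_of_neg (by linarith)]
        exact ⟨by ring, mul_pos_of_neg_of_neg (by linarith) (by linarith)⟩
    have hVre : ∀ x : ℝ, (z + ((ε * |x| : ℝ) : ℂ)).re = z.re + ε * |x| := fun x => by
      rw [Complex.add_re, Complex.ofReal_re]
    -- A horizontal ray pointing away from the imaginary axis; `|x|` only serves to define it on the
    -- whole line.
    refine ⟨fun x => z + ((ε * |x| : ℝ) : ℂ), ?_, by simp, ?_, fun x => ?_, fun x => ?_,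
      fun x => ?_, fun x j hj => ?_⟩
    · exact continuous_const.add (Complex.continuous_ofReal.comp
        (continuous_const.mul continuous_abs))
    · simp only [hVre, hε]
      exact tendsto_atTop_add_const_left _ _ tendsto_abs_atTop_atTop
    · rw [hVre, (hε x).1]
      linarith [abs_nonneg x]
    · rw [Complex.add_im, Complex.ofReal_im, add_zero, sub_self, abs_zero]
      positivity
    · rw [hVre]; exact (hε x).2
    · rw [Nat.le_zero.1 hj, Function.iterate_zero, id_eq, hVre, (hε x).1]
      linarith [abs_nonneg x]
  | succ k ih =>
    intro z hz
    have hz0 : 3 * K + 30 ≤ |z.re| := hz 0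
    -- The path for `z` lifts the one for `E z`, so it is exactly horizontal only after `k + 1`
    -- steps. Each lift is anchored at a point of the given orbit, so the errors do not accumulate.
    obtain ⟨U, u1, u2, u3, u4, u5, u6, u7⟩ := ih (cosMap a b z) fun j => by
      rw [← Function.iterate_succ_apply]; exact hz (j + 1)
    obtain ⟨V, v1, v2, v3⟩ := G.exists_lift_step u1 (fun x => hK'.trans (u7 x 0 (Nat.zero_le k)))
      (show C + 2 ≤ |z.re| by linarith) u2
    have hlow : ∀ x, |z.re| - (2 * C + 2) ≤ |(V x).re| := by
      intro x
      refine G.abs_re_compare (by linarith) ?_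
      rw [(v3 x).1]
      have h1 : |(cosMap a b z).re| ≤ |(U x).re| + (2 * C + 2) := by linarith [u4 x]
      have h2 : |(cosMap a b z).im| ≤ |(U x).im| + 4 * Real.pi := by
        have := abs_sub_abs_le_abs_sub (cosMap a b z).im (U x).im
        rw [abs_sub_comm] at this
        linarith [u5 x]
      have h3 := norm_le_of_abs_le h1 h2
      have h4 : 3 * K + 30 ≤ ‖cosMap a b z‖ := (hz 1).trans (Complex.abs_re_le_norm _)
      nlinarith [four_le_exp_two, norm_nonneg (U x), Real.pi_lt_d2]
    refine ⟨V, v1, v2, ?_, hlow, fun x => (v3 x).2.2, fun x => (v3 x).2.1, fun x j hj => ?_⟩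
    · refine tendsto_atTop_mono (fun x => ?_)
        (tendsto_atTop_add_const_right _ (-C) (Real.tendsto_log_atTop.comp u3))
      have h1 := (Complex.abs_re_le_norm (U x)).trans ((v3 x).1 ▸ G.upper (V x))
      have h2 := Real.log_le_log (by have := u7 x 0 (Nat.zero_le k); simp only [Function.iterate_zero, id_eq] at this; linarith) h1
      rw [Real.log_exp] at h2
      simp only [Function.comp]
      linarith
    · rcases j with _ | j
      · have := hlow x
        rw [Function.iterate_zero, id_eq]
        linarith
      · rw [Function.iterate_succ_apply, (v3 x).1]
        exact u7 x j (by omega)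

end

/-! ### Crossing lemmas up to reflection, and concatenation of paths -/

lemma paths_cross_symm {a b c d : ℝ} (hab : a ≤ b) (hcd : c ≤ d) {f g : ℝ → ℂ} (hf : Continuous f)
    (hg : Continuous g)
    (hre : (∀ t ∈ Icc c d, (f a).re < (g t).re ∧ (g t).re < (f b).re) ∨
      (∀ t ∈ Icc c d, (f b).re < (g t).re ∧ (g t).re < (f a).re))
    (him : (∀ s ∈ Icc a b, (g c).im < (f s).im ∧ (f s).im < (g d).im) ∨
      (∀ s ∈ Icc a b, (g d).im < (f s).im ∧ (f s).im < (g c).im)) :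
    ∃ s ∈ Icc a b, ∃ t ∈ Icc c d, f s = g t := by
  have refl : ∀ {x y z : ℝ}, z ∈ Icc x y → x + y - z ∈ Icc x y := fun hz =>
    ⟨by linarith [hz.2], by linarith [hz.1]⟩
  have base : ∀ f : ℝ → ℂ, Continuous f →
      (∀ t ∈ Icc c d, (f a).re < (g t).re ∧ (g t).re < (f b).re) →
      ((∀ s ∈ Icc a b, (g c).im < (f s).im ∧ (f s).im < (g d).im) ∨
        (∀ s ∈ Icc a b, (g d).im < (f s).im ∧ (f s).im < (g c).im)) →
      ∃ s ∈ Icc a b, ∃ t ∈ Icc c d, f s = g t := by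
    intro f hf hre him
    rcases him with him | him
    · exact paths_cross hab hcd hf.continuousOn hg.continuousOn (fun t ht => (hre t ht).1)
        (fun t ht => (hre t ht).2) (fun s hs => (him s hs).1) (fun s hs => (him s hs).2)
    · obtain ⟨s, hs, t, ht, h⟩ := paths_cross (g := fun t => g (c + d - t)) hab hcd hf.continuousOn
        (hg.comp (continuous_const.sub continuous_id)).continuousOn
        (fun t ht => (hre _ (refl ht)).1) (fun t ht => (hre _ (refl ht)).2)
        (fun s hs => by rw [add_sub_cancel_left]; exact (him s hs).1)
        (fun s hs => by rw [add_sub_cancel_right]; exact (him s hs).2)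
      exact ⟨s, hs, _, refl ht, h⟩
  rcases hre with hre | hre
  · exact base f hf hre him
  · obtain ⟨s, hs, t, ht, h⟩ := base (fun s => f (a + b - s))
      (hf.comp (continuous_const.sub continuous_id))
      (fun t ht => by rw [add_sub_cancel_left, add_sub_cancel_right]; exact hre t ht)
      (him.imp (fun H s hs => H _ (refl hs)) (fun H s hs => H _ (refl hs)))
    exact ⟨_, refl hs, t, ht, h⟩

lemma hairpin_meets_translate_symm {α β : ℝ} (hαβ : α ≤ β) {g : ℝ → ℂ} (hg : Continuous g)
    {η B y₁ y₂ ε : ℝ} (hε : ε = 1 ∨ ε = -1) (hη : 2 * B < η) (hB : 0 ≤ B)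
    (hy : η + 2 * B < |y₂ - y₁|) (h1 : |(g α).im - y₁| ≤ B) (h2 : |(g β).im - y₂| ≤ B)
    (hm : ∀ t ∈ Icc α β, (ε * (g t).re < ε * (g α).re ∧ ε * (g t).re < ε * (g β).re) ∨
      |(g t).im - y₁| ≤ B ∨ |(g t).im - y₂| ≤ B) :
    ∃ s ∈ Icc α β, ∃ t ∈ Icc α β, g s + η * Complex.I = g t := by
  have refl : ∀ {z : ℝ}, z ∈ Icc α β → α + β - z ∈ Icc α β := fun hz =>
    ⟨by linarith [hz.2], by linarith [hz.1]⟩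
  have base : ∀ (g : ℝ → ℂ) (y₁ y₂ : ℝ), Continuous g → η + 2 * B < |y₂ - y₁| →
      |(g α).im - y₁| ≤ B → |(g β).im - y₂| ≤ B →
      (∀ t ∈ Icc α β, ((g t).re < (g α).re ∧ (g t).re < (g β).re) ∨
        |(g t).im - y₁| ≤ B ∨ |(g t).im - y₂| ≤ B) →
      ∃ s ∈ Icc α β, ∃ t ∈ Icc α β, g s + η * Complex.I = g t := by
    intro g y₁ y₂ hg hy h1 h2 hm
    rcases lt_abs.1 hy with hy | hy
    · exact hairpin_meets_translate hαβ hg.continuousOn hη hB hy h1 h2 hm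
    · obtain ⟨s, hs, t, ht, h⟩ := hairpin_meets_translate (g := fun t => g (α + β - t)) hαβ
        (hg.comp (continuous_const.sub continuous_id)).continuousOn hη hB
        (y₁ := y₂) (y₂ := y₁) (by linarith) (by rwa [add_sub_cancel_left])
        (by rwa [add_sub_cancel_right])
        (fun t ht => by
          rw [add_sub_cancel_left, add_sub_cancel_right]
          rcases hm _ (refl ht) with h | h | h
          · exact Or.inl ⟨h.2, h.1⟩
          · exact Or.inr (Or.inr h)
          · exact Or.inr (Or.inl h))
      exact ⟨_, refl hs, _, refl ht, h⟩
  rcases hε with rfl | rfl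
  · exact base g y₁ y₂ hg hy h1 h2 (by simpa using hm)
  · have neg : ∀ x y : ℝ, |-x - -y| = |x - y| := fun x y => by
      rw [neg_sub_neg, abs_sub_comm]
    obtain ⟨s, hs, t, ht, h⟩ := base (fun t => -g t) (-y₁) (-y₂) hg.neg (by rwa [neg])
      (by rwa [Complex.neg_im, neg]) (by rwa [Complex.neg_im, neg])
      (fun t ht => by
        simp only [Complex.neg_im, Complex.neg_re, neg]
        simpa only [neg_one_mul] using hm t ht)
    exact ⟨t, ht, s, hs, by linear_combination h⟩

lemma re_cosMap_iter_add_int (a b z : ℂ) (n : ℤ) (i : ℕ) :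
    ((cosMap a b)^[i] (z + ((2 * Real.pi * n : ℝ) : ℂ) * Complex.I)).re =
      ((cosMap a b)^[i] z).re := by
  rcases i with _ | i
  · rw [Function.iterate_zero, id_eq, id_eq, Complex.add_re, Complex.re_ofReal_mul, Complex.I_re,
      mul_zero, add_zero]
  · rw [Function.iterate_succ_apply, Function.iterate_succ_apply, cosMap_add_int]

lemma im_add_ofReal_mul_I (z : ℂ) (x : ℝ) : (z + x * Complex.I).im = z.im + x := by
  simp

/-- The concatenation of the reversed path `V` with `f`, started at `τ`. -/
noncomputable def concat (V f : ℝ → ℂ) (τ : ℝ) (s : ℝ) : ℂ := if s ≤ 0 then V (-s) else f (τ + s)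

lemma concat_of_nonpos {V f : ℝ → ℂ} {τ s : ℝ} (hs : s ≤ 0) : concat V f τ s = V (-s) := if_pos hs

lemma concat_of_pos {V f : ℝ → ℂ} {τ s : ℝ} (hs : 0 < s) : concat V f τ s = f (τ + s) :=
  if_neg (not_le.2 hs)

lemma continuous_concat {V f : ℝ → ℂ} {τ : ℝ} (hV : Continuous V) (hf : Continuous f)
    (h : V 0 = f τ) : Continuous (concat V f τ) := by
  refine Continuous.if_le (hV.comp continuous_neg) (hf.comp (continuous_const.add continuous_id))
    continuous_id continuous_const fun x hx => ?_
  change x = 0 at hx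
  simp [hx, h]

/-! ### Heights of the landing orbit compared with the address -/

section

variable {a b : ℂ} {τ C K : ℝ} {γ : ℝ → ℂ} {h : ℕ → ℝ}

/-- The points of a ray at a height that is neither that of the address nor that of the landing
point do not have far orbits; by compactness this is visible after boundedly many steps. -/
lemma LandingRay.exists_return_time (L : LandingRay a b τ γ h C) (hK : 12 * C + 4 ≤ K) (m : ℕ)
    (T : ℝ) {S : Set ℝ} (hS : IsClosed S) (hw : ((cosMap a b)^[m] (γ τ)).im ∉ S)
    (hh : ∀ y ∈ S, C < |y - h m|) :
    ∃ k, ∀ t, τ ≤ t → t ≤ T → ((cosMap a b)^[m] (γ t)).im ∈ S →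
      ∃ i, i ≤ k ∧ |((cosMap a b)^[i] ((cosMap a b)^[m] (γ t))).re| < K := by
  by_contra! hcon
  have cpt : IsCompact (Icc τ T ∩ (fun t => ((cosMap a b)^[m] (γ t)).im) ⁻¹' S) :=
    isCompact_Icc.inter_right (hS.preimage (Complex.continuous_im.comp (L.continuous_orbit m)))
  obtain ⟨t, ⟨ht, htS⟩, hfar⟩ := exists_forall_of_forall_exists cpt
    (φ := fun i t => |((cosMap a b)^[i] ((cosMap a b)^[m] (γ t))).re|) (K := K)
    (fun j => (continuous_abs.comp (Complex.continuous_re.comp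
      ((continuous_cosMap_iter a b j).comp (L.continuous_orbit m)))).continuousOn)
    (fun n => by
      obtain ⟨t, h1, h2, h3, h4⟩ := hcon n
      exact ⟨t, ⟨⟨h1, h2⟩, h3⟩, h4⟩)
  simp only [mem_preimage] at htS
  have hτ : τ < t := by
    rcases ht.1.eq_or_lt with rfl | h
    · exact absurd htS hw
    · exact h
  have := (L.up hK (n := m) hτ (fun k hk => by
    have := hfar (k - m)
    rwa [← Function.iterate_add_apply, Nat.sub_add_cancel hk] at this) m le_rfl t le_rfl).2
  exact absurd this (not_le.2 (hh _ htS))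

lemma LandingRay.exists_side (L : LandingRay a b τ γ h C) (m : ℕ) : ∃ ε : ℝ, (ε = 1 ∨ ε = -1) ∧
    Tendsto (fun t => ε * ((cosMap a b)^[m] (γ t)).re) atTop atTop := by
  rcases L.far_re m with H | H
  · exact ⟨1, Or.inl rfl, by simpa using H⟩
  · exact ⟨-1, Or.inr rfl, by simpa using H⟩

/-- If some forward image of the ray has its end and its landing point in opposite half-planes,
then it separates the later images. -/
theorem LandingRay.height_of_opposite (L : LandingRay a b τ γ h C) (hK : 12 * C + 4 ≤ K)
    (hK' : 4 * Real.exp C ≤ K) (hN : NoUniformTime a b τ γ K) {n : ℕ}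
    (hw : ∀ j, n ≤ j → 3 * K + 30 ≤ |((cosMap a b)^[j] (γ τ)).re|) {ε : ℝ} (hε : ε = 1 ∨ ε = -1)
    (hside : Tendsto (fun t => ε * ((cosMap a b)^[n] (γ t)).re) atTop atTop)
    (hopp : ε * ((cosMap a b)^[n] (γ τ)).re < 0) :
    ∃ M, 0 ≤ M ∧ ∀ m, n < m → |((cosMap a b)^[m] (γ τ)).im - h m| ≤ M := by
  have hC := L.growth.one_le
  have pi := Real.pi_pos
  -- the heights of the ray
  obtain ⟨B₀, hB₀⟩ : ∃ B₀, ∀ t, τ ≤ t → |((cosMap a b)^[n] (γ t)).im| ≤ B₀ := by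
    obtain ⟨T, hT⟩ := eventually_atTop.1 (L.far n)
    obtain ⟨B₁, hB₁⟩ := (isCompact_Icc (a := τ) (b := T)).exists_bound_of_continuousOn
      (Complex.continuous_im.comp (L.continuous_orbit n)).continuousOn
    refine ⟨max B₁ (|h n| + C), fun t ht => ?_⟩
    rcases le_total t T with h1 | h1
    · exact (hB₁ t ⟨ht, h1⟩).trans (le_max_left _ _)
    · have h2 := hT t h1
      have h3 := abs_sub_abs_le_abs_sub ((cosMap a b)^[n] (γ t)).im (h n)
      exact le_trans (by linarith) (le_max_right _ _)
  have B₀0 := (abs_nonneg _).trans (hB₀ τ le_rfl)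
  set B := B₀ + 4 * Real.pi with hB
  refine ⟨2 * B + 2 * Real.pi + 2 * C, by positivity, fun m hm => ?_⟩
  by_contra! hfar
  set W := ((cosMap a b)^[m] (γ τ)).im with hW
  -- a translate of the separating curve
  obtain ⟨j, hj1, hj2⟩ : ∃ j : ℤ, min W (h m) + C + B < 2 * Real.pi * j ∧
      2 * Real.pi * j ≤ min W (h m) + C + B + 2 * Real.pi := by
    refine ⟨⌊(min W (h m) + C + B) / (2 * Real.pi)⌋ + 1, ?_, ?_⟩
    · have := Int.lt_floor_add_one ((min W (h m) + C + B) / (2 * Real.pi))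
      rw [div_lt_iff₀ (by positivity)] at this
      push_cast
      linarith
    · have := Int.floor_le ((min W (h m) + C + B) / (2 * Real.pi))
      rw [le_div_iff₀ (by positivity)] at this
      push_cast
      linarith
  -- The translated curve has all its heights in `S`, and the choice of `j` places `S` strictly
  -- between `W` and the strip of radius `C` about `h m`.
  set S : Set ℝ := Icc (2 * Real.pi * j - B) (2 * Real.pi * j + B) with hS
  have hSmem : ∀ y ∈ S, (W < y ∧ y + C < h m) ∨ (h m + C < y ∧ y < W) := by
    intro y hy
    rcases le_total W (h m) with hle | hle
    · rw [min_eq_left hle] at hj1 hj2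
      rw [abs_sub_comm, abs_of_nonneg (by linarith)] at hfar
      exact Or.inl ⟨by linarith [hy.1], by linarith [hy.2]⟩
    · rw [min_eq_right hle] at hj1 hj2
      rw [abs_of_nonneg (by linarith)] at hfar
      exact Or.inr ⟨by linarith [hy.1], by linarith [hy.2]⟩
  obtain ⟨T, hT, hTτ⟩ := ((L.far m).and (eventually_ge_atTop τ)).exists
  obtain ⟨k, hk⟩ := L.exists_return_time hK m T (isClosed_Icc : IsClosed S)
    (fun hmem => by rcases hSmem _ hmem with h | h <;> linarith)
    (fun y hy => by
      rw [lt_abs]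
      rcases hSmem y hy with h | h
      · right; linarith
      · left; linarith)
  obtain ⟨V, v1, v2, v3, -, v5, v6, v7⟩ := L.growth.exists_path hK hK' k ((cosMap a b)^[n] (γ τ))
    (fun j => by rw [← Function.iterate_add_apply]; exact hw _ (by omega))
  obtain ⟨R, hR⟩ := (isCompact_Icc (a := τ) (b := T)).exists_bound_of_continuousOn
      (Complex.continuous_re.comp (L.continuous_orbit m)).continuousOn
  simp only [Function.comp, Real.norm_eq_abs] at hR
  obtain ⟨x₁, hx₁, hx₁'⟩ := ((v3.eventually_gt_atTop R).and (eventually_ge_atTop 0)).exists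
  obtain ⟨x₂, hx₂, hx₂'⟩ := ((hside.eventually_gt_atTop R).and (eventually_gt_atTop τ)).exists
  set X := concat V (fun t => (cosMap a b)^[n] (γ t)) τ with hX
  have hXc : Continuous X := continuous_concat v1 (L.continuous_orbit n) v2
  have hXim : ∀ s, |(X s).im| ≤ B := by
    intro s
    rcases le_or_gt s 0 with hs | hs
    · rw [hX, concat_of_nonpos hs]
      have h1 := v5 (-s)
      have h2 := hB₀ τ le_rfl
      have h3 := abs_sub_abs_le_abs_sub (V (-s)).im ((cosMap a b)^[n] (γ τ)).im
      linarith
    · rw [hX, concat_of_pos hs]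
      linarith [hB₀ (τ + s) (by linarith)]
  have hleft : X (-x₁) = V x₁ := by rw [hX, concat_of_nonpos (by linarith), neg_neg]
  have hright : X (x₂ - τ) = (cosMap a b)^[n] (γ x₂) := by
    rw [hX, concat_of_pos (by linarith), add_sub_cancel]
  have hre : ∀ z : ℂ, (z + ((2 * Real.pi * j : ℝ) : ℂ) * Complex.I).re = z.re := fun z => by
    rw [Complex.add_re, Complex.re_ofReal_mul, Complex.I_re, mul_zero, add_zero]
  obtain ⟨s, hs, t, ht, hst⟩ := paths_cross_symm (a := -x₁) (b := x₂ - τ) (c := τ) (d := T)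
    (f := fun s => X s + ((2 * Real.pi * j : ℝ) : ℂ) * Complex.I)
    (g := fun t => (cosMap a b)^[m] (γ t)) (by linarith) hTτ (hXc.add continuous_const)
    (L.continuous_orbit m) (by
      simp only [hre, hleft, hright]
      have s1 := v6 x₁
      rcases hε with rfl | rfl
      · left
        intro t ht
        have h1 := abs_le.1 (hR t ht)
        rw [one_mul] at hopp hx₂
        have h2 : (V x₁).re < 0 := by nlinarith
        rw [abs_of_neg h2] at hx₁
        constructor <;> linarith
      · right
        intro t ht
        have h1 := abs_le.1 (hR t ht)
        rw [neg_one_mul] at hopp hx₂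
        have h2 : 0 < (V x₁).re := by nlinarith
        rw [abs_of_pos h2] at hx₁
        constructor <;> linarith) (by
      have hmem : ∀ s, (X s + ((2 * Real.pi * j : ℝ) : ℂ) * Complex.I).im ∈ S := fun s => by
        have := abs_le.1 (hXim s)
        rw [im_add_ofReal_mul_I]
        constructor <;> linarith
      rw [abs_le] at hT
      rcases le_total W (h m) with hle | hle
      · left
        intro s _
        rcases hSmem _ (hmem s) with h | h
        · constructor <;> linarith
        · constructor <;> linarith
      · right
        intro s _
        rcases hSmem _ (hmem s) with h | h
        · constructor <;> linarith
        · constructor <;> linarith)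
  -- A crossing on the path would give a ray point at a height in `S` that does not return within
  -- `k` steps, as translation leaves the real parts of all iterates unchanged. A crossing on the
  -- ray becomes, after one application of `E`, a meeting of two different forward images.
  rcases le_or_gt s 0 with hs0 | hs0
  · have hmem : ((cosMap a b)^[m] (γ t)).im ∈ S := by
      rw [← hst, im_add_ofReal_mul_I]
      have := abs_le.1 (hXim s)
      constructor <;> linarith
    obtain ⟨i, hi, hi'⟩ := hk t ht.1 ht.2 hmem
    rw [← hst, re_cosMap_iter_add_int, hX, concat_of_nonpos hs0] at hi'
    exact absurd (v7 (-s) i hi) (not_le.2 hi')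
  · have := congrArg (cosMap a b) hst
    rw [cosMap_add_int, hX, concat_of_pos hs0, ← Function.iterate_succ_apply' (cosMap a b),
      ← Function.iterate_succ_apply' (cosMap a b)] at this
    exact L.orbit_ne hK hN (show n.succ < m.succ by omega) ht.1 (by linarith) this.symm

/-- If a forward image of the ray has its end and its landing point in the same half-plane, then
their heights are within a bounded distance, since the ray is disjoint from its translates. -/
theorem LandingRay.height_of_same (L : LandingRay a b τ γ h C) (hK : 12 * C + 4 ≤ K)
    (hK' : 4 * Real.exp C ≤ K) : ∃ M, 0 ≤ M ∧ ∀ m,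
      (∀ j, m ≤ j → 3 * K + 30 ≤ |((cosMap a b)^[j] (γ τ)).re|) →
      (∃ ε : ℝ, (ε = 1 ∨ ε = -1) ∧
        Tendsto (fun t => ε * ((cosMap a b)^[m] (γ t)).re) atTop atTop ∧
        0 < ε * ((cosMap a b)^[m] (γ τ)).re) →
      |((cosMap a b)^[m] (γ τ)).im - h m| ≤ M := by
  have hC := L.growth.one_le
  have pi := Real.pi_pos
  set B := 4 * Real.pi + C with hB
  obtain ⟨j, hj⟩ : ∃ j : ℤ, 2 * B < 2 * Real.pi * j := by
    refine ⟨⌊2 * B / (2 * Real.pi)⌋ + 1, ?_⟩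
    have := Int.lt_floor_add_one (2 * B / (2 * Real.pi))
    rw [div_lt_iff₀ (by positivity)] at this
    push_cast
    linarith
  set η := 2 * Real.pi * (j : ℝ) with hη
  refine ⟨η + 2 * B, by linarith, ?_⟩
  rintro m hw ⟨ε, hε, hside, hsame⟩
  by_contra! hfar
  set W := ((cosMap a b)^[m] (γ τ)).im with hW
  -- These are the heights at which the ray can meet the path translated by `η` down or up.
  set S : Set ℝ := Icc (W - η - 4 * Real.pi) (W - η + 4 * Real.pi) ∪
    Icc (W + η - 4 * Real.pi) (W + η + 4 * Real.pi) with hS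
  obtain ⟨T₀, hT₀, hT₀τ⟩ : ∃ T₀, (∀ t, T₀ ≤ t → |((cosMap a b)^[m] (γ t)).im - h m| ≤ C) ∧
      τ ≤ T₀ := by
    obtain ⟨T, hT⟩ := eventually_atTop.1 (L.far m)
    exact ⟨max T τ, fun t ht => hT t ((le_max_left _ _).trans ht), le_max_right _ _⟩
  obtain ⟨R, hR⟩ := (isCompact_Icc (a := τ) (b := T₀)).exists_bound_of_continuousOn
      (Complex.continuous_re.comp (L.continuous_orbit m)).continuousOn
  simp only [Function.comp, Real.norm_eq_abs] at hR
  obtain ⟨T, hT, hTT₀⟩ := ((hside.eventually_gt_atTop R).and (eventually_gt_atTop T₀)).exists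
  obtain ⟨k, hk⟩ := L.exists_return_time hK m T (S := S) (isClosed_Icc.union isClosed_Icc)
    (by rintro (hmem | hmem) <;> linarith [hmem.1, hmem.2])
    (fun y hy => by
      have h1 := abs_sub_abs_le_abs_sub (W - h m) (W - y)
      rw [show W - h m - (W - y) = y - h m by ring] at h1
      have h2 : |W - y| ≤ η + 4 * Real.pi := by
        rw [abs_le]
        rcases hy with hy | hy <;> constructor <;> linarith [hy.1, hy.2]
      linarith)
  obtain ⟨V, v1, v2, v3, -, v5, v6, v7⟩ := L.growth.exists_path hK hK' k ((cosMap a b)^[m] (γ τ))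
    (fun j => by rw [← Function.iterate_add_apply]; exact hw _ (by omega))
  obtain ⟨x₁, hx₁, hx₁'⟩ := ((v3.eventually_gt_atTop R).and (eventually_ge_atTop 0)).exists
  set X := concat V (fun t => (cosMap a b)^[m] (γ t)) τ with hX
  have hXc : Continuous X := continuous_concat v1 (L.continuous_orbit m) v2
  have hleft : X (-x₁) = V x₁ := by rw [hX, concat_of_nonpos (by linarith), neg_neg]
  have hright : X (T - τ) = (cosMap a b)^[m] (γ T) := by
    rw [hX, concat_of_pos (by linarith), add_sub_cancel]
  have hεV : R < ε * (V x₁).re := by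
    have s1 := v6 x₁
    rcases hε with rfl | rfl
    · rw [one_mul] at hsame ⊢
      rwa [abs_of_pos (pos_of_mul_pos_right s1 hsame.le)] at hx₁
    · rw [neg_one_mul] at hsame ⊢
      rwa [abs_of_neg (by nlinarith)] at hx₁
  have hV_im : ∀ {s}, s ≤ 0 → |(X s).im - W| ≤ 4 * Real.pi := fun {s} hs => by
    rw [hX, concat_of_nonpos hs]; exact v5 (-s)
  obtain ⟨s, hs, t, ht, hst⟩ := hairpin_meets_translate_symm (α := -x₁) (β := T - τ) (g := X)
    (η := η) (B := B) (y₁ := W) (y₂ := h m) (ε := ε) (by linarith) hXc hε hj (by positivity)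
    (by rwa [abs_sub_comm]) ((hV_im (by linarith)).trans (by linarith))
    (by rw [hright]; exact (hT₀ T hTT₀.le).trans (by linarith)) (fun s hs => by
      rcases le_or_gt s 0 with hs0 | hs0
      · exact Or.inr (Or.inl ((hV_im hs0).trans (by linarith)))
      · rcases le_total (τ + s) T₀ with h1 | h1
        · left
          have h2 := hR (τ + s) ⟨by linarith, h1⟩
          rw [hleft, hright, hX, concat_of_pos hs0]
          have h3 : ε * ((cosMap a b)^[m] (γ (τ + s))).re ≤ R := by
            rw [abs_le] at h2
            rcases hε with rfl | rfl <;> linarith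
          constructor <;> linarith
        · right; right
          rw [hX, concat_of_pos hs0]
          exact (hT₀ _ h1).trans (by linarith))
  have him := congrArg Complex.im hst
  rw [im_add_ofReal_mul_I] at him
  -- Path against path is excluded by heights, path against ray by the return time. For ray against
  -- ray, one application of `E` removes the translation and injectivity of the next image gives `s
  -- = t`, against `η > 0`.
  rcases le_or_gt s 0 with hs0 | hs0 <;> rcases le_or_gt t 0 with ht0 | ht0
  · have h1 := abs_le.1 (hV_im hs0)
    have h2 := abs_le.1 (hV_im ht0)
    linarith
  · have h1 := abs_le.1 (hV_im hs0)
    have hmem : ((cosMap a b)^[m] (γ (τ + t))).im ∈ S := by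
      rw [hX, concat_of_pos ht0, ← hX] at him
      exact Or.inr ⟨by linarith, by linarith⟩
    obtain ⟨i, hi, hi'⟩ := hk (τ + t) (by linarith) (by linarith [ht.2]) hmem
    rw [hX, concat_of_pos ht0, concat_of_nonpos hs0] at hst
    rw [← hst, hη, re_cosMap_iter_add_int] at hi'
    exact absurd (v7 (-s) i hi) (not_le.2 hi')
  · have h1 := abs_le.1 (hV_im ht0)
    have hmem : ((cosMap a b)^[m] (γ (τ + s))).im ∈ S := by
      rw [hX, concat_of_pos hs0, ← hX] at him
      exact Or.inl ⟨by linarith, by linarith⟩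
    obtain ⟨i, hi, hi'⟩ := hk (τ + s) (by linarith) (by linarith [hs.2]) hmem
    rw [hX, concat_of_pos hs0, concat_of_nonpos ht0] at hst
    rw [← re_cosMap_iter_add_int a b _ j, ← hη, hst] at hi'
    exact absurd (v7 (-t) i hi) (not_le.2 hi')
  · have h1 := congrArg (cosMap a b) hst
    rw [hη, cosMap_add_int, hX, concat_of_pos hs0, concat_of_pos ht0,
      ← Function.iterate_succ_apply' (cosMap a b), ← Function.iterate_succ_apply' (cosMap a b)] at h1
    have h2 := L.inj _ (show τ < τ + s by linarith) (show τ < τ + t by linarith) h1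
    have h3 : s = t := by linarith
    rw [h3] at him
    linarith

/-- A single late time with ends in opposite half-planes controls all later heights; if there is
none, the hairpin argument applies at every late time. Either way `LandingRay.false_of_height` gives
a contradiction. -/
theorem LandingRay.not_noUniformTime (L : LandingRay a b τ γ h C) (hK : 12 * C + 4 ≤ K)
    (hK' : 4 * Real.exp C ≤ K) : ¬ NoUniformTime a b τ γ K := by
  intro hN
  have hC := L.growth.one_le
  obtain ⟨n₁, hn₁⟩ := eventually_atTop.1 (L.escaping.eventually_ge_atTop (3 * K + 30))
  have fin : ∀ M n, 0 ≤ M → (∀ m, n < m → |((cosMap a b)^[m] (γ τ)).im - h m| ≤ M) → False := by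
    intro M n hM hb
    refine L.false_of_height hK hN (M := M + 1) (by linarith) ?_
    filter_upwards [eventually_gt_atTop n] with m hm
    have h1 := hb m hm
    have h2 := abs_sub_abs_le_abs_sub ((cosMap a b)^[m] (γ τ)).im (h m)
    nlinarith [abs_nonneg (h m)]
  by_cases hex : ∃ n, n₁ ≤ n ∧ ∃ ε : ℝ, (ε = 1 ∨ ε = -1) ∧
      Tendsto (fun t => ε * ((cosMap a b)^[n] (γ t)).re) atTop atTop ∧
      ε * ((cosMap a b)^[n] (γ τ)).re < 0
  · obtain ⟨n, hn, ε, hε, hside, hopp⟩ := hex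
    obtain ⟨M, hM, hb⟩ := L.height_of_opposite hK hK' hN (n := n)
      (fun j hj => hn₁ j (hn.trans hj)) hε hside hopp
    exact fin M n hM hb
  · push Not at hex
    obtain ⟨M, hM, hb⟩ := L.height_of_same hK hK'
    refine fin M n₁ hM fun m hm => hb m (fun j hj => hn₁ j (by omega)) ?_
    obtain ⟨ε, hε, hside⟩ := L.exists_side m
    refine ⟨ε, hε, hside, (hex m hm.le ε hε hside).lt_of_ne fun h0 => ?_⟩
    have h1 := hn₁ m hm.le
    have h2 : ((cosMap a b)^[m] (γ τ)).re = 0 := by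
      rcases mul_eq_zero.1 h0.symm with h | h
      · rcases hε with rfl | rfl <;> norm_num at h
      · exact h
    rw [h2, abs_zero] at h1
    linarith

end

end CosineFamily

theorem corollary6p6 (a b c : ℂ) (ha : a ≠ 0) (hb : b ≠ 0)
    (hc : CosineFamily.IsCritCentre a b c)
    (R : CosineFamily.Symbol → Set ℂ) (hR : CosineFamily.IsStripLabelling a b c R)
    (s : CosineFamily.Address) (τ : ℝ) (g : ℝ → ℂ)
    (hg : CosineFamily.IsDynamicRay a b c R s τ g)
    (w : ℂ) (hland : CosineFamily.LandsAt τ g w) (hw : CosineFamily.IsEscaping a b w) :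
    CosineFamily.EscapeUniformly a b τ g w := by
  obtain ⟨G, rfl, hG⟩ := hg
  obtain ⟨γ, C, L, rfl, hγ⟩ := CosineFamily.exists_landingRay ha hb hc hR hG hland hw
  intro r
  -- The last entry makes `K - (2C + 2)`, the bound left for the whole ray, exceed `r`.
  set K := max (12 * C + 4) (max (4 * Real.exp C) (r + 2 * C + 3)) with hK
  have h1 : 12 * C + 4 ≤ K := le_max_left _ _
  have h2 : 4 * Real.exp C ≤ K := (le_max_left _ _).trans (le_max_right _ _)
  have h3 : r + 2 * C + 3 ≤ K := (le_max_right _ _).trans (le_max_right _ _)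
  obtain ⟨n, hn⟩ := L.uniform_of_not_noUniformTime h1 (L.not_noUniformTime h1 h2)
  obtain ⟨m, hm⟩ := Filter.eventually_atTop.1 (L.escaping.eventually_gt_atTop r)
  refine ⟨max n m, fun k hk => ⟨hm k ((le_max_right _ _).trans hk), fun t ht => ?_⟩⟩
  rw [← hγ t ht]
  linarith [hn k ((le_max_left _ _).trans hk) t ht]
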